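/- Let $q_1,q_2\in\mathbb C\setminus\{0,1\}$, $\lambda_{12}\in\mathbb C\setminus\{0\}$, $\lambda_{21}=\lambda_{12}^{-1}$. Let $A$ be the rank-two quantized Weyl algebra, i.e. the unital $\mathbb C$-algebra with generators $X_1,X_2,Y_1,Y_2$ and relations $$X_1X_2=q_1\lambda_{12}X_2X_1,\quad Y_1Y_2=\lambda_{12}Y_2Y_1,\quad X_1Y_2=\lambda_{21}Y_2X_1,\quad X_2Y_1=q_1\lambda_{12}Y_1X_2,$$ $$X_1Y_1-q_1Y_1X_1=1,\qquad X_2Y_2-q_2Y_2X_2=1+(q_1-1)Y_1X_1 .$$ Put $t_i=Y_iX_i$ and let $R$ be the commutative subalgebra generated by $t_1,t_2$. For a maximal ideal $\mathfrak m$ of $R$ and an $A$-module $M$ put $M_{\mathfrak m}=\{v\in M:\mathfrak m v=0\}$. $M$ is a *weight module* if $M=\bigoplus_{\mathfrak m}M_{\mathfrak m}$ over all maximal ideals of $R$. $M$ has *no proper inner breaks* if for all $\mathfrak m$ with $M_{\mathfrak m}\ne0$ and every word $a=Z_1\cdots Z_k$ in the generators with $aM_{\mathfrak m}\neq0$ one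 has $a^*a\notin\mathfrak m$, where $a^*=Z_k^*\cdots Z_1^*$, $X_i^*=Y_i$, $Y_i^*=X_i$. **Theorem.** Every simple weight $A$-module $M$ with no proper inner breaks and with all weight spaces $M_{\mathfrak m}$ finite-dimensional is isomorphic to one of the modules 1–12 below; that is, $M$ has a basis on which the generators act by the formulas of one of the following cases. Notation: $[k]_q=(q^k-1)/(q-1)$ for $k\in\mathbb Z$; $o_i$ is the order of $q_i$ if $q_i$ is a root of unity; $\overline k=\max\{0,k\}$; the parameters $\rho,\mu,\lambda$ are nonzero complex numbers; $K_2=\{(k,l)\in\mathbb Z^2: q_1^kq_2^l=1\}$. 1. Basis $v_0$: $X_1v_0=\rho v_0$, $X_2v_0=0$, $Y_1v_0=\rho^{-1}(1-q_1)^{-1}v_0$, $Y_2v_0=0$. 2. $q_1$ a root of unity. Basis $v_j$, $0\le j<o_1$: $X_1v_0=0$, $X_1v_j=[j]_{q_1}v_{j-1}$ for $j>0$; $Y_1v_j=v_{j+1}$ for $j<o_1-1$, $Y_1v_{o_1-1}=0$; $X_2v_j=\rho\lambda_{12}^jq_1^jv_j$; $Y_2v_j=(1-q_2)^{-1}\rho^{-1}\lambda_{21}^jv_j$.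 3. $q_1$ not a root of unity. Basis $v_j$, $j\ge0$: $X_1v_0=0$, $X_1v_j=[j]_{q_1}v_{j-1}$ for $j\geq 1$; $Y_1v_j=v_{j+1}$; $X_2v_j=\rho\lambda_{12}^jq_1^jv_j$; $Y_2v_j=(1-q_2)^{-1}\rho^{-1}\lambda_{21}^jv_j$. 4. $q_1$ not a root of unity. Basis $v_j$, $j\ge0$: $X_1v_j=v_{j+1}$; $Y_1v_0=0$, $Y_1v_j=[-j]_{q_1}v_{j-1}$ for $j>0$; $X_2v_j=(q_1\lambda_{12})^{-j}\rho v_j$; $Y_2v_j=\lambda_{12}^{j}q_1^{-1}(1-q_2)^{-1}\rho^{-1}v_j$. 5. $q_1$ a root of unity, $\lambda\notin q_1^{\mathbb Z}$, $\lambda_{12}^{o_1}$ a root of unity of order $r$. Basis $w_{ij}$, $0\le i<o_1$, $0\le j<r$: $X_1w_{ij}=w_{i+1,j}$ if $i<o_1-1$, $X_1w_{o_1-1,j}=\lambda_{12}^{o_1j}\rho w_{0j}$; $Y_1w_{0j}=(1-\lambda q_1)(1-q_1)^{-1}\lambda_{12}^{-o_1j}\rho^{-1}w_{o_1-1,j}$,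 $Y_1w_{ij}=(1-\lambda q_1^{1-i})(1-q_1)^{-1}w_{i-1,j}$ if $i>0$; $X_2w_{ij}=q_1^{-i}\lambda_{21}^iw_{i,j+1}$ if $j<r-1$, $X_2w_{i,r-1}=q_1^{-i}\lambda_{21}^i\mu w_{i0}$; $Y_2w_{i0}=\lambda_{12}^i\mu^{-1}\lambda(1-q_2)^{-1}w_{i,r-1}$, $Y_2w_{ij}=\lambda_{12}^i\lambda(1-q_2)^{-1}w_{i,j-1}$ if $j>0$. 6. $q_1$ not a root of unity, $\lambda\notin q_1^{\mathbb Z}$. Basis $v_j$, $j\in\mathbb Z$: $X_1v_j=v_{j+1}$, $X_2v_j=q_1^{-j}\lambda_{12}^{-j}\rho v_j$, $Y_1v_j=\frac{1-\lambda q_1^{1-j}}{1-q_1}v_{j-1}$, $Y_2v_j=\lambda_{12}^j\lambda(1-q_2)^{-1}\rho^{-1}v_j$. In cases 7–10 the $Y_i$ are determined by $Y_1X_1w=(1-q_1)^{-1}w$ and $Y_2X_2w=\lambda q_1^{-i}q_2^{-j}w$ for $w=w_{ij}$ or $w=w_{ijk}$, and for integers $k,n$ with $m=\min\{|k|,|n|\}$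 we put $m_1(k,n)=(1-q_1)^{-m}$, $m_2(k,n)=\lambda^mq_2^{(1-2n+\mathrm{sgn}(n)m)m/2}$, $c(k,n)=q_2^{(k-n)m-(\mathrm{sgn}k-\mathrm{sgn}n)m^2/2}$ if $kn<0$, and $m_1=m_2=c=1$ if $kn\ge0$; further $r_{(g_1,g_2)}=(1-q_1)^{|g_1|}\lambda^{-|g_2|}q_2^{(g_2-1)|g_2|/2}$. 7. $K_2=0$. Basis $w_{ij}$, $i,j\in\mathbb Z$: $X_1w_{ij}=w_{i+1,j}$ if $i\ge0$ and $(1-q_1)^{-1}w_{i+1,j}$ if $i<0$; $X_2w_{ij}=(q_1\lambda_{12})^{-i}w_{i,j+1}$ if $j\ge0$ and $(q_1\lambda_{12})^{-i}\lambda q_2^{-j}w_{i,j+1}$ if $j<0$. 8. $K_2=\mathbb Z(a,b)$ with $a>0$. Basis $w_{ij}$, $0\le i<a$, $j\in\mathbb Z$: $X_1w_{ij}=w_{i+1,j}$ if $i<a-1$, $X_1w_{a-1,j}=r_{(0,b)}q_1^{a(\overline j+\overline{-b})}\lambda_{12}^{a(j-b)}\rho\, m_2(j,-b)\,w_{0,j-b}$;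 $X_2w_{ij}=q_1^{-i}\lambda_{21}^iw_{i,j+1}$ if $j\ge0$ and $q_1^{-i}\lambda_{21}^i\lambda q_2^{-j}w_{i,j+1}$ if $j<0$. 9. $K_2=\mathbb Z(0,b)$ with $b>0$. Basis $w_{ij}$, $i\in\mathbb Z$, $0\le j<b$: $X_1w_{ij}=w_{i+1,j}$ if $i\ge0$ and $(1-q_1)^{-1}w_{i+1,j}$ if $i<0$; $X_2w_{ij}=(q_1\lambda_{12})^{-i}w_{i,j+1}$ if $j<b-1$, $X_2w_{i,b-1}=(q_1\lambda_{12})^{-i}\rho w_{i0}$. 10. $K_2$ of rank two. Here, for some $\lambda$ and for any choice of a basis $\mathbf a=(a_1,a_2),\mathbf b=(b_1,b_2)$ of $K_2$ with $a_1,b_1\ge0$, $d=a_1b_2-b_1a_2>0$, and of integers $a_2',b_2'$ with $a_2'a_2+b_2'b_2=d_2:=\gcd(a_2,b_2)$ and $s:=-a_2'a_1-b_2'b_1\in\{0,\dots,d_1-1\}$, $d_1:=d/d_2$ (such choices exist), the following holds with suitable $\rho,\mu$. The number $\nu=\lambda_{12}^dq_1^{a_1\overline{b_2}-b_1\overline{a_2}}c(a_2,b_2)$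 is a root of unity, of order $r$ say. Put $\kappa_g(p)=\lambda_{12}^{-g_1g_2p(p-1)/2}\,q_1^{-g_1\overline{g_2}p(p-1)/2}$ for $p\ge0$, $\kappa_g(p)=\lambda_{12}^{-g_1g_2p(p-1)/2}\,r_g^{-p}\,q_1^{g_1\overline{-g_2}p(p-1)/2}$ for $p<0$, $C(p,n)^{-1}=\kappa_{\mathbf a}(p)\kappa_{\mathbf b}(n)\,q_1^{-nb_1\overline{pa_2}}\lambda_{12}^{-nb_1pa_2}\,m_1(pa_1,nb_1)\,m_2(pa_2,nb_2)$, $C_1=C(b_2/d_2,-a_2/d_2)$, $C_2=C(a_2',b_2')$. Define integers by $k-a_2/d_2=rk_1'+k_1''$, $b_2'+k=rk_2'+k_2''$, $k_2''-a_2/d_2=rk_3'+k_3''$, $0\le k_1'',k_2'',k_3''<r$. Basis $w_{ijk}$, $0\le i<d_1$, $0\le j<d_2$, $0\le k<r$: $X_1w_{ijk}=w_{i+1,j,k}$ if $i<d_1-1$, and $X_1w_{d_1-1,j,k}=(q_1\lambda_{12})^{jd_1}C_1\nu^{(b_2/d_2)k_1''}\rho^{b_2/d_2}\mu^{k_1'}w_{0,j,k_1''}$;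 $X_2w_{ijk}=(q_1\lambda_{12})^{-i}w_{i,j+1,k}$ if $j<d_2-1$; and for $j=d_2-1$, $X_2w_{ijk}=(q_1\lambda_{12})^{-i}(1-q_1)^sC_2\nu^{a_2'k_2''}\rho^{a_2'}\mu^{k_2'}w_{i+s,0,k_2''}$ if $i+s\le d_1-1$, $X_2w_{ijk}=(q_1\lambda_{12})^{-i}(1-q_1)^sC_2C_1\nu^{a_2'k_2''+k_3''b_2/d_2}\rho^{a_2'+b_2/d_2}\mu^{k_2'+k_3'}w_{i+s-d_1,0,k_3''}$ if $i+s>d_1-1$. In cases 11–12, $\alpha_1,\alpha_2\in\mathbb C$ are such that $\gamma_1:=1+(q_1-1)\alpha_1\ne0$ and $\gamma_2:=\gamma_1+(q_2-1)\alpha_2\neq0$. 11. $q_1,q_2$ roots of unity, $\gamma_1\notin q_1^{\mathbb Z}$, $\gamma_2\notin q_2^{\mathbb Z}\gamma_1$, $\lambda_{12}^{o_1o_2}$ a root of unity of order $r$. Basis $w_{ijk}$, $0\le i<o_1$, $0\le j<o_2$, $0\le k<r$: $X_1w_{ijk}=w_{i+1,j,k}$ if $i<o_1-1$, $X_1w_{o_1-1,j,k}=\lambda_{12}^{o_1(o_2k+j)}\rho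 w_{0jk}$; $X_2w_{ijk}=(q_1\lambda_{12})^{-i}u$ with $u=w_{i,j+1,k}$ if $j<o_2-1$, $u=w_{i,0,k+1}$ if $j=o_2-1$, $k<r-1$, and $u=\mu w_{i00}$ if $j=o_2-1$, $k=r-1$; the $Y_i$ are determined by $Y_1X_1w_{ijk}=q_1^{-i}(\alpha_1-[i]_{q_1})w_{ijk}$, $Y_2X_2w_{ijk}=q_1^{-i}q_2^{-j}(\alpha_2-[j]_{q_2}\gamma_1)w_{ijk}$. 12. All other such $q_1,q_2,\alpha_1,\alpha_2$, normalized as follows. With $\gamma_0=1$, for $i=1,2$: if $q_i$ is a root of unity, then $I_i=\{0,\dots,o_i-1\}$ and either $\gamma_i=q_i^{-1}\gamma_{i-1}$ or $\gamma_i\notin q_i^{\mathbb Z}\gamma_{i-1}$; if $q_i$ is not a root of unity, then either $I_i=\mathbb Z$ and $\gamma_i\notin q_i^{\mathbb Z}\gamma_{i-1}$, or $I_i=\mathbb Z_{\ge0}$ and $\gamma_i=q_i^{-1}\gamma_{i-1}$, or $I_i=\mathbb Z_{\le0}$ and $\gamma_i=\gamma_{i-1}$. Excluded is the case that both $q_i$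 are roots of unity and $\gamma_i\notin q_i^{\mathbb Z}\gamma_{i-1}$ for both $i$. Basis $w_{ij}$, $(i,j)\in I_1\times I_2$: $X_1w_{ij}=w_{i+1,j}$ if $i+1\in I_1$; $=\rho\lambda_{12}^{o_1j}w_{0j}$ if $i+1\notin I_1$, $q_1$ is a root of unity and $\alpha_1\ne[i]_{q_1}$; $=0$ otherwise. $X_2w_{ij}=(q_1\lambda_{12})^{-i}u$ with $u=w_{i,j+1}$ if $j+1\in I_2$; $u=\mu w_{i0}$ if $j+1\notin I_2$, $q_2$ is a root of unity and $\alpha_2\neq[j]_{q_2}\gamma_1$; $u=0$ otherwise. $Y_1w_{ij}=q_1^{-i+1}(\alpha_1-[i-1]_{q_1})u$ with $u=w_{i-1,j}$ if $i-1\in I_1$; $u=(\rho\lambda_{12}^{o_1j})^{-1}w_{o_1-1,j}$ if $i-1\notin I_1$, $q_1$ is a root of unity and $\alpha_1\ne[i-1]_{q_1}$; $u=0$ otherwise. $Y_2w_{ij}=\lambda_{12}^{i}q_2^{-j+1}(\alpha_2-[j-1]_{q_2}\gamma_1)u$ with $u=w_{i,j-1}$ if $j-1\in I_2$; $u=\mu^{-1}w_{i,o_2-1}$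 if $j-1\notin I_2$, $q_2$ is a root of unity and $\alpha_2\neq[j-1]_{q_2}\gamma_1$; $u=0$ otherwise. -/

import Mathlib

namespace QWeyl

/-! ### The quantized Weyl algebra of rank two -/

/-- The generators `x₁, x₂` (as `x 0, x 1`) and `y₁, y₂` (as `y 0, y 1`). -/
inductive Gen : Type
  | x (i : Fin 2) : Gen
  | y (i : Fin 2) : Gen

/-- The exchange `x_i ↔ y_i`, written `Z ↦ Z^*`. -/
def Gen.adj : Gen → Gen
  | .x i => .y i
  | .y i => .x i

/-- The free generator attached to `g`. -/
abbrev fr (g : Gen) : FreeAlgebra ℂ Gen := FreeAlgebra.ι ℂ g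

/-- The defining relations, with `l = λ₁₂` and `λ₂₁ = l⁻¹`. -/
inductive Rel (q₁ q₂ l : ℂ) : FreeAlgebra ℂ Gen → FreeAlgebra ℂ Gen → Prop
  | xx : Rel q₁ q₂ l (fr (.x 0) * fr (.x 1)) ((q₁ * l) • (fr (.x 1) * fr (.x 0)))
  | yy : Rel q₁ q₂ l (fr (.y 0) * fr (.y 1)) (l • (fr (.y 1) * fr (.y 0)))
  | xy : Rel q₁ q₂ l (fr (.x 0) * fr (.y 1)) (l⁻¹ • (fr (.y 1) * fr (.x 0)))
  | yx : Rel q₁ q₂ l (fr (.x 1) * fr (.y 0)) ((q₁ * l) • (fr (.y 0) * fr (.x 1)))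
  | one : Rel q₁ q₂ l (fr (.x 0) * fr (.y 0) - q₁ • (fr (.y 0) * fr (.x 0))) 1
  | two : Rel q₁ q₂ l (fr (.x 1) * fr (.y 1) - q₂ • (fr (.y 1) * fr (.x 1)))
      (1 + (q₁ - 1) • (fr (.y 0) * fr (.x 0)))

/-- The quantized Weyl algebra of rank two with parameters `q₁`, `q₂` and `l = λ₁₂`. -/
abbrev Alg (q₁ q₂ l : ℂ) : Type := RingQuot (Rel q₁ q₂ l)

/-- The image of a generator in the quantized Weyl algebra. -/
noncomputable def gen (q₁ q₂ l : ℂ) (g : Gen) : Alg q₁ q₂ l :=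
  RingQuot.mkAlgHom ℂ (Rel q₁ q₂ l) (fr g)

/-- The element `t_i = y_i x_i`. -/
noncomputable def t (q₁ q₂ l : ℂ) (i : Fin 2) : Alg q₁ q₂ l :=
  gen q₁ q₂ l (.y i) * gen q₁ q₂ l (.x i)

/-- The subalgebra `R = ℂ[t₁, t₂]`. It is commutative (`t_comm`), so that its left ideals are its
ideals. -/
noncomputable def R (q₁ q₂ l : ℂ) : Subalgebra ℂ (Alg q₁ q₂ l) :=
  Algebra.adjoin ℂ (Set.range (t q₁ q₂ l))

theorem t_comm (q₁ q₂ l : ℂ) : Commute (t q₁ q₂ l 0) (t q₁ q₂ l 1) := by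
  have hxx := RingQuot.mkAlgHom_rel ℂ (Rel.xx (q₁ := q₁) (q₂ := q₂) (l := l))
  have hyy := RingQuot.mkAlgHom_rel ℂ (Rel.yy (q₁ := q₁) (q₂ := q₂) (l := l))
  have hxy := RingQuot.mkAlgHom_rel ℂ (Rel.xy (q₁ := q₁) (q₂ := q₂) (l := l))
  have hyx := RingQuot.mkAlgHom_rel ℂ (Rel.yx (q₁ := q₁) (q₂ := q₂) (l := l))
  simp only [map_mul, map_smul] at hxx hyy hxy hyx
  simp only [Commute, SemiconjBy, t, gen]
  generalize RingQuot.mkAlgHom ℂ (Rel q₁ q₂ l) (fr (.x 0)) = a at *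
  generalize RingQuot.mkAlgHom ℂ (Rel q₁ q₂ l) (fr (.x 1)) = b at *
  generalize RingQuot.mkAlgHom ℂ (Rel q₁ q₂ l) (fr (.y 0)) = c at *
  generalize RingQuot.mkAlgHom ℂ (Rel q₁ q₂ l) (fr (.y 1)) = d at *
  have e : l⁻¹ * (q₁ * l * l) = q₁ * l := by
    by_cases h : l = 0
    · simp [h]
    · field_simp
  calc c * a * (d * b) = c * (a * d) * b := by simp only [mul_assoc]
    _ = l⁻¹ • ((c * d) * (a * b)) := by rw [hxy]; simp [mul_assoc]
    _ = (q₁ * l) • (d * c * (b * a)) := by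
        rw [hyy, hxx]; simp only [smul_mul_assoc, mul_smul_comm, smul_smul]; rw [e]
    _ = d * (b * c) * a := by
        rw [hyx]
        simp only [smul_mul_assoc, mul_smul_comm, mul_assoc]
    _ = d * b * (c * a) := by simp only [mul_assoc]

/-- The element of the algebra given by a word in the generators. -/
noncomputable def word (q₁ q₂ l : ℂ) (w : List Gen) : Alg q₁ q₂ l :=
  (w.map (gen q₁ q₂ l)).prod

/-- The word `Z_k^* ⋯ Z_1^*` for `Z_1 ⋯ Z_k`. -/
def adjWord (w : List Gen) : List Gen := (w.map Gen.adj).reverse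

/-! ### Weight modules -/

section Weight

variable (q₁ q₂ l : ℂ) (M : Type*) [AddCommGroup M] [Module ℂ M] [Module (Alg q₁ q₂ l) M]
  [IsScalarTower ℂ (Alg q₁ q₂ l) M]

/-- The weight space `M_𝔪 = {v | 𝔪 v = 0}`. -/
def weightSpace (m : Ideal (R q₁ q₂ l)) : Submodule ℂ M where
  carrier := {v | ∀ r ∈ m, (r : Alg q₁ q₂ l) • v = 0}
  add_mem' := fun ha hb r hr => by rw [smul_add, ha r hr, hb r hr, add_zero]
  zero_mem' := fun r _ => smul_zero _
  smul_mem' := fun c v hv r hr => by rw [smul_comm, hv r hr, smul_zero]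

open Classical in
/-- `M` is the direct sum of its weight spaces over all maximal ideals of `R`. -/
def IsWeightModule : Prop :=
  DirectSum.IsInternal
    (fun m : {m : Ideal (R q₁ q₂ l) // m.IsMaximal} => weightSpace q₁ q₂ l M m.1)

/-- All weight spaces are finite-dimensional. -/
def IsLocallyFinite : Prop :=
  ∀ m : Ideal (R q₁ q₂ l), m.IsMaximal → FiniteDimensional ℂ (weightSpace q₁ q₂ l M m)

/-- No proper inner breaks: for every maximal ideal `𝔪` in the support and every word `a` with
`a M_𝔪 ≠ 0`, the element `a^* a` (which lies in `R`) is not in `𝔪`. -/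
def NoProperInnerBreaks : Prop :=
  ∀ m : Ideal (R q₁ q₂ l), m.IsMaximal → weightSpace q₁ q₂ l M m ≠ ⊥ →
    ∀ w : List Gen, (∃ v ∈ weightSpace q₁ q₂ l M m, word q₁ q₂ l w • v ≠ 0) →
      ∀ r ∈ m, (r : Alg q₁ q₂ l) ≠ word q₁ q₂ l (adjWord w) * word q₁ q₂ l w

end Weight

/-! ### The explicit modules -/

/-- Four operators on `M`, standing for the action of `x₁, x₂, y₁, y₂`. -/
structure Action (M : Type*) where
  X₁ : M → M
  X₂ : M → M
  Y₁ : M → M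
  Y₂ : M → M

/-- The action of the four generators on a module. -/
noncomputable def genAction (q₁ q₂ l : ℂ) (M : Type*) [AddCommGroup M]
    [Module (Alg q₁ q₂ l) M] : Action M where
  X₁ := fun v => gen q₁ q₂ l (.x 0) • v
  X₂ := fun v => gen q₁ q₂ l (.x 1) • v
  Y₁ := fun v => gen q₁ q₂ l (.y 0) • v
  Y₂ := fun v => gen q₁ q₂ l (.y 1) • v

/-- The vectors `w s`, `s ∈ S`, form a basis of `M`. -/
def IsBasisOn {ι M : Type*} [AddCommGroup M] [Module ℂ M] (S : Set ι) (w : ι → M) : Prop :=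
  LinearIndepOn ℂ w S ∧ Submodule.span ℂ (w '' S) = ⊤

/-- The `q`-integer `[k]_q`, for `q ≠ 1` and `k ∈ ℤ`. -/
noncomputable def qint (q : ℂ) (k : ℤ) : ℂ := (q ^ k - 1) / (q - 1)

/-- The kernel of `(k, n) ↦ q₁ ^ k q₂ ^ n` on `ℤ²`. -/
def K₂ (q₁ q₂ : ℂ) : Set (ℤ × ℤ) := {g | q₁ ^ g.1 * q₂ ^ g.2 = 1}

/-- On the weight space at `t₁ = 1/(1-q₁)`: the scalar `c` in `Z₁^k Z₁^n = c Z₁^{k+n}`, where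
`Z^k = X^k` for `k ≥ 0` and `Z^k = Y^{-k}` for `k < 0`. -/
noncomputable def mul₁ (q₁ : ℂ) (k n : ℤ) : ℂ :=
  if k * n < 0 then (1 - q₁) ^ (-min |k| |n|) else 1

/-- On the weight space at `t₁ = 1/(1-q₁)`, `t₂ = z`: the scalar `c` in
`Z₂^k Z₂^n = c Z₂^{k+n}`. -/
noncomputable def mul₂ (q₂ z : ℂ) (k n : ℤ) : ℂ :=
  if k * n < 0 then
    z ^ min |k| |n| * q₂ ^ ((1 - 2 * n + n.sign * min |k| |n|) * min |k| |n| / 2)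
  else 1

/-- The scalar `r_g` with `(a_g)⁻¹ = r_g a_g^*`, `a_g = Z₁^{g₁} Z₂^{g₂}`, on the same weight
space. -/
noncomputable def rInv (q₁ q₂ z : ℂ) (g₁ g₂ : ℤ) : ℂ :=
  (1 - q₁) ^ |g₁| * z ^ (-|g₂|) * q₂ ^ ((g₂ - 1) * |g₂| / 2)

/-- The scalar `c(k, n)` with `Z₂^k Z₂^n = c(k, n) Z₂^n Z₂^k` on the same weight space. -/
noncomputable def swap₂ (q₂ : ℂ) (k n : ℤ) : ℂ :=
  if k * n < 0 then
    q₂ ^ ((k - n) * min |k| |n| - (k.sign - n.sign) * min |k| |n| ^ 2 / 2)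
  else 1

/-- The scalar `c` with `(Z₁^{g₁} Z₂^{g₂})^p = c Z₁^{p g₁} Z₂^{p g₂}` on the same weight space,
for `(g₁, g₂)` in its stabilizer `K₂` and `p ∈ ℤ`. -/
noncomputable def pow₂ (q₁ q₂ l z : ℂ) (g₁ g₂ p : ℤ) : ℂ :=
  l ^ (-(g₁ * g₂ * (p * (p - 1) / 2))) *
    if 0 ≤ p then q₁ ^ (-(g₁ * max 0 g₂ * (p * (p - 1) / 2)))
    else rInv q₁ q₂ z g₁ g₂ ^ (-p) * q₁ ^ (g₁ * max 0 (-g₂) * (p * (p - 1) / 2))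

/-- A basis `(a₁, a₂)`, `(b₁, b₂)` of `K₂` (in the case that `K₂` has rank two) together with
Bézout coefficients, normalized as in the description of the modules. -/
structure RankTwoChoice (q₁ q₂ : ℂ) where
  a₁ : ℤ
  a₂ : ℤ
  b₁ : ℤ
  b₂ : ℤ
  a' : ℤ
  b' : ℤ
  a₁_nonneg : 0 ≤ a₁
  b₁_nonneg : 0 ≤ b₁
  det_pos : 0 < a₁ * b₂ - b₁ * a₂
  mem_iff : ∀ g : ℤ × ℤ,
    g ∈ K₂ q₁ q₂ ↔ ∃ m n : ℤ, g.1 = m * a₁ + n * b₁ ∧ g.2 = m * a₂ + n * b₂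
  bezout : a' * a₂ + b' * b₂ = (Int.gcd a₂ b₂ : ℤ)
  shift_nonneg : 0 ≤ -a' * a₁ - b' * b₁
  shift_lt : -a' * a₁ - b' * b₁ < (a₁ * b₂ - b₁ * a₂) / (Int.gcd a₂ b₂ : ℤ)

namespace RankTwoChoice

variable {q₁ q₂ : ℂ} (c : RankTwoChoice q₁ q₂)

/-- The determinant `d`. -/
def d : ℤ := c.a₁ * c.b₂ - c.b₁ * c.a₂

/-- `d₂ = gcd (a₂, b₂)`. -/
def d₂ : ℤ := (Int.gcd c.a₂ c.b₂ : ℤ)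

/-- `d₁ = d / d₂`. -/
def d₁ : ℤ := c.d / c.d₂

/-- The shift `s = -a' a₁ - b' b₁`. -/
def s : ℤ := -c.a' * c.a₁ - c.b' * c.b₁

/-- The scalar `ν` by which `Z₁^{a₁} Z₂^{a₂}` and `Z₁^{b₁} Z₂^{b₂}` commute. -/
noncomputable def nu (l : ℂ) : ℂ :=
  l ^ c.d * q₁ ^ (c.a₁ * max 0 c.b₂ - c.b₁ * max 0 c.a₂) * swap₂ q₂ c.a₂ c.b₂

/-- The scalar `C` with
`C (Z₁^{a₁} Z₂^{a₂})^p (Z₁^{b₁} Z₂^{b₂})^n = Z₁^{p a₁ + n b₁} Z₂^{p a₂ + n b₂}`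
on the weight space. -/
noncomputable def const (l z : ℂ) (p n : ℤ) : ℂ :=
  (pow₂ q₁ q₂ l z c.a₁ c.a₂ p * pow₂ q₁ q₂ l z c.b₁ c.b₂ n *
    (q₁ ^ (-(n * c.b₁ * max 0 (p * c.a₂))) * l ^ (-(n * c.b₁ * (p * c.a₂))) *
      mul₁ q₁ (p * c.a₁) (n * c.b₁) * mul₂ q₂ z (p * c.a₂) (n * c.b₂)))⁻¹

/-- `C₁`, belonging to `X₁^{d₁}`. -/
noncomputable def C₁ (l z : ℂ) : ℂ := c.const l z (c.b₂ / c.d₂) (-(c.a₂ / c.d₂))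

/-- `C₂`, belonging to `Z₁^{-s} Z₂^{d₂}`. -/
noncomputable def C₂ (l z : ℂ) : ℂ := c.const l z c.a' c.b'

end RankTwoChoice

section Families

variable {M : Type*} [AddCommGroup M] [Module ℂ M] (q₁ q₂ l : ℂ) (T : Action M)

/-- Weight `𝔫₀ = (t₁ - 1/(1-q₁), t₂)`. -/
def FamN0 : Prop :=
  ∃ (ρ : ℂ) (v : M), ρ ≠ 0 ∧ v ≠ 0 ∧ Submodule.span ℂ {v} = ⊤ ∧
    T.X₁ v = ρ • v ∧
    T.X₂ v = 0 ∧
    T.Y₁ v = (ρ⁻¹ * (1 - q₁)⁻¹) • v ∧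
    T.Y₂ v = 0

/-- Weights `𝔫_λ^{(1)} = (t₁ - (1-λ)/(1-q₁), t₂ - λ/(1-q₂))`, with a `1`-break, `q₁` a root of
unity. -/
def FamN1Fin : Prop :=
  0 < orderOf q₁ ∧ ∃ (ρ : ℂ) (v : ℤ → M), ρ ≠ 0 ∧
    IsBasisOn (Set.Ico 0 (orderOf q₁ : ℤ)) v ∧
    ∀ j ∈ Set.Ico 0 (orderOf q₁ : ℤ),
      T.X₁ (v j) = (if j = 0 then 0 else qint q₁ j • v (j - 1)) ∧
      T.Y₁ (v j) = (if j < (orderOf q₁ : ℤ) - 1 then v (j + 1) else 0) ∧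
      T.X₂ (v j) = (ρ * l ^ j * q₁ ^ j) • v j ∧
      T.Y₂ (v j) = ((1 - q₂)⁻¹ * ρ⁻¹ * (l⁻¹) ^ j) • v j

/-- Weights `𝔫_λ^{(1)}`, with a `1`-break, `q₁` not a root of unity, highest weight case. -/
def FamN1High : Prop :=
  orderOf q₁ = 0 ∧ ∃ (ρ : ℂ) (v : ℤ → M), ρ ≠ 0 ∧
    IsBasisOn (Set.Ici 0) v ∧
    ∀ j ∈ Set.Ici (0 : ℤ),
      T.X₁ (v j) = (if j = 0 then 0 else qint q₁ j • v (j - 1)) ∧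
      T.Y₁ (v j) = v (j + 1) ∧
      T.X₂ (v j) = (ρ * l ^ j * q₁ ^ j) • v j ∧
      T.Y₂ (v j) = ((1 - q₂)⁻¹ * ρ⁻¹ * (l⁻¹) ^ j) • v j

/-- Weights `𝔫_λ^{(1)}`, with a `1`-break, `q₁` not a root of unity, lowest weight case. -/
def FamN1Low : Prop :=
  orderOf q₁ = 0 ∧ ∃ (ρ : ℂ) (v : ℤ → M), ρ ≠ 0 ∧
    IsBasisOn (Set.Ici 0) v ∧
    ∀ j ∈ Set.Ici (0 : ℤ),
      T.X₁ (v j) = v (j + 1) ∧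
      T.Y₁ (v j) = (if j = 0 then 0 else qint q₁ (-j) • v (j - 1)) ∧
      T.X₂ (v j) = ((q₁ * l) ^ (-j) * ρ) • v j ∧
      T.Y₂ (v j) = (l ^ j * q₁⁻¹ * (1 - q₂)⁻¹ * ρ⁻¹) • v j

/-- Weights `𝔫_z^{(1)}`, without `1`-break, `q₁` a root of unity. -/
def FamN1Cyc : Prop :=
  0 < orderOf q₁ ∧ 0 < orderOf (l ^ orderOf q₁) ∧
  ∃ (z ρ μ : ℂ) (w : ℤ × ℤ → M), z ≠ 0 ∧ (∀ k : ℤ, z ≠ q₁ ^ k) ∧ ρ ≠ 0 ∧ μ ≠ 0 ∧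
    ∃ o r : ℤ, o = orderOf q₁ ∧ r = orderOf (l ^ orderOf q₁) ∧
    IsBasisOn (Set.Ico 0 o ×ˢ Set.Ico 0 r) w ∧
    ∀ i ∈ Set.Ico 0 o, ∀ j ∈ Set.Ico 0 r,
      T.X₁ (w (i, j)) =
        (if i < o - 1 then w (i + 1, j) else (l ^ (o * j) * ρ) • w (0, j)) ∧
      T.Y₁ (w (i, j)) =
        (if i = 0 then
          ((1 - z * q₁) * (1 - q₁)⁻¹ * l ^ (-(o * j)) * ρ⁻¹) • w (o - 1, j)
        else ((1 - z * q₁ ^ (1 - i)) * (1 - q₁)⁻¹) • w (i - 1, j)) ∧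
      T.X₂ (w (i, j)) =
        (if j < r - 1 then (q₁ ^ (-i) * (l⁻¹) ^ i) • w (i, j + 1)
        else (q₁ ^ (-i) * (l⁻¹) ^ i * μ) • w (i, 0)) ∧
      T.Y₂ (w (i, j)) =
        (if j = 0 then (l ^ i * μ⁻¹ * z * (1 - q₂)⁻¹) • w (i, r - 1)
        else (l ^ i * z * (1 - q₂)⁻¹) • w (i, j - 1))

/-- Weights `𝔫_z^{(1)}`, without `1`-break, `q₁` not a root of unity. -/
def FamN1Inf : Prop :=
  orderOf q₁ = 0 ∧ ∃ (z ρ : ℂ) (v : ℤ → M), z ≠ 0 ∧ (∀ k : ℤ, z ≠ q₁ ^ k) ∧ ρ ≠ 0 ∧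
    IsBasisOn Set.univ v ∧
    ∀ j : ℤ,
      T.X₁ (v j) = v (j + 1) ∧
      T.X₂ (v j) = (q₁ ^ (-j) * l ^ (-j) * ρ) • v j ∧
      T.Y₁ (v j) = ((1 - z * q₁ ^ (-j + 1)) / (1 - q₁)) • v (j - 1) ∧
      T.Y₂ (v j) = (l ^ j * z * (1 - q₂)⁻¹ * ρ⁻¹) • v j

/-- Weights `𝔫_z^{(2)} = (t₁ - 1/(1-q₁), t₂ - z)`, `K₂` of rank zero. -/
def FamN2Zero : Prop :=
  K₂ q₁ q₂ = {0} ∧ ∃ (z : ℂ) (w : ℤ × ℤ → M), z ≠ 0 ∧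
    IsBasisOn Set.univ w ∧
    ∀ i j : ℤ,
      T.X₁ (w (i, j)) =
        (if 0 ≤ i then w (i + 1, j) else (1 - q₁)⁻¹ • w (i + 1, j)) ∧
      T.X₂ (w (i, j)) =
        (if 0 ≤ j then (q₁ * l) ^ (-i) • w (i, j + 1)
        else ((q₁ * l) ^ (-i) * z * q₂ ^ (-j)) • w (i, j + 1)) ∧
      T.Y₁ (T.X₁ (w (i, j))) = (1 - q₁)⁻¹ • w (i, j) ∧
      T.Y₂ (T.X₂ (w (i, j))) = (z * q₁ ^ (-i) * q₂ ^ (-j)) • w (i, j)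

/-- Weights `𝔫_z^{(2)}`, `K₂` of rank one with generator `(a, b)`, `a > 0`. -/
def FamN2One : Prop :=
  ∃ a b : ℤ, 0 < a ∧ (∀ g : ℤ × ℤ, g ∈ K₂ q₁ q₂ ↔ ∃ n : ℤ, g = (n * a, n * b)) ∧
  ∃ (z ρ : ℂ) (w : ℤ × ℤ → M), z ≠ 0 ∧ ρ ≠ 0 ∧
    IsBasisOn (Set.Ico 0 a ×ˢ Set.univ) w ∧
    ∀ i ∈ Set.Ico 0 a, ∀ j : ℤ,
      T.X₁ (w (i, j)) =
        (if i < a - 1 then w (i + 1, j)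
        else (rInv q₁ q₂ z 0 b * q₁ ^ (a * (max 0 j + max 0 (-b))) * l ^ (a * (j - b)) * ρ *
          mul₂ q₂ z j (-b)) • w (0, j - b)) ∧
      T.X₂ (w (i, j)) =
        (if 0 ≤ j then (q₁ ^ (-i) * (l⁻¹) ^ i) • w (i, j + 1)
        else (q₁ ^ (-i) * (l⁻¹) ^ i * z * q₂ ^ (-j)) • w (i, j + 1)) ∧
      T.Y₁ (T.X₁ (w (i, j))) = (1 - q₁)⁻¹ • w (i, j) ∧
      T.Y₂ (T.X₂ (w (i, j))) = (z * q₁ ^ (-i) * q₂ ^ (-j)) • w (i, j)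

/-- Weights `𝔫_z^{(2)}`, `K₂` of rank one with generator `(0, b)`, `b > 0`. -/
def FamN2One' : Prop :=
  ∃ b : ℤ, 0 < b ∧ (∀ g : ℤ × ℤ, g ∈ K₂ q₁ q₂ ↔ ∃ n : ℤ, g = (0, n * b)) ∧
  ∃ (z ρ : ℂ) (w : ℤ × ℤ → M), z ≠ 0 ∧ ρ ≠ 0 ∧
    IsBasisOn (Set.univ ×ˢ Set.Ico 0 b) w ∧
    ∀ i : ℤ, ∀ j ∈ Set.Ico 0 b,
      T.X₁ (w (i, j)) =
        (if 0 ≤ i then w (i + 1, j) else (1 - q₁)⁻¹ • w (i + 1, j)) ∧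
      T.X₂ (w (i, j)) =
        (if j < b - 1 then (q₁ * l) ^ (-i) • w (i, j + 1)
        else ((q₁ * l) ^ (-i) * ρ) • w (i, 0)) ∧
      T.Y₁ (T.X₁ (w (i, j))) = (1 - q₁)⁻¹ • w (i, j) ∧
      T.Y₂ (T.X₂ (w (i, j))) = (z * q₁ ^ (-i) * q₂ ^ (-j)) • w (i, j)

/-- The formulas for weights `𝔫_z^{(2)}`, `K₂` of rank two, for a given choice of basis. In the
notation of integer division with remainder, `k - a₂/d₂ = r k₁' + k₁''`, `b' + k = r k₂' + k₂''` and
`k₂'' - a₂/d₂ = r k₃' + k₃''`. -/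
def FamN2TwoFor (c : RankTwoChoice q₁ q₂) (z : ℂ) : Prop :=
  0 < orderOf (c.nu l) ∧
  ∃ (ρ μ : ℂ) (w : ℤ × ℤ × ℤ → M), ρ ≠ 0 ∧ μ ≠ 0 ∧
    ∃ r : ℤ, r = orderOf (c.nu l) ∧
    IsBasisOn (Set.Ico 0 c.d₁ ×ˢ Set.Ico 0 c.d₂ ×ˢ Set.Ico 0 r) w ∧
    ∀ i ∈ Set.Ico 0 c.d₁, ∀ j ∈ Set.Ico 0 c.d₂, ∀ k ∈ Set.Ico 0 r,
      ∀ k₁' k₁'' k₂' k₂'' k₃' k₃'' : ℤ,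
        k₁'' ∈ Set.Ico 0 r → k - c.a₂ / c.d₂ = r * k₁' + k₁'' →
        k₂'' ∈ Set.Ico 0 r → c.b' + k = r * k₂' + k₂'' →
        k₃'' ∈ Set.Ico 0 r → k₂'' - c.a₂ / c.d₂ = r * k₃' + k₃'' →
      T.X₁ (w (i, j, k)) =
        (if i < c.d₁ - 1 then w (i + 1, j, k)
        else (q₁ ^ (j * c.d₁) * l ^ (j * c.d₁) * c.C₁ l z *
          c.nu l ^ (c.b₂ / c.d₂ * k₁'') * ρ ^ (c.b₂ / c.d₂) * μ ^ k₁') • w (0, j, k₁'')) ∧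
      T.X₂ (w (i, j, k)) = (q₁ * l) ^ (-i) •
        (if j < c.d₂ - 1 then w (i, j + 1, k)
        else if i + c.s ≤ c.d₁ - 1 then
          ((1 - q₁) ^ c.s * c.C₂ l z * c.nu l ^ (c.a' * k₂'') * ρ ^ c.a' * μ ^ k₂') •
            w (i + c.s, 0, k₂'')
        else
          ((1 - q₁) ^ c.s * c.C₂ l z * c.nu l ^ (c.a' * k₂'' + k₃'' * (c.b₂ / c.d₂)) *
            ρ ^ (c.a' + c.b₂ / c.d₂) * μ ^ (k₂' + k₃') * c.C₁ l z) •
            w (i + c.s - c.d₁, 0, k₃'')) ∧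
      T.Y₁ (T.X₁ (w (i, j, k))) = (1 - q₁)⁻¹ • w (i, j, k) ∧
      T.Y₂ (T.X₂ (w (i, j, k))) = (z * q₁ ^ (-i) * q₂ ^ (-j)) • w (i, j, k)

/-- Weights `𝔫_z^{(2)}`, `K₂` of rank two: the formulas hold for every choice of basis. -/
def FamN2Two : Prop :=
  Nonempty (RankTwoChoice q₁ q₂) ∧
  ∃ z : ℂ, z ≠ 0 ∧ ∀ c : RankTwoChoice q₁ q₂, FamN2TwoFor q₁ q₂ l T c z

/-- Generic weights `(t₁ - α₁, t₂ - α₂)`, `q₁` and `q₂` roots of unity, no breaks. -/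
def FamGenCyc : Prop :=
  0 < orderOf q₁ ∧ 0 < orderOf q₂ ∧ 0 < orderOf (l ^ (orderOf q₁ * orderOf q₂)) ∧
  ∃ (α₁ α₂ γ₁ γ₂ ρ μ : ℂ) (w : ℤ × ℤ × ℤ → M),
    γ₁ = 1 + (q₁ - 1) * α₁ ∧ γ₂ = γ₁ + (q₂ - 1) * α₂ ∧ γ₁ ≠ 0 ∧ γ₂ ≠ 0 ∧
    (∀ k : ℤ, γ₁ ≠ q₁ ^ k) ∧ (∀ k : ℤ, γ₂ ≠ q₂ ^ k * γ₁) ∧ ρ ≠ 0 ∧ μ ≠ 0 ∧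
    ∃ o₁ o₂ r : ℤ, o₁ = orderOf q₁ ∧ o₂ = orderOf q₂ ∧
      r = orderOf (l ^ (orderOf q₁ * orderOf q₂)) ∧
    IsBasisOn (Set.Ico 0 o₁ ×ˢ Set.Ico 0 o₂ ×ˢ Set.Ico 0 r) w ∧
    ∀ i ∈ Set.Ico 0 o₁, ∀ j ∈ Set.Ico 0 o₂, ∀ k ∈ Set.Ico 0 r,
      T.X₁ (w (i, j, k)) =
        (if i < o₁ - 1 then w (i + 1, j, k)
        else (l ^ (o₁ * (o₂ * k + j)) * ρ) • w (0, j, k)) ∧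
      T.X₂ (w (i, j, k)) = (q₁ * l) ^ (-i) •
        (if j < o₂ - 1 then w (i, j + 1, k)
        else if k < r - 1 then w (i, 0, k + 1)
        else μ • w (i, 0, 0)) ∧
      T.Y₁ (T.X₁ (w (i, j, k))) = (q₁ ^ (-i) * (α₁ - qint q₁ i)) • w (i, j, k) ∧
      T.Y₂ (T.X₂ (w (i, j, k))) =
        (q₁ ^ (-i) * q₂ ^ (-j) * (α₂ - qint q₂ j * (1 + (q₁ - 1) * α₁))) • w (i, j, k)

/-- The shape of the index set in one coordinate, for a generic weight. There is a break in this
direction iff `γ = q ^ k γ'` for some `k`; then the base weight is chosen at an end of the string. -/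
def Shape (q γ' γ : ℂ) (I : Set ℤ) : Prop :=
  (0 < orderOf q ∧ I = Set.Ico 0 (orderOf q : ℤ) ∧
    (γ = q⁻¹ * γ' ∨ ∀ k : ℤ, γ ≠ q ^ k * γ')) ∨
  (orderOf q = 0 ∧ I = Set.univ ∧ ∀ k : ℤ, γ ≠ q ^ k * γ') ∨
  (orderOf q = 0 ∧ I = Set.Ici 0 ∧ γ = q⁻¹ * γ') ∨
  (orderOf q = 0 ∧ I = Set.Iic 0 ∧ γ = γ')

open Classical in
/-- Generic weights `(t₁ - α₁, t₂ - α₂)` in all other cases. -/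
def FamGen : Prop :=
  ∃ (α₁ α₂ γ₁ γ₂ ρ μ : ℂ) (I₁ I₂ : Set ℤ) (w : ℤ × ℤ → M),
    γ₁ = 1 + (q₁ - 1) * α₁ ∧ γ₂ = γ₁ + (q₂ - 1) * α₂ ∧ γ₁ ≠ 0 ∧ γ₂ ≠ 0 ∧
    Shape q₁ 1 γ₁ I₁ ∧ Shape q₂ γ₁ γ₂ I₂ ∧
    ¬ (0 < orderOf q₁ ∧ 0 < orderOf q₂ ∧
      (∀ k : ℤ, γ₁ ≠ q₁ ^ k) ∧ (∀ k : ℤ, γ₂ ≠ q₂ ^ k * γ₁)) ∧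
    ρ ≠ 0 ∧ μ ≠ 0 ∧
    IsBasisOn (I₁ ×ˢ I₂) w ∧
    ∀ i ∈ I₁, ∀ j ∈ I₂,
      T.X₁ (w (i, j)) =
        (if i + 1 ∈ I₁ then w (i + 1, j)
        else if 0 < orderOf q₁ ∧ α₁ ≠ qint q₁ i then
          (ρ * l ^ ((orderOf q₁ : ℤ) * j)) • w (0, j)
        else 0) ∧
      T.X₂ (w (i, j)) = (q₁ * l) ^ (-i) •
        (if j + 1 ∈ I₂ then w (i, j + 1)
        else if 0 < orderOf q₂ ∧ α₂ ≠ qint q₂ j * (1 + (q₁ - 1) * α₁) then μ • w (i, 0)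
        else 0) ∧
      T.Y₁ (w (i, j)) = (q₁ ^ (-i + 1) * (α₁ - qint q₁ (i - 1))) •
        (if i - 1 ∈ I₁ then w (i - 1, j)
        else if 0 < orderOf q₁ ∧ α₁ ≠ qint q₁ (i - 1) then
          (ρ * l ^ ((orderOf q₁ : ℤ) * j))⁻¹ • w ((orderOf q₁ : ℤ) - 1, j)
        else 0) ∧
      T.Y₂ (w (i, j)) =
        (l ^ i * q₂ ^ (-j + 1) * (α₂ - qint q₂ (j - 1) * (1 + (q₁ - 1) * α₁))) •
        (if j - 1 ∈ I₂ then w (i, j - 1)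
        else if 0 < orderOf q₂ ∧ α₂ ≠ qint q₂ (j - 1) * (1 + (q₁ - 1) * α₁) then
          μ⁻¹ • w (i, (orderOf q₂ : ℤ) - 1)
        else 0)

end Families

end QWeyl

/-!
The elements `g₁ = 1 + (q₁ - 1) t₁` and `g₂ = g₁ + (q₂ - 1) t₂` commute with the generators up to
scalars: `X₁` divides the eigenvalues `(a, b)` of `(g₁, g₂)` by `q₁`, `X₂` divides `b` by `q₂`, and
`Y₁`, `Y₂` do the opposite. In these coordinates the weights of a simple module lie on one orbit of
`ℤ²`, and whether `a` and `b` vanish is the same for all of them. The operators `Y_i X_i` and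
`X_i Y_i` are scalars on each weight space, and the absence of proper inner breaks says that `X_i`
and `Y_i` vanish wherever these scalars do. So one starts with a vector `v` in some weight space
that is an eigenvector of as much of the stabilizer of the weight as possible, and applies powers of
`X₁`, `X₂` and their inverses: the vectors obtained span by simplicity, and they are independent
since weights and one further eigenvalue separate them (`Rep.linearIndepOn_of_weight`). If two
elements `S`, `T` of the stabilizer commute only up to a scalar `ν`, then comparing determinants on
the finite-dimensional weight space shows that `ν` is a root of unity of some order `r`, and one uses
a joint eigenvector of `S` and `T ^ r` (`exists_clock_shift`).

* For `a = b = 0` the operators `X₂`, `Y₂` vanish and `X₁`, `Y₁` act as scalars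
  (`Rep.famN0_of_weight`).
* For `a ≠ 0` and `b = 0` the operators `X₂`, `Y₂` preserve the weights and only the string in the
  direction of `X₁` matters (`Rep.fam_of_weight_zero_right`).
* For `a ≠ 0` and `b ≠ 0` the weights form a grid, the product of two strings; each of them is a
  line, a half-line ending at a break, or a cycle, and the base weight is chosen at a break if there
  is one (`exists_shape`, `Rep.famGen_of_shape`, `Rep.famGenCyc_of_weight`).
* For `a = 0` and `b ≠ 0` there are no breaks at all, `X₁` and `X₂` are invertible, and the module
  is one of a quantum torus (`Torus`). The cases correspond to the rank of the stabilizer `K₂`. All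
  computations are made with the monomials `X₁ ^ i X₂ ^ j` in the group of invertible operators;
  the scalars in the formulas come from comparing them with `Z₁ ^ i Z₂ ^ j`, where negative powers
  are powers of `Y₁` and `Y₂` (`norm₁`, `norm₂`).
-/

namespace QWeyl

/-! ### Eigenvectors -/

section LinearAlgebra

variable {M : Type*} [AddCommGroup M] [Module ℂ M]

/-- Nonzero joint eigenvectors of a family of operators are linearly independent as soon as the
eigenvalues separate them. The operators need not commute. -/
theorem linearIndepOn_of_eigen {ι κ : Type*} {S : Set ι} {w : ι → M} (T : κ → Module.End ℂ M)
    (e : κ → ι → ℂ) (h : ∀ k, ∀ s ∈ S, T k (w s) = e k s • w s) (hne : ∀ s ∈ S, w s ≠ 0)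
    (hinj : ∀ s ∈ S, ∀ s' ∈ S, (∀ k, e k s = e k s') → s = s') : LinearIndepOn ℂ w S := by
  classical
  rw [linearIndepOn_iff']
  intro F
  induction F using Finset.induction_on with
  | empty => simp
  | insert s₀ F hs₀ ih =>
    intro g hF hsum
    have hF' : (F : Set ι) ⊆ S := fun x hx => hF (by simp at hx; simp [hx])
    have hs₀S : s₀ ∈ S := hF (by simp)
    have key : ∀ s ∈ F, g s = 0 := by
      intro s hs
      have hne' : s ≠ s₀ := fun h => hs₀ (h ▸ hs)
      obtain ⟨k, hk⟩ : ∃ k, e k s ≠ e k s₀ := by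
        by_contra! hcon
        exact hne' (hinj s (hF' hs) s₀ hs₀S hcon)
      -- the operator `T k - e k s₀` kills the term at `s₀` and rescales the others
      have h1 : ∑ i ∈ F, (g i * (e k i - e k s₀)) • w i = 0 := by
        have h2 := congrArg (fun v => T k v - e k s₀ • v) hsum
        simp only [map_sum, map_smul, Finset.smul_sum, map_zero, smul_zero, sub_zero] at h2
        rw [← Finset.sum_sub_distrib, Finset.sum_insert hs₀, h k s₀ hs₀S] at h2
        rw [← h2, smul_comm (e k s₀), sub_self, zero_add]
        refine Finset.sum_congr rfl fun i hi => ?_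
        rw [h k i (hF' hi)]
        module
      have h3 := ih _ hF' h1 s hs
      exact (mul_eq_zero.1 h3).resolve_right (sub_ne_zero.2 hk)
    intro s hs
    rcases Finset.mem_insert.1 hs with rfl | hs
    · rw [Finset.sum_insert hs₀, Finset.sum_eq_zero (fun i hi => by rw [key i hi, zero_smul]),
        add_zero] at hsum
      exact (smul_eq_zero.1 hsum).resolve_right (hne s hs₀S)
    · exact key s hs

theorem exists_eigenvector {W : Submodule ℂ M} [FiniteDimensional ℂ W] (hW : W ≠ ⊥)
    (S : Module.End ℂ M) (hS : ∀ v ∈ W, S v ∈ W) :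
    ∃ c : ℂ, ∃ v ∈ W, v ≠ 0 ∧ S v = c • v := by
  have : Nontrivial W := Submodule.nontrivial_iff_ne_bot.2 hW
  obtain ⟨c, hc⟩ := Module.End.exists_eigenvalue (S.restrict hS)
  obtain ⟨v, hv⟩ := hc.exists_hasEigenvector
  refine ⟨c, v, v.2, fun h => hv.2 (Subtype.ext h), ?_⟩
  have := congrArg Subtype.val hv.apply_eq_smul
  simpa using this

theorem exists_joint_eigenvector {W : Submodule ℂ M} [FiniteDimensional ℂ W] (hW : W ≠ ⊥)
    (S T : Module.End ℂ M) (hS : ∀ v ∈ W, S v ∈ W) (hT : ∀ v ∈ W, T v ∈ W)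
    (hST : ∀ v ∈ W, S (T v) = T (S v)) :
    ∃ c d : ℂ, ∃ v ∈ W, v ≠ 0 ∧ S v = c • v ∧ T v = d • v := by
  obtain ⟨c, u, huW, hu0, hu⟩ := exists_eigenvector hW S hS
  let W' : Submodule ℂ M := W ⊓ Module.End.eigenspace S c
  have : FiniteDimensional ℂ W' := Submodule.finiteDimensional_of_le inf_le_left
  have hW' : W' ≠ ⊥ := by
    rw [Submodule.ne_bot_iff]
    exact ⟨u, ⟨huW, Module.End.mem_eigenspace_iff.2 hu⟩, hu0⟩
  obtain ⟨d, v, hv, hv0, hvd⟩ := exists_eigenvector hW' T (fun v hv => ⟨hT v hv.1, by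
    rw [SetLike.mem_coe, Module.End.mem_eigenspace_iff, hST v hv.1,
      Module.End.mem_eigenspace_iff.1 hv.2, map_smul]⟩)
  exact ⟨c, d, v, hv.1, hv0, Module.End.mem_eigenspace_iff.1 hv.2, hvd⟩

theorem apply_pow_of_commute_up_to {W : Submodule ℂ M} {S T : Module.End ℂ M} {ν : ℂ}
    (hT : ∀ v ∈ W, T v ∈ W) (hST : ∀ v ∈ W, S (T v) = ν • T (S v)) (n : ℕ) :
    ∀ v ∈ W, (T ^ n) v ∈ W ∧ S ((T ^ n) v) = ν ^ n • (T ^ n) (S v) := by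
  induction n with
  | zero => intro v hv; simpa using hv
  | succ n ih =>
    intro v hv
    rw [pow_succ']
    refine ⟨hT _ (ih v hv).1, ?_⟩
    rw [Module.End.mul_apply, hST _ (ih v hv).1, (ih v hv).2, map_smul, smul_smul, pow_succ',
      Module.End.mul_apply]

/-- Two injective operators on a nonzero finite-dimensional space that commute up to the scalar
`ν`: comparing determinants, `ν` is a root of unity, of order `r` say, and then the first operator
and the `r`-th power of the second one commute. -/
theorem exists_clock_shift {W : Submodule ℂ M} [FiniteDimensional ℂ W] (hW : W ≠ ⊥)
    (S T : Module.End ℂ M) (ν : ℂ) (hS : ∀ v ∈ W, S v ∈ W) (hT : ∀ v ∈ W, T v ∈ W)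
    (hS0 : ∀ v ∈ W, S v = 0 → v = 0) (hT0 : ∀ v ∈ W, T v = 0 → v = 0)
    (hST : ∀ v ∈ W, S (T v) = ν • T (S v)) :
    0 < orderOf ν ∧ ∃ ρ μ : ℂ, ρ ≠ 0 ∧ μ ≠ 0 ∧ ∃ v ∈ W, v ≠ 0 ∧ S v = ρ • v ∧
      (T ^ orderOf ν) v = μ • v := by
  have : Nontrivial W := Submodule.nontrivial_iff_ne_bot.2 hW
  have hdet : ∀ (A : Module.End ℂ M) (hA : ∀ v ∈ W, A v ∈ W), (∀ v ∈ W, A v = 0 → v = 0) →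
      (A.restrict hA).det ≠ 0 := by
    intro A hA hA0 h0
    have h1 := LinearMap.bot_lt_ker_of_det_eq_zero h0
    refine h1.ne' (LinearMap.ker_eq_bot'.2 fun v hv => ?_)
    have h2 := congrArg Subtype.val hv
    exact Subtype.ext (hA0 v v.2 (by simpa using h2))
  have h1 : S.restrict hS * T.restrict hT = ν • (T.restrict hT * S.restrict hS) := by
    ext v
    simpa using hST v v.2
  have h2 := congrArg LinearMap.det h1
  rw [LinearMap.det_smul, map_mul, map_mul, mul_comm (LinearMap.det (T.restrict hT))] at h2
  have h3 : ν ^ Module.finrank ℂ W = 1 := by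
    have := mul_ne_zero (hdet S hS hS0) (hdet T hT hT0)
    exact (mul_eq_right₀ this).1 h2.symm
  have hpos : 0 < orderOf ν :=
    orderOf_pos_iff.2 (isOfFinOrder_iff_pow_eq_one.2 ⟨_, Module.finrank_pos, h3⟩)
  refine ⟨hpos, ?_⟩
  have hpow := apply_pow_of_commute_up_to hT hST (orderOf ν)
  obtain ⟨ρ, μ, v, hv, hv0, h4, h5⟩ := exists_joint_eigenvector hW S (T ^ orderOf ν) hS
    (fun v hv => (hpow v hv).1) (fun v hv => by rw [(hpow v hv).2, pow_orderOf_eq_one, one_smul])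
  refine ⟨ρ, μ, ?_, ?_, v, hv, hv0, h4, h5⟩
  · rintro rfl
    exact hv0 (hS0 v hv (by rw [h4, zero_smul]))
  · rintro rfl
    rw [zero_smul] at h5
    have hn : ∀ n : ℕ, (T ^ n) v = 0 → v = 0 := by
      intro n
      induction n with
      | zero => simp
      | succ n ih =>
        intro h
        rw [pow_succ', Module.End.mul_apply] at h
        exact ih (hT0 _ (apply_pow_of_commute_up_to hT hST n v hv).1 h)
    exact hv0 (hn _ h5)

end LinearAlgebra

/-! ### Ladders of weight spaces -/

section Ladder

variable {M : Type*} [AddCommGroup M] [Module ℂ M]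

/-- A string of subspaces `L i`, `i ∈ ℤ`, along which `X` raises and `Y` lowers the index, such
that `Y X` on `L i` and `X Y` on `L (i + 1)` are both the scalar `c i`, and such that there are no
proper inner breaks: both `X` and `Y` vanish across a step with `c i = 0`. -/
structure Ladder (X Y : Module.End ℂ M) (L : ℤ → Submodule ℂ M) (c : ℤ → ℂ) : Prop where
  X_mem : ∀ i, ∀ v ∈ L i, X v ∈ L (i + 1)
  Y_mem : ∀ i, ∀ v ∈ L (i + 1), Y v ∈ L i
  YX : ∀ i, ∀ v ∈ L i, Y (X v) = c i • v
  XY : ∀ i, ∀ v ∈ L (i + 1), X (Y v) = c i • v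
  X_zero : ∀ i, c i = 0 → ∀ v ∈ L i, X v = 0
  Y_zero : ∀ i, c i = 0 → ∀ v ∈ L (i + 1), Y v = 0

/-- The operator `X ^ i` on `L 0`, where for `i < 0` the inverse of `X` on the ladder is expressed
by `Y`: it is `(c (-1) ⋯ c i)⁻¹ Y ^ (-i)`. -/
noncomputable def ladderOp (X Y : Module.End ℂ M) (c : ℤ → ℂ) (i : ℤ) : Module.End ℂ M :=
  if 0 ≤ i then X ^ i.toNat
  else (∏ k ∈ Finset.range (-i).toNat, c (-(k + 1 : ℤ)))⁻¹ • Y ^ (-i).toNat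

theorem ladderOp_natCast (X Y : Module.End ℂ M) (c : ℤ → ℂ) (n : ℕ) :
    ladderOp X Y c n = X ^ n := by
  simp [ladderOp]

@[simp] theorem ladderOp_zero (X Y : Module.End ℂ M) (c : ℤ → ℂ) : ladderOp X Y c 0 = 1 := by
  simp [ladderOp]

theorem ladderOp_neg (X Y : Module.End ℂ M) (c : ℤ → ℂ) (n : ℕ) :
    ladderOp X Y c (-(n : ℤ)) = (∏ k ∈ Finset.range n, c (-(k + 1 : ℤ)))⁻¹ • Y ^ n := by
  rcases Nat.eq_zero_or_pos n with rfl | hn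
  · simp
  · simp [ladderOp, hn.ne']

theorem apply_pow_comm {Z X : Module.End ℂ M} {α : ℂ} (h : ∀ v, Z (X v) = α • X (Z v)) (n : ℕ)
    (v : M) : Z ((X ^ n) v) = α ^ n • (X ^ n) (Z v) :=
  (apply_pow_of_commute_up_to (W := ⊤) (fun _ _ => trivial) (fun v _ => h v) n v trivial).2

theorem pow_apply_comm {Z X : Module.End ℂ M} {α : ℂ} (h : ∀ v, Z (X v) = α • X (Z v)) (n : ℕ)
    (v : M) : (Z ^ n) (X v) = α ^ n • X ((Z ^ n) v) := by
  induction n with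
  | zero => simp
  | succ n ih =>
    rw [pow_succ', Module.End.mul_apply, ih, map_smul, h, smul_smul, pow_succ,
      Module.End.mul_apply]

theorem apply_ladderOp {Z X Y : Module.End ℂ M} (c : ℤ → ℂ) {α : ℂ}
    (hX : ∀ v, Z (X v) = α • X (Z v)) (hY : ∀ v, Z (Y v) = α⁻¹ • Y (Z v)) (i : ℤ) (v : M) :
    Z (ladderOp X Y c i v) = α ^ i • ladderOp X Y c i (Z v) := by
  obtain ⟨n, rfl | rfl⟩ := Int.eq_nat_or_neg i
  · rw [ladderOp_natCast, apply_pow_comm hX, zpow_natCast]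
  · rw [ladderOp_neg, LinearMap.smul_apply, map_smul, apply_pow_comm hY, smul_comm,
      LinearMap.smul_apply, inv_pow, zpow_neg, zpow_natCast]

namespace Ladder

variable {X Y : Module.End ℂ M} {L : ℤ → Submodule ℂ M} {c : ℤ → ℂ}

/-- The same ladder read downwards. -/
theorem reverse (h : Ladder X Y L c) : Ladder Y X (fun i => L (-i)) (fun i => c (-i - 1)) where
  X_mem i v hv := h.Y_mem _ v (by rw [show -(i + 1) + 1 = -i by ring]; exact hv)
  Y_mem i v hv := by
    have := h.X_mem _ v hv
    rwa [show -(i + 1) + 1 = -i by ring] at this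
  YX i v hv := h.XY _ v (by rw [show -i - 1 + 1 = -i by ring]; exact hv)
  XY i v hv := by
    have := h.YX _ v hv
    rwa [show -(i + 1) = -i - 1 by ring] at this
  X_zero i hc v hv := h.Y_zero _ hc v (by rw [show -i - 1 + 1 = -i by ring]; exact hv)
  Y_zero i hc v hv := h.X_zero _ hc v (by rw [show -i - 1 = -(i + 1) by ring]; exact hv)

theorem pow_X_mem (h : Ladder X Y L c) {v : M} (hv : v ∈ L 0) (n : ℕ) : (X ^ n) v ∈ L n := by
  induction n with
  | zero => simpa using hv
  | succ n ih =>
    rw [pow_succ', Module.End.mul_apply]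
    exact_mod_cast h.X_mem _ _ ih

theorem pow_Y_mem (h : Ladder X Y L c) {v : M} (hv : v ∈ L 0) (n : ℕ) :
    (Y ^ n) v ∈ L (-(n : ℤ)) := by
  simpa using h.reverse.pow_X_mem (by simpa using hv) n

theorem op_mem (h : Ladder X Y L c) {v : M} (hv : v ∈ L 0) (i : ℤ) :
    ladderOp X Y c i v ∈ L i := by
  obtain ⟨n, rfl | rfl⟩ := Int.eq_nat_or_neg i
  · rw [ladderOp_natCast]
    exact h.pow_X_mem hv n
  · rw [ladderOp_neg]
    exact Submodule.smul_mem _ _ (h.pow_Y_mem hv n)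

theorem X_op (h : Ladder X Y L c) {v : M} (hv : v ∈ L 0) {i : ℤ} (hi : 0 ≤ i ∨ c i ≠ 0) :
    X (ladderOp X Y c i v) = ladderOp X Y c (i + 1) v := by
  rcases lt_or_ge i 0 with h0 | h0
  · obtain ⟨n, rfl⟩ : ∃ n : ℕ, i = -((n + 1 : ℕ) : ℤ) := ⟨(-i - 1).toNat, by omega⟩
    have hc := hi.resolve_left (by omega)
    rw [show -((n + 1 : ℕ) : ℤ) + 1 = -(n : ℤ) by push_cast; ring, ladderOp_neg, ladderOp_neg,
      LinearMap.smul_apply, map_smul, pow_succ', Module.End.mul_apply,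
      h.XY (-((n + 1 : ℕ) : ℤ)) _ (by
        rw [show -((n + 1 : ℕ) : ℤ) + 1 = -(n : ℤ) by push_cast; ring]
        exact h.pow_Y_mem hv n), smul_smul, LinearMap.smul_apply, Finset.prod_range_succ]
    congr 1
    push_cast at hc ⊢
    rw [mul_inv, mul_assoc, inv_mul_cancel₀ hc, mul_one]
  · obtain ⟨n, rfl⟩ := Int.eq_ofNat_of_zero_le h0
    rw [ladderOp_natCast, ← Nat.cast_succ, ladderOp_natCast, pow_succ', Module.End.mul_apply]

theorem Y_op (h : Ladder X Y L c) {v : M} (hv : v ∈ L 0) {i : ℤ} (hi : 0 ≤ i ∨ c i ≠ 0) :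
    Y (ladderOp X Y c (i + 1) v) = c i • ladderOp X Y c i v := by
  rw [← h.X_op hv hi, h.YX _ _ (h.op_mem hv i)]

theorem op_ne_zero (h : Ladder X Y L c) {v : M} (hv : v ∈ L 0) (hv0 : v ≠ 0) {i : ℤ}
    (hpos : ∀ k, 0 ≤ k → k < i → c k ≠ 0) (hneg : ∀ k, i ≤ k → k < 0 → c k ≠ 0) :
    ladderOp X Y c i v ≠ 0 := by
  obtain ⟨n, rfl | rfl⟩ := Int.eq_nat_or_neg i
  · induction n with
    | zero => simpa using hv0
    | succ n ih =>
      intro h0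
      have h1 := h.Y_op hv (i := n) (Or.inl (by omega))
      rw [← Nat.cast_succ, h0, map_zero] at h1
      exact (smul_ne_zero (hpos n (by omega) (by omega))
        (ih (fun k h0 hk => hpos k h0 (by omega)) (fun k h0 hk => by omega))) h1.symm
  · induction n with
    | zero => simpa using hv0
    | succ n ih =>
      intro h0
      have h1 := h.X_op hv (i := -((n + 1 : ℕ) : ℤ)) (Or.inr (hneg _ le_rfl (by omega)))
      rw [h0, map_zero, show -((n + 1 : ℕ) : ℤ) + 1 = -(n : ℤ) by push_cast; ring] at h1
      exact ih (fun k h0 hk => by omega) (fun k h0 hk => hneg k (by omega) hk) h1.symm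

end Ladder

/-- The index sets `I` of the generic modules in terms of the scalars `c` of a ladder: a cycle of
length `o` (possibly broken between its ends), or an infinite string that ends where `c`
vanishes; `o = 0` stands for infinite order. -/
def LadderShape (o : ℕ) (c : ℤ → ℂ) (I : Set ℤ) : Prop :=
  (0 < o ∧ I = Set.Ico 0 (o : ℤ) ∧ c (o - 1) = c (-1) ∧ ∀ i, 0 ≤ i → i < (o : ℤ) - 1 → c i ≠ 0) ∨
  (o = 0 ∧ I = Set.univ ∧ ∀ i, c i ≠ 0) ∨
  (o = 0 ∧ I = Set.Ici 0 ∧ c (-1) = 0 ∧ ∀ i, 0 ≤ i → c i ≠ 0) ∨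
  (o = 0 ∧ I = Set.Iic 0 ∧ c 0 = 0 ∧ ∀ i, i < 0 → c i ≠ 0)

namespace LadderShape

variable {X Y : Module.End ℂ M} {L : ℤ → Submodule ℂ M} {c : ℤ → ℂ} {o : ℕ} {I : Set ℤ}

theorem zero_mem (hI : LadderShape o c I) : (0 : ℤ) ∈ I := by
  rcases hI with ⟨h, rfl, -⟩ | ⟨-, rfl, -⟩ | ⟨-, rfl, -⟩ | ⟨-, rfl, -⟩ <;> simp [*]

theorem ne_zero (hI : LadderShape o c I) {i : ℤ} (hi : i ∈ I) (hi' : i + 1 ∈ I) : c i ≠ 0 := by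
  rcases hI with ⟨h, rfl, -, h1⟩ | ⟨-, rfl, h1⟩ | ⟨-, rfl, -, h1⟩ | ⟨-, rfl, -, h1⟩
  · simp only [Set.mem_Ico] at hi hi'
    exact h1 i (by omega) (by omega)
  · exact h1 i
  · exact h1 i hi
  · exact h1 i (by simp only [Set.mem_Iic] at hi'; omega)

theorem op_ne_zero (hI : LadderShape o c I) (h : Ladder X Y L c) {v : M} (hv : v ∈ L 0)
    (hv0 : v ≠ 0) {i : ℤ} (hi : i ∈ I) : ladderOp X Y c i v ≠ 0 := by
  rcases hI with ⟨h0, rfl, -, h1⟩ | ⟨-, rfl, h1⟩ | ⟨-, rfl, -, h1⟩ | ⟨-, rfl, -, h1⟩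
  all_goals
    refine h.op_ne_zero hv hv0 (fun k hk hk' => ?_) (fun k hk hk' => ?_) <;>
      grind

theorem X_op (hI : LadderShape o c I) (h : Ladder X Y L c) {v : M} (hv : v ∈ L 0) {i : ℤ}
    (hi : i ∈ I) (hi' : i + 1 ∈ I) : X (ladderOp X Y c i v) = ladderOp X Y c (i + 1) v :=
  h.X_op hv (Or.inr (hI.ne_zero hi hi'))

/-- Beyond the end of the string: the cycle closes up, or `X` vanishes. -/
theorem X_op_end (hI : LadderShape o c I) (h : Ladder X Y L c) {v : M} (hv : v ∈ L 0) {τ : ℂ}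
    (hτ : 0 < o → c (-1) ≠ 0 → (X ^ o) v = τ • v) {i : ℤ} (hi : i ∈ I) (hi' : i + 1 ∉ I) :
    (0 < o ∧ c i ≠ 0 → X (ladderOp X Y c i v) = τ • ladderOp X Y c 0 v) ∧
    (¬ (0 < o ∧ c i ≠ 0) → X (ladderOp X Y c i v) = 0) := by
  have hm := h.op_mem hv i
  rcases hI with ⟨h0, rfl, h2, h1⟩ | ⟨h0, rfl, h1⟩ | ⟨h0, rfl, h2, h1⟩ | ⟨h0, rfl, h2, h1⟩
  · simp only [Set.mem_Ico] at hi hi'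
    obtain rfl : i = (o : ℤ) - 1 := by omega
    refine ⟨fun hc => ?_, fun hc => h.X_zero _ (by tauto) _ hm⟩
    rw [h.X_op hv (Or.inl (by omega)), sub_add_cancel, ladderOp_natCast,
      hτ h0 (h2 ▸ hc.2), ladderOp_zero, Module.End.one_apply]
  · exact absurd (Set.mem_univ _) hi'
  · simp only [Set.mem_Ici] at hi hi'
    omega
  · simp only [Set.mem_Iic] at hi hi'
    obtain rfl : i = 0 := by omega
    exact ⟨fun hc => by omega, fun _ => h.X_zero _ h2 _ hm⟩

theorem Y_op (hI : LadderShape o c I) (h : Ladder X Y L c) {v : M} (hv : v ∈ L 0) {i : ℤ}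
    (hi : i ∈ I) (hi' : i - 1 ∈ I) :
    Y (ladderOp X Y c i v) = c (i - 1) • ladderOp X Y c (i - 1) v := by
  have := h.Y_op hv (Or.inr (hI.ne_zero hi' (by rwa [sub_add_cancel])))
  rwa [sub_add_cancel] at this

/-- Before the beginning of the string: the cycle closes up, or `Y` vanishes. -/
theorem Y_op_end (hI : LadderShape o c I) (h : Ladder X Y L c) {v : M} (hv : v ∈ L 0) {τ : ℂ}
    (hτ0 : τ ≠ 0) (hτ : 0 < o → c (-1) ≠ 0 → (X ^ o) v = τ • v) {i : ℤ} (hi : i ∈ I)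
    (hi' : i - 1 ∉ I) :
    (0 < o ∧ c (i - 1) ≠ 0 →
      Y (ladderOp X Y c i v) = c (i - 1) • τ⁻¹ • ladderOp X Y c ((o : ℤ) - 1) v) ∧
    (¬ (0 < o ∧ c (i - 1) ≠ 0) → Y (ladderOp X Y c i v) = 0) := by
  have hm := h.op_mem hv i
  rw [show i = i - 1 + 1 by ring] at hm
  have hz : c (i - 1) = 0 → Y (ladderOp X Y c i v) = 0 := fun hc => by
    have := h.Y_zero _ hc _ hm
    rwa [sub_add_cancel] at this
  rcases hI with ⟨h0, rfl, h2, h1⟩ | ⟨h0, rfl, h1⟩ | ⟨h0, rfl, h2, h1⟩ | ⟨h0, rfl, h2, h1⟩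
  · simp only [Set.mem_Ico] at hi hi'
    obtain rfl : i = 0 := by omega
    refine ⟨fun hc => ?_, fun hc => hz (by tauto)⟩
    have h3 := h.YX _ _ (h.op_mem hv ((o : ℤ) - 1))
    rw [h.X_op hv (Or.inl (by omega)), sub_add_cancel, ladderOp_natCast,
      hτ h0 (by simpa using hc.2), map_smul, h2] at h3
    rw [ladderOp_zero, Module.End.one_apply, zero_sub, smul_comm, ← h3, smul_smul,
      inv_mul_cancel₀ hτ0, one_smul]
  · exact absurd (Set.mem_univ _) hi'
  · simp only [Set.mem_Ici] at hi hi'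
    obtain rfl : i = 0 := by omega
    exact ⟨fun hc => by omega, fun _ => hz (by simpa using h2)⟩
  · simp only [Set.mem_Iic] at hi hi'
    omega

theorem X_op_mem_span (hI : LadderShape o c I) (h : Ladder X Y L c) {v : M} (hv : v ∈ L 0) {τ : ℂ}
    (hτ : 0 < o → c (-1) ≠ 0 → (X ^ o) v = τ • v) {i : ℤ} (hi : i ∈ I) :
    X (ladderOp X Y c i v) ∈ Submodule.span ℂ ((fun i => ladderOp X Y c i v) '' I) := by
  by_cases hi' : i + 1 ∈ I
  · rw [hI.X_op h hv hi hi']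
    exact Submodule.subset_span ⟨_, hi', rfl⟩
  · have := hI.X_op_end h hv hτ hi hi'
    by_cases hc : 0 < o ∧ c i ≠ 0
    · rw [this.1 hc]
      exact Submodule.smul_mem _ _ (Submodule.subset_span ⟨_, hI.zero_mem, rfl⟩)
    · rw [this.2 hc]
      exact Submodule.zero_mem _

theorem Y_op_mem_span (hI : LadderShape o c I) (h : Ladder X Y L c) {v : M} (hv : v ∈ L 0) {τ : ℂ}
    (hτ0 : τ ≠ 0) (hτ : 0 < o → c (-1) ≠ 0 → (X ^ o) v = τ • v) {i : ℤ} (hi : i ∈ I) :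
    Y (ladderOp X Y c i v) ∈ Submodule.span ℂ ((fun i => ladderOp X Y c i v) '' I) := by
  by_cases hi' : i - 1 ∈ I
  · rw [hI.Y_op h hv hi hi']
    exact Submodule.smul_mem _ _ (Submodule.subset_span ⟨_, hi', rfl⟩)
  · have := hI.Y_op_end h hv hτ0 hτ hi hi'
    by_cases hc : 0 < o ∧ c (i - 1) ≠ 0
    · rw [this.1 hc]
      refine Submodule.smul_mem _ _ (Submodule.smul_mem _ _ (Submodule.subset_span ⟨_, ?_, rfl⟩))
      rcases hI with ⟨h0, rfl, -⟩ | ⟨h0, -⟩ | ⟨h0, -⟩ | ⟨h0, -⟩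
      · simp only [Set.mem_Ico]
        omega
      all_goals omega
    · rw [this.2 hc]
      exact Submodule.zero_mem _

end LadderShape

end Ladder

/-! ### The scalars along a string of weights -/

/-- With `q = q₁`, `γ' = 1`, `γ = a` the scalar of `Y₁ X₁` on the weight space reached by `X₁ ^ i`
from weight `(a, b)`; with `q = q₂`, `γ' = a`, `γ = b` that of `Y₂ X₂` on the one reached by
`X₂ ^ i`. -/
noncomputable def stepScalar (q γ' γ : ℂ) (i : ℤ) : ℂ := (q ^ (-i) * γ - γ') / (q - 1)

theorem stepScalar_eq_zero_iff {q γ' γ : ℂ} (hq : q ≠ 0) (hq' : q ≠ 1) {i : ℤ} :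
    stepScalar q γ' γ i = 0 ↔ γ = q ^ i * γ' := by
  rw [stepScalar, div_eq_zero_iff, or_iff_left (sub_ne_zero.2 hq'), sub_eq_zero, zpow_neg,
    inv_mul_eq_iff_eq_mul₀ (zpow_ne_zero _ hq)]

theorem stepScalar_eq {q γ' γ : ℂ} (hq : q ≠ 0) (hq' : q ≠ 1) (i : ℤ) :
    stepScalar q γ' γ i = q ^ (-i) * ((γ - γ') / (q - 1) - qint q i * γ') := by
  have h1 := sub_ne_zero.2 hq'
  have h2 := zpow_ne_zero i hq
  rw [stepScalar, qint, zpow_neg]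
  field_simp
  ring

theorem stepScalar_ne_zero_iff {q γ' γ : ℂ} (hq : q ≠ 0) (hq' : q ≠ 1) {i : ℤ} :
    stepScalar q γ' γ i ≠ 0 ↔ (γ - γ') / (q - 1) ≠ qint q i * γ' := by
  rw [stepScalar_eq hq hq', mul_ne_zero_iff, and_iff_right (zpow_ne_zero _ hq), sub_ne_zero]

theorem zpow_eq_one_iff_orderOf_dvd {q : ℂ} (hq : q ≠ 0) {k : ℤ} :
    q ^ k = 1 ↔ (orderOf q : ℤ) ∣ k := by
  have h1 : orderOf q = orderOf (Units.mk0 q hq) := by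
    rw [← orderOf_units, Units.val_mk0]
  rw [h1, orderOf_dvd_iff_zpow_eq_one, Units.ext_iff, Units.val_zpow_eq_zpow_val, Units.val_mk0,
    Units.val_one]

theorem zpow_eq_zpow_iff_orderOf_dvd {q : ℂ} (hq : q ≠ 0) {i j : ℤ} :
    q ^ i = q ^ j ↔ (orderOf q : ℤ) ∣ i - j := by
  rw [← zpow_eq_one_iff_orderOf_dvd hq, zpow_sub₀ hq, div_eq_one_iff_eq (zpow_ne_zero _ hq)]

theorem stepScalar_cycle {q γ' γ : ℂ} (hq : q ≠ 0) {n : ℤ} (hn : q ^ n = 1) :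
    stepScalar q γ' γ (n - 1) = stepScalar q γ' γ (-1) := by
  rw [stepScalar, stepScalar, show -(n - 1) = -(-1) - n by ring, zpow_sub₀ hq _ n, hn, div_one]

namespace Shape

variable {q γ' γ : ℂ} {I : Set ℤ}

theorem ladderShape (h : Shape q γ' γ I) (hq : q ≠ 0) (hq' : q ≠ 1) (hγ' : γ' ≠ 0) :
    LadderShape (orderOf q) (stepScalar q γ' γ) I := by
  have hz : ∀ i j : ℤ, q ^ j * γ' = q ^ i * γ' → (orderOf q : ℤ) ∣ j - i := fun i j hij =>
    (zpow_eq_zpow_iff_orderOf_dvd hq).1 (mul_right_cancel₀ hγ' hij)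
  simp only [LadderShape, ne_eq, stepScalar_eq_zero_iff hq hq']
  rcases h with ⟨h0, rfl, h1⟩ | ⟨h0, rfl, h1⟩ | ⟨h0, rfl, h1⟩ | ⟨h0, rfl, h1⟩
  · refine Or.inl ⟨h0, rfl, stepScalar_cycle hq (by simp [pow_orderOf_eq_one]),
      fun i hi hi' hcon => ?_⟩
    rcases h1 with h1 | h1
    · have := Int.le_of_dvd (by omega)
        ((dvd_neg.2 (hz i (-1) (by rw [← hcon, h1, zpow_neg_one]))))
      omega
    · exact h1 i hcon
  · exact Or.inr (Or.inl ⟨h0, rfl, h1⟩)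
  · refine Or.inr (Or.inr (Or.inl ⟨h0, rfl, by rw [h1, zpow_neg_one], fun i hi hcon => ?_⟩))
    have := hz i (-1) (by rw [← hcon, h1, zpow_neg_one])
    rw [h0, Nat.cast_zero, zero_dvd_iff] at this
    omega
  · refine Or.inr (Or.inr (Or.inr ⟨h0, rfl, by rw [h1, zpow_zero, one_mul], fun i hi hcon => ?_⟩))
    have := hz i 0 (by rw [← hcon, h1, zpow_zero, one_mul])
    rw [h0, Nat.cast_zero, zero_dvd_iff] at this
    omega

theorem zpow_inj (h : Shape q γ' γ I) (hq : q ≠ 0) {i j : ℤ} (hi : i ∈ I) (hj : j ∈ I)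
    (hij : q ^ i = q ^ j) : i = j := by
  rw [zpow_eq_zpow_iff_orderOf_dvd hq] at hij
  have h0 : orderOf q = 0 → i = j := fun h0 => by
    rw [h0, Nat.cast_zero, zero_dvd_iff] at hij
    omega
  rcases h with ⟨-, rfl, -⟩ | ⟨h1, -⟩ | ⟨h1, -⟩ | ⟨h1, -⟩
  · exact Int.eq_of_sub_eq_zero (Int.eq_zero_of_abs_lt_dvd hij (by
      simp only [Set.mem_Ico] at hi hj
      rw [abs_lt]
      omega))
  all_goals exact h0 h1

end Shape

/-! ### Weights -/

/-- A representation of the quantized Weyl algebra on `M`, given by the operators of the four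
generators. The conditions on the parameters are part of the structure, since every computation
with the operators needs them. -/
structure Rep (q₁ q₂ l : ℂ) (M : Type*) [AddCommGroup M] [Module ℂ M] where
  X₁ : Module.End ℂ M
  X₂ : Module.End ℂ M
  Y₁ : Module.End ℂ M
  Y₂ : Module.End ℂ M
  q₁_ne : q₁ ≠ 0
  q₁_ne' : q₁ ≠ 1
  q₂_ne : q₂ ≠ 0
  q₂_ne' : q₂ ≠ 1
  l_ne : l ≠ 0
  xx : ∀ v, X₁ (X₂ v) = (q₁ * l) • X₂ (X₁ v)
  yy : ∀ v, Y₁ (Y₂ v) = l • Y₂ (Y₁ v)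
  xy : ∀ v, X₁ (Y₂ v) = l⁻¹ • Y₂ (X₁ v)
  yx : ∀ v, X₂ (Y₁ v) = (q₁ * l) • Y₁ (X₂ v)
  one : ∀ v, X₁ (Y₁ v) = q₁ • Y₁ (X₁ v) + v
  two : ∀ v, X₂ (Y₂ v) = q₂ • Y₂ (X₂ v) + v + (q₁ - 1) • Y₁ (X₁ v)

namespace Rep

variable {q₁ q₂ l : ℂ} {M : Type*} [AddCommGroup M] [Module ℂ M] (D : Rep q₁ q₂ l M)

/-- The four operators of a representation. -/
def action : Action M := ⟨D.X₁, D.X₂, D.Y₁, D.Y₂⟩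

/-- The weight space for the eigenvalues `a` of `g₁ = 1 + (q₁ - 1) t₁` and `b` of
`g₂ = g₁ + (q₂ - 1) t₂`. In these coordinates `X₁` divides both `a` and `b` by `q₁`, while `X₂`
divides `b` by `q₂`. -/
noncomputable def W (a b : ℂ) : Submodule ℂ M :=
  Module.End.eigenspace (D.Y₁ * D.X₁) ((a - 1) / (q₁ - 1)) ⊓
    Module.End.eigenspace (D.Y₂ * D.X₂) ((b - a) / (q₂ - 1))

theorem mem_W {a b : ℂ} {v : M} : v ∈ D.W a b ↔
    D.Y₁ (D.X₁ v) = ((a - 1) / (q₁ - 1)) • v ∧ D.Y₂ (D.X₂ v) = ((b - a) / (q₂ - 1)) • v := by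
  simp [W]

theorem YX₁ {a b : ℂ} {v : M} (hv : v ∈ D.W a b) : D.Y₁ (D.X₁ v) = ((a - 1) / (q₁ - 1)) • v :=
  (D.mem_W.1 hv).1

theorem YX₂ {a b : ℂ} {v : M} (hv : v ∈ D.W a b) : D.Y₂ (D.X₂ v) = ((b - a) / (q₂ - 1)) • v :=
  (D.mem_W.1 hv).2

theorem XY₁ {a b : ℂ} {v : M} (hv : v ∈ D.W a b) :
    D.X₁ (D.Y₁ v) = ((q₁ * a - 1) / (q₁ - 1)) • v := by
  rw [D.one, D.YX₁ hv, smul_smul]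
  have := sub_ne_zero.2 D.q₁_ne'
  match_scalars
  field_simp
  ring

theorem XY₂ {a b : ℂ} {v : M} (hv : v ∈ D.W a b) :
    D.X₂ (D.Y₂ v) = ((q₂ * b - a) / (q₂ - 1)) • v := by
  rw [D.two, D.YX₁ hv, D.YX₂ hv, smul_smul, smul_smul]
  have := sub_ne_zero.2 D.q₁_ne'
  have := sub_ne_zero.2 D.q₂_ne'
  match_scalars
  field_simp
  ring

theorem xx' (v : M) : D.X₂ (D.X₁ v) = (q₁ * l)⁻¹ • D.X₁ (D.X₂ v) := by
  rw [D.xx, smul_smul, inv_mul_cancel₀ (mul_ne_zero D.q₁_ne D.l_ne), one_smul]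

theorem yy' (v : M) : D.Y₂ (D.Y₁ v) = l⁻¹ • D.Y₁ (D.Y₂ v) := by
  rw [D.yy, smul_smul, inv_mul_cancel₀ D.l_ne, one_smul]

theorem xy' (v : M) : D.Y₂ (D.X₁ v) = l • D.X₁ (D.Y₂ v) := by
  rw [D.xy, smul_smul, mul_inv_cancel₀ D.l_ne, one_smul]

theorem yx' (v : M) : D.Y₁ (D.X₂ v) = (q₁ * l)⁻¹ • D.X₂ (D.Y₁ v) := by
  rw [D.yx, smul_smul, inv_mul_cancel₀ (mul_ne_zero D.q₁_ne D.l_ne), one_smul]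

theorem X₁_mem {a b a' b' : ℂ} {v : M} (hv : v ∈ D.W a b) (ha : q₁ * a' = a) (hb : q₁ * b' = b) :
    D.X₁ v ∈ D.W a' b' := by
  subst ha hb
  have h1 := sub_ne_zero.2 D.q₁_ne'
  rw [mem_W]
  constructor
  · have h := D.one (D.X₁ v)
    rw [D.YX₁ hv, map_smul] at h
    have h2 : q₁ • D.Y₁ (D.X₁ (D.X₁ v)) = q₁ • ((a' - 1) / (q₁ - 1)) • D.X₁ v := by
      rw [eq_sub_of_add_eq h.symm]
      match_scalars
      field_simp
      ring
    exact smul_right_injective M D.q₁_ne h2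
  · rw [D.xx', map_smul, D.xy', D.YX₂ hv, map_smul, smul_smul, smul_smul]
    congr 1
    have := D.q₁_ne
    have := D.l_ne
    field_simp

theorem Y₁_mem {a b a' b' : ℂ} {v : M} (hv : v ∈ D.W a b) (ha : a' = q₁ * a) (hb : b' = q₁ * b) :
    D.Y₁ v ∈ D.W a' b' := by
  subst ha hb
  rw [mem_W]
  constructor
  · rw [D.XY₁ hv, map_smul]
  · rw [D.yx, map_smul, D.yy', D.YX₂ hv, map_smul, smul_smul, smul_smul]
    congr 1
    have := D.l_ne
    field_simp

theorem X₂_mem {a b b' : ℂ} {v : M} (hv : v ∈ D.W a b) (hb : q₂ * b' = b) :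
    D.X₂ v ∈ D.W a b' := by
  subst hb
  have h1 := sub_ne_zero.2 D.q₁_ne'
  have h2 := sub_ne_zero.2 D.q₂_ne'
  have h3 : D.Y₁ (D.X₁ (D.X₂ v)) = ((a - 1) / (q₁ - 1)) • D.X₂ v := by
    rw [D.xx, map_smul, D.yx', D.YX₁ hv, map_smul, smul_smul, smul_smul,
      mul_inv_cancel₀ (mul_ne_zero D.q₁_ne D.l_ne), one_mul]
  refine D.mem_W.2 ⟨h3, ?_⟩
  have h := D.two (D.X₂ v)
  rw [h3, D.YX₂ hv, map_smul, smul_smul, add_assoc] at h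
  have h4 : q₂ • D.Y₂ (D.X₂ (D.X₂ v)) = q₂ • ((b' - a) / (q₂ - 1)) • D.X₂ v := by
    rw [eq_sub_of_add_eq h.symm]
    have : D.X₂ v + ((q₁ - 1) * ((a - 1) / (q₁ - 1))) • D.X₂ v = a • D.X₂ v := by
      rw [mul_div_cancel₀ _ h1]
      module
    rw [this, smul_smul, ← sub_smul]
    congr 1
    field_simp
    ring
  exact smul_right_injective M D.q₂_ne h4

theorem Y₂_mem {a b b' : ℂ} {v : M} (hv : v ∈ D.W a b) (hb : b' = q₂ * b) :
    D.Y₂ v ∈ D.W a b' := by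
  subst hb
  refine D.mem_W.2 ⟨?_, by rw [D.XY₂ hv, map_smul]⟩
  rw [D.xy, map_smul, D.yy, D.YX₁ hv, map_smul, smul_smul, smul_smul, inv_mul_cancel₀ D.l_ne,
    one_mul]

theorem X₁_ne_zero {a b : ℂ} (ha : a ≠ 1) {v : M} (hv : v ∈ D.W a b) (h0 : v ≠ 0) :
    D.X₁ v ≠ 0 := fun h1 => by
  have h2 := D.YX₁ hv
  rw [h1, map_zero] at h2
  exact smul_ne_zero (div_ne_zero (sub_ne_zero.2 ha) (sub_ne_zero.2 D.q₁_ne')) h0 h2.symm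

theorem Y₁_ne_zero {a b : ℂ} (ha : q₁ * a ≠ 1) {v : M} (hv : v ∈ D.W a b) (h0 : v ≠ 0) :
    D.Y₁ v ≠ 0 := fun h1 => by
  have h2 := D.XY₁ hv
  rw [h1, map_zero] at h2
  exact smul_ne_zero (div_ne_zero (sub_ne_zero.2 ha) (sub_ne_zero.2 D.q₁_ne')) h0 h2.symm

theorem X₂_ne_zero {a b : ℂ} (ha : b ≠ a) {v : M} (hv : v ∈ D.W a b) (h0 : v ≠ 0) :
    D.X₂ v ≠ 0 := fun h1 => by
  have h2 := D.YX₂ hv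
  rw [h1, map_zero] at h2
  exact smul_ne_zero (div_ne_zero (sub_ne_zero.2 ha) (sub_ne_zero.2 D.q₂_ne')) h0 h2.symm

theorem Y₂_ne_zero {a b : ℂ} (ha : q₂ * b ≠ a) {v : M} (hv : v ∈ D.W a b) (h0 : v ≠ 0) :
    D.Y₂ v ≠ 0 := fun h1 => by
  have h2 := D.XY₂ hv
  rw [h1, map_zero] at h2
  exact smul_ne_zero (div_ne_zero (sub_ne_zero.2 ha) (sub_ne_zero.2 D.q₂_ne')) h0 h2.symm

/-- The properties of a representation that the classification uses: it is simple, its weight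
spaces are finite-dimensional, some weight space is nonzero, and the generators satisfy the
condition that there are no proper inner breaks. -/
structure Good : Prop where
  simple : ∀ N : Submodule ℂ M, N ≠ ⊥ →
    (∀ v ∈ N, D.X₁ v ∈ N ∧ D.X₂ v ∈ N ∧ D.Y₁ v ∈ N ∧ D.Y₂ v ∈ N) → N = ⊤
  fin : ∀ a b, FiniteDimensional ℂ (D.W a b)
  exists_weight : ∃ a b, D.W a b ≠ ⊥
  X₁_zero : ∀ b, ∀ v ∈ D.W 1 b, D.X₁ v = 0
  Y₁_zero : ∀ a b, q₁ * a = 1 → ∀ v ∈ D.W a b, D.Y₁ v = 0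
  X₂_zero : ∀ a, ∀ v ∈ D.W a a, D.X₂ v = 0
  Y₂_zero : ∀ a b, q₂ * b = a → ∀ v ∈ D.W a b, D.Y₂ v = 0

namespace Good

variable {D}

theorem span_eq_top (h : D.Good) {ι : Type*} {S : Set ι} {w : ι → M} {s : ι} (hs : s ∈ S) (hw : w s ≠ 0)
    (hX₁ : ∀ s ∈ S, D.X₁ (w s) ∈ Submodule.span ℂ (w '' S))
    (hX₂ : ∀ s ∈ S, D.X₂ (w s) ∈ Submodule.span ℂ (w '' S))
    (hY₁ : ∀ s ∈ S, D.Y₁ (w s) ∈ Submodule.span ℂ (w '' S))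
    (hY₂ : ∀ s ∈ S, D.Y₂ (w s) ∈ Submodule.span ℂ (w '' S)) :
    Submodule.span ℂ (w '' S) = ⊤ := by
  have key : ∀ A : Module.End ℂ M, (∀ s ∈ S, A (w s) ∈ Submodule.span ℂ (w '' S)) →
      ∀ v ∈ Submodule.span ℂ (w '' S), A v ∈ Submodule.span ℂ (w '' S) := by
    intro A hA v hv
    have : Submodule.span ℂ (w '' S) ≤ (Submodule.span ℂ (w '' S)).comap A := by
      rw [Submodule.span_le]
      rintro _ ⟨s, hs, rfl⟩
      exact hA s hs
    exact this hv
  refine h.simple _ ?_ fun v hv => ⟨key _ hX₁ v hv, key _ hX₂ v hv, key _ hY₁ v hv,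
    key _ hY₂ v hv⟩
  rw [Submodule.ne_bot_iff]
  exact ⟨w s, Submodule.subset_span ⟨s, hs, rfl⟩, hw⟩

theorem ladder₁ (h : D.Good) (a b : ℂ) : Ladder D.X₁ D.Y₁ (fun i => D.W (q₁ ^ (-i) * a) (q₁ ^ (-i) * b))
    (stepScalar q₁ 1 a) := by
  have hq := D.q₁_ne
  have e : ∀ (i : ℤ) (x : ℂ), q₁ * (q₁ ^ (-(i + 1)) * x) = q₁ ^ (-i) * x := fun i x => by
    rw [← mul_assoc, ← zpow_one_add₀ hq]
    congr 2
    ring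
  have z : ∀ {x : ℂ}, (x - 1) / (q₁ - 1) = 0 → x = 1 := fun hx =>
    sub_eq_zero.1 ((div_eq_zero_iff.1 hx).resolve_right (sub_ne_zero.2 D.q₁_ne'))
  refine ⟨fun i v hv => D.X₁_mem hv (e i a) (e i b),
    fun i v hv => D.Y₁_mem hv (e i a).symm (e i b).symm, fun i v hv => D.YX₁ hv,
    fun i v hv => by rw [D.XY₁ hv, e, stepScalar], fun i hc v hv => ?_, fun i hc v hv => ?_⟩
  · simp only [z hc] at hv
    exact h.X₁_zero _ v hv
  · exact h.Y₁_zero _ _ (by rw [e, z hc]) v hv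

theorem ladder₂ (h : D.Good) (a b : ℂ) : Ladder D.X₂ D.Y₂ (fun i => D.W a (q₂ ^ (-i) * b))
    (stepScalar q₂ a b) := by
  have hq := D.q₂_ne
  have e : ∀ (i : ℤ) (x : ℂ), q₂ * (q₂ ^ (-(i + 1)) * x) = q₂ ^ (-i) * x := fun i x => by
    rw [← mul_assoc, ← zpow_one_add₀ hq]
    congr 2
    ring
  have z : ∀ {x : ℂ}, (x - a) / (q₂ - 1) = 0 → x = a := fun hx =>
    sub_eq_zero.1 ((div_eq_zero_iff.1 hx).resolve_right (sub_ne_zero.2 D.q₂_ne'))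
  refine ⟨fun i v hv => D.X₂_mem hv (e i b),
    fun i v hv => D.Y₂_mem hv (e i b).symm, fun i v hv => D.YX₂ hv,
    fun i v hv => by rw [D.XY₂ hv, e, stepScalar], fun i hc v hv => ?_, fun i hc v hv => ?_⟩
  · simp only [z hc] at hv
    exact h.X₂_zero _ v hv
  · exact h.Y₂_zero _ _ (by rw [e, z hc]) v hv

end Good
end Rep

/-! ### From modules to representations -/

section Reduction

variable {q₁ q₂ l : ℂ} {M : Type*} [AddCommGroup M] [Module ℂ M] [Module (Alg q₁ q₂ l) M]
  [IsScalarTower ℂ (Alg q₁ q₂ l) M]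

variable (M) in
/-- The operators of the generators on a module. -/
noncomputable def repOfModule (hq₁ : q₁ ≠ 0) (hq₁' : q₁ ≠ 1) (hq₂ : q₂ ≠ 0) (hq₂' : q₂ ≠ 1)
    (hl : l ≠ 0) : Rep q₁ q₂ l M where
  X₁ := Algebra.lsmul ℂ ℂ M (gen q₁ q₂ l (.x 0))
  X₂ := Algebra.lsmul ℂ ℂ M (gen q₁ q₂ l (.x 1))
  Y₁ := Algebra.lsmul ℂ ℂ M (gen q₁ q₂ l (.y 0))
  Y₂ := Algebra.lsmul ℂ ℂ M (gen q₁ q₂ l (.y 1))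
  q₁_ne := hq₁
  q₁_ne' := hq₁'
  q₂_ne := hq₂
  q₂_ne' := hq₂'
  l_ne := hl
  xx v := by
    have h := congrArg (fun a => a • v)
      (RingQuot.mkAlgHom_rel ℂ (Rel.xx (q₁ := q₁) (q₂ := q₂) (l := l)))
    simpa [gen, mul_smul] using h
  yy v := by
    have h := congrArg (fun a => a • v)
      (RingQuot.mkAlgHom_rel ℂ (Rel.yy (q₁ := q₁) (q₂ := q₂) (l := l)))
    simpa [gen, mul_smul] using h
  xy v := by
    have h := congrArg (fun a => a • v)
      (RingQuot.mkAlgHom_rel ℂ (Rel.xy (q₁ := q₁) (q₂ := q₂) (l := l)))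
    simpa [gen, mul_smul] using h
  yx v := by
    have h := congrArg (fun a => a • v)
      (RingQuot.mkAlgHom_rel ℂ (Rel.yx (q₁ := q₁) (q₂ := q₂) (l := l)))
    simpa [gen, mul_smul] using h
  one v := by
    have h := congrArg (fun a => a • v)
      (RingQuot.mkAlgHom_rel ℂ (Rel.one (q₁ := q₁) (q₂ := q₂) (l := l)))
    simp only [map_sub, map_mul, map_smul, map_one, sub_smul, mul_smul, smul_assoc, one_smul] at h
    simp only [gen, Algebra.lsmul_coe]
    rw [sub_eq_iff_eq_add'.1 h]
  two v := by
    have h := congrArg (fun a => a • v)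
      (RingQuot.mkAlgHom_rel ℂ (Rel.two (q₁ := q₁) (q₂ := q₂) (l := l)))
    simp only [map_sub, map_add, map_mul, map_smul, map_one, sub_smul, add_smul, mul_smul,
      smul_assoc, one_smul] at h
    simp only [gen, Algebra.lsmul_coe]
    rw [sub_eq_iff_eq_add'.1 h, sub_smul, one_smul]
    abel

theorem smul_mem_of_gen_smul_mem {N : Submodule ℂ M}
    (hN : ∀ g, ∀ v ∈ N, gen q₁ q₂ l g • v ∈ N) (a : Alg q₁ q₂ l) : ∀ v ∈ N, a • v ∈ N := by
  obtain ⟨f, rfl⟩ := RingQuot.mkAlgHom_surjective ℂ (Rel q₁ q₂ l) a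
  induction f using FreeAlgebra.induction with
  | grade0 c =>
    intro v hv
    rw [AlgHom.commutes, algebraMap_smul]
    exact N.smul_mem c hv
  | grade1 g => exact hN g
  | mul a b ha hb =>
    intro v hv
    rw [map_mul, mul_smul]
    exact ha _ (hb _ hv)
  | add a b ha hb =>
    intro v hv
    rw [map_add, add_smul]
    exact N.add_mem (ha _ hv) (hb _ hv)

theorem t_mem_R (i : Fin 2) : t q₁ q₂ l i ∈ R q₁ q₂ l :=
  Algebra.subset_adjoin ⟨i, rfl⟩

theorem gen_mul_gen_mem_R_zero :
    gen q₁ q₂ l (.x 0) * gen q₁ q₂ l (.y 0) ∈ R q₁ q₂ l := by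
  have h := RingQuot.mkAlgHom_rel ℂ (Rel.one (q₁ := q₁) (q₂ := q₂) (l := l))
  simp only [map_sub, map_mul, map_smul, map_one] at h
  have h' : gen q₁ q₂ l (.x 0) * gen q₁ q₂ l (.y 0) = q₁ • t q₁ q₂ l 0 + 1 :=
    sub_eq_iff_eq_add'.1 h
  rw [h']
  exact add_mem (Subalgebra.smul_mem _ (t_mem_R 0) _) (one_mem _)

theorem gen_mul_gen_mem_R_one :
    gen q₁ q₂ l (.x 1) * gen q₁ q₂ l (.y 1) ∈ R q₁ q₂ l := by
  have h := RingQuot.mkAlgHom_rel ℂ (Rel.two (q₁ := q₁) (q₂ := q₂) (l := l))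
  simp only [map_sub, map_add, map_mul, map_smul, map_one] at h
  have h' : gen q₁ q₂ l (.x 1) * gen q₁ q₂ l (.y 1) =
      q₂ • t q₁ q₂ l 1 + (1 + (q₁ - 1) • t q₁ q₂ l 0) :=
    sub_eq_iff_eq_add'.1 h
  rw [h']
  exact add_mem (Subalgebra.smul_mem _ (t_mem_R 1) _)
    (add_mem (one_mem _) (Subalgebra.smul_mem _ (t_mem_R 0) _))

theorem R_commute {r s : Alg q₁ q₂ l} (hr : r ∈ R q₁ q₂ l) (hs : s ∈ R q₁ q₂ l) :
    Commute r s := by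
  have h1 : ∀ i j, Commute (t q₁ q₂ l i) (t q₁ q₂ l j) := by
    intro i j
    fin_cases i <;> fin_cases j
    exacts [Commute.refl _, t_comm q₁ q₂ l, (t_comm q₁ q₂ l).symm, Commute.refl _]
  refine Algebra.commute_of_mem_adjoin_of_forall_mem_commute hs ?_
  rintro _ ⟨i, rfl⟩
  refine (Algebra.commute_of_mem_adjoin_of_forall_mem_commute hr ?_).symm
  rintro _ ⟨j, rfl⟩
  exact h1 i j

variable (q₁ q₂ l) in
/-- The ideal of `R` that annihilates a vector. -/
noncomputable def annR (v : M) : Ideal (R q₁ q₂ l) where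
  carrier := {r | (r : Alg q₁ q₂ l) • v = 0}
  add_mem' := fun {a b} ha hb => by
    change ((a : Alg q₁ q₂ l) + b) • v = 0
    rw [add_smul, ha, hb, add_zero]
  zero_mem' := zero_smul _ v
  smul_mem' := fun a b hb => by
    change ((a : Alg q₁ q₂ l) * b) • v = 0
    rw [mul_smul, hb, smul_zero]

variable {hq₁ : q₁ ≠ 0} {hq₁' : q₁ ≠ 1} {hq₂ : q₂ ≠ 0} {hq₂' : q₂ ≠ 1} {hl : l ≠ 0} {a b : ℂ}

theorem exists_scalar_of_mem_R {r : Alg q₁ q₂ l} (hr : r ∈ R q₁ q₂ l) : ∃ c : ℂ,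
    ∀ v ∈ (repOfModule M hq₁ hq₁' hq₂ hq₂' hl).W a b, r • v = c • v := by
  induction hr using Algebra.adjoin_induction with
  | mem x hx =>
    obtain ⟨i, rfl⟩ := hx
    fin_cases i
    · refine ⟨(a - 1) / (q₁ - 1), fun v hv => ?_⟩
      rw [← (repOfModule M hq₁ hq₁' hq₂ hq₂' hl).YX₁ hv]
      exact mul_smul _ _ _
    · refine ⟨(b - a) / (q₂ - 1), fun v hv => ?_⟩
      rw [← (repOfModule M hq₁ hq₁' hq₂ hq₂' hl).YX₂ hv]
      exact mul_smul _ _ _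
  | algebraMap c => exact ⟨c, fun v _ => algebraMap_smul _ c v⟩
  | add x y _ _ hx hy =>
    obtain ⟨c, hc⟩ := hx
    obtain ⟨d, hd⟩ := hy
    exact ⟨c + d, fun v hv => by rw [add_smul, add_smul, hc v hv, hd v hv]⟩
  | mul x y _ _ hx hy =>
    obtain ⟨c, hc⟩ := hx
    obtain ⟨d, hd⟩ := hy
    exact ⟨c * d, fun v hv => by
      rw [mul_smul, hd v hv, smul_comm, hc v hv, smul_smul, mul_comm]⟩

/-- A weight vector is an eigenvector of all of `R`, so that its annihilator is the kernel of a
character. -/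
theorem annR_isMaximal {v : M} (hv : v ∈ (repOfModule M hq₁ hq₁' hq₂ hq₂' hl).W a b)
    (hv0 : v ≠ 0) : (annR q₁ q₂ l v).IsMaximal := by
  refine ⟨⟨?_, fun J hJ => ?_⟩⟩
  · intro h
    have h1 : (1 : R q₁ q₂ l) ∈ annR q₁ q₂ l v := h ▸ Submodule.mem_top
    exact hv0 (by simpa using (show ((1 : R q₁ q₂ l) : Alg q₁ q₂ l) • v = 0 from h1))
  · obtain ⟨hle, x, hxJ, hx⟩ := SetLike.lt_iff_le_and_exists.1 hJ
    obtain ⟨c, hc⟩ := exists_scalar_of_mem_R (M := M) (hq₁ := hq₁) (hq₁' := hq₁') (hq₂ := hq₂)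
      (hq₂' := hq₂') (hl := hl) (a := a) (b := b) x.2
    have hc0 : c ≠ 0 := by
      rintro rfl
      exact hx ((hc v hv).trans (zero_smul ℂ v))
    have h1 : algebraMap ℂ (R q₁ q₂ l) c + (-1 : ℂ) • x ∈ annR q₁ q₂ l v := by
      change (algebraMap ℂ (Alg q₁ q₂ l) c + (-1 : ℂ) • (x : Alg q₁ q₂ l)) • v = 0
      rw [add_smul, smul_assoc, hc v hv, algebraMap_smul, neg_one_smul, add_neg_cancel]
    have h2 : algebraMap ℂ (R q₁ q₂ l) c ∈ J := by
      have h3 := J.add_mem (hle h1) hxJ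
      have h4 : (-1 : ℂ) • x + x = 0 := by
        nth_rewrite 2 [← one_smul ℂ x]
        rw [← add_smul, neg_add_cancel, zero_smul]
      rwa [add_assoc, h4, add_zero] at h3
    rw [Ideal.eq_top_iff_one]
    have := J.mul_mem_left (algebraMap ℂ (R q₁ q₂ l) c⁻¹) h2
    rwa [← map_mul, inv_mul_cancel₀ hc0, map_one] at this

theorem W_le_weightSpace {v : M} (hv : v ∈ (repOfModule M hq₁ hq₁' hq₂ hq₂' hl).W a b)
    (hv0 : v ≠ 0) :
    (repOfModule M hq₁ hq₁' hq₂ hq₂' hl).W a b ≤ weightSpace q₁ q₂ l M (annR q₁ q₂ l v) := by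
  intro u hu r hr
  obtain ⟨c, hc⟩ := exists_scalar_of_mem_R (M := M) (hq₁ := hq₁) (hq₁' := hq₁') (hq₂ := hq₂)
    (hq₂' := hq₂') (hl := hl) (a := a) (b := b) r.2
  have h1 : (r : Alg q₁ q₂ l) • v = 0 := hr
  rw [hc v hv] at h1
  rw [hc u hu, (smul_eq_zero.1 h1).resolve_right hv0, zero_smul]

/-- Only words of length one are needed from the condition on inner breaks. -/
theorem gen_smul_eq_zero (hbreaks : NoProperInnerBreaks q₁ q₂ l M) (g : Gen)
    (hg : gen q₁ q₂ l g.adj * gen q₁ q₂ l g ∈ R q₁ q₂ l) {v : M}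
    (hv : v ∈ (repOfModule M hq₁ hq₁' hq₂ hq₂' hl).W a b)
    (h : gen q₁ q₂ l g.adj • gen q₁ q₂ l g • v = 0) : gen q₁ q₂ l g • v = 0 := by
  by_contra h0
  have hv0 : v ≠ 0 := by
    rintro rfl
    exact h0 (smul_zero _)
  have hvm := W_le_weightSpace hv hv0 hv
  refine hbreaks _ (annR_isMaximal hv hv0) ?_ [g] ⟨v, hvm, by simpa [word] using h0⟩ ⟨_, hg⟩ ?_ ?_
  · rw [Submodule.ne_bot_iff]
    exact ⟨v, hvm, hv0⟩
  · change (gen q₁ q₂ l g.adj * gen q₁ q₂ l g) • v = 0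
    rw [mul_smul, h]
  · simp [word, adjWord]

theorem repOfModule_good (hsimple : IsSimpleModule (Alg q₁ q₂ l) M)
    (hweight : IsWeightModule q₁ q₂ l M) (hfin : IsLocallyFinite q₁ q₂ l M)
    (hbreaks : NoProperInnerBreaks q₁ q₂ l M) :
    (repOfModule M hq₁ hq₁' hq₂ hq₂' hl).Good where
  simple N hN hinv := by
    have hN' : ∀ g, ∀ v ∈ N, gen q₁ q₂ l g • v ∈ N := by
      rintro (i | i) v hv <;> fin_cases i
      exacts [(hinv v hv).1, (hinv v hv).2.1, (hinv v hv).2.2.1, (hinv v hv).2.2.2]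
    let N' : Submodule (Alg q₁ q₂ l) M :=
      { N.toAddSubmonoid with smul_mem' := fun a v hv => smul_mem_of_gen_smul_mem hN' a v hv }
    rcases eq_bot_or_eq_top N' with h | h
    · refine absurd ?_ hN
      rw [Submodule.eq_bot_iff]
      intro v hv
      have : v ∈ N' := hv
      rwa [h] at this
    · rw [Submodule.eq_top_iff']
      intro v
      have : v ∈ N' := h ▸ Submodule.mem_top
      exact this
  fin a b := by
    by_cases hW : (repOfModule M hq₁ hq₁' hq₂ hq₂' hl).W a b = ⊥
    · rw [hW]
      infer_instance
    · obtain ⟨v, hv, hv0⟩ := Submodule.exists_mem_ne_zero_of_ne_bot hW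
      have := hfin _ (annR_isMaximal hv hv0)
      exact Submodule.finiteDimensional_of_le (W_le_weightSpace hv hv0)
  exists_weight := by
    have : Nontrivial M := IsSimpleModule.nontrivial (Alg q₁ q₂ l) M
    obtain ⟨m, hm, hne⟩ : ∃ m : Ideal (R q₁ q₂ l), m.IsMaximal ∧ weightSpace q₁ q₂ l M m ≠ ⊥ := by
      by_contra! hcon
      have h1 := hweight.submodule_iSup_eq_top
      simp only [hcon _ (Subtype.prop _), iSup_bot] at h1
      exact bot_ne_top h1
    have := hfin m hm
    have hinv : ∀ i, ∀ v ∈ weightSpace q₁ q₂ l M m,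
        Algebra.lsmul ℂ ℂ M (t q₁ q₂ l i) v ∈ weightSpace q₁ q₂ l M m := by
      intro i v hv r hr
      rw [Algebra.lsmul_coe, ← mul_smul, (R_commute r.2 (t_mem_R i)).eq, mul_smul, hv r hr,
        smul_zero]
    obtain ⟨c, d, v, -, hv0, hc, hd⟩ := exists_joint_eigenvector hne _ _ (hinv 0) (hinv 1)
      (fun v _ => by
        simp only [Algebra.lsmul_coe]
        rw [← mul_smul, ← mul_smul, (t_comm q₁ q₂ l).eq])
    have h1 := sub_ne_zero.2 hq₁'
    have h2 := sub_ne_zero.2 hq₂'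
    refine ⟨1 + (q₁ - 1) * c, 1 + (q₁ - 1) * c + (q₂ - 1) * d, ?_⟩
    rw [Submodule.ne_bot_iff]
    refine ⟨v, ((repOfModule M hq₁ hq₁' hq₂ hq₂' hl).mem_W).2 ⟨?_, ?_⟩, hv0⟩
    · rw [add_sub_cancel_left, mul_div_cancel_left₀ _ h1, ← hc]
      exact (mul_smul _ _ _).symm
    · rw [add_sub_cancel_left, mul_div_cancel_left₀ _ h2, ← hd]
      exact (mul_smul _ _ _).symm
  X₁_zero b v hv := gen_smul_eq_zero hbreaks (.x 0) (t_mem_R 0) hv (by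
    have := (repOfModule M hq₁ hq₁' hq₂ hq₂' hl).YX₁ hv
    rwa [sub_self, zero_div, zero_smul] at this)
  X₂_zero a v hv := gen_smul_eq_zero hbreaks (.x 1) (t_mem_R 1) hv (by
    have := (repOfModule M hq₁ hq₁' hq₂ hq₂' hl).YX₂ hv
    rwa [sub_self, zero_div, zero_smul] at this)
  Y₁_zero a b hab v hv := gen_smul_eq_zero hbreaks (.y 0) gen_mul_gen_mem_R_zero hv (by
    have := (repOfModule M hq₁ hq₁' hq₂ hq₂' hl).XY₁ hv
    rwa [hab, sub_self, zero_div, zero_smul] at this)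
  Y₂_zero a b hab v hv := gen_smul_eq_zero hbreaks (.y 1) gen_mul_gen_mem_R_one hv (by
    have := (repOfModule M hq₁ hq₁' hq₂ hq₂' hl).XY₂ hv
    rwa [hab, sub_self, zero_div, zero_smul] at this)

end Reduction

/-! ### The grid of vectors generated by a weight vector -/

namespace Rep

variable {q₁ q₂ l : ℂ} {M : Type*} [AddCommGroup M] [Module ℂ M] (D : Rep q₁ q₂ l M)

/-- `X₁ ^ i` on weights `(a, _)`, with inverses expressed by `Y₁`. -/
noncomputable def P₁ (a : ℂ) (i : ℤ) : Module.End ℂ M :=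
  ladderOp D.X₁ D.Y₁ (stepScalar q₁ 1 a) i

/-- `X₂ ^ j` on weights `(a, b)`, with inverses expressed by `Y₂`. -/
noncomputable def P₂ (a b : ℂ) (j : ℤ) : Module.End ℂ M :=
  ladderOp D.X₂ D.Y₂ (stepScalar q₂ a b) j

theorem X₂_P₁ (a : ℂ) (i : ℤ) (v : M) :
    D.X₂ (D.P₁ a i v) = (q₁ * l) ^ (-i) • D.P₁ a i (D.X₂ v) := by
  rw [zpow_neg, ← inv_zpow]
  exact apply_ladderOp _ D.xx' (fun v => by rw [inv_inv]; exact D.yx v) i v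

theorem Y₂_P₁ (a : ℂ) (i : ℤ) (v : M) : D.Y₂ (D.P₁ a i v) = l ^ i • D.P₁ a i (D.Y₂ v) :=
  apply_ladderOp _ D.xy' D.yy' i v

/-- A power of `X₁` that fixes all weights. The scalars inside `P₂` are those of a weight
`(a, b)`, hence the restriction to `q₁ ^ n = 1`. -/
theorem pow_X₁_P₂ (a b : ℂ) {n : ℕ} (hn : q₁ ^ n = 1) (j : ℤ) (v : M) :
    (D.X₁ ^ n) (D.P₂ a b j v) = l ^ (n * j) • D.P₂ a b j ((D.X₁ ^ n) v) := by
  rw [zpow_mul, zpow_natCast]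
  refine apply_ladderOp _ (fun v => ?_) (fun v => ?_) j v
  · rw [pow_apply_comm D.xx, mul_pow, hn, one_mul]
  · rw [pow_apply_comm D.xy, inv_pow]

variable {D}

theorem P₁_mem (h : D.Good) {a b : ℂ} {v : M} (hv : v ∈ D.W a b) (i : ℤ) :
    D.P₁ a i v ∈ D.W (q₁ ^ (-i) * a) (q₁ ^ (-i) * b) :=
  (h.ladder₁ a b).op_mem (by simpa using hv) i

theorem P₂_mem (h : D.Good) {a b : ℂ} {v : M} (hv : v ∈ D.W a b) (j : ℤ) :
    D.P₂ a b j v ∈ D.W a (q₂ ^ (-j) * b) :=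
  (h.ladder₂ a b).op_mem (by simpa using hv) j

theorem P₁_P₂_mem (h : D.Good) {a b : ℂ} {v : M} (hv : v ∈ D.W a b) (i j : ℤ) :
    D.P₁ a i (D.P₂ a b j v) ∈ D.W (q₁ ^ (-i) * a) (q₁ ^ (-i) * (q₂ ^ (-j) * b)) :=
  P₁_mem h (P₂_mem h hv j) i

/-- Vectors in weight spaces are linearly independent as soon as they are separated by their
weights together with the eigenvalues `θ` of one further operator `A`. -/
theorem linearIndepOn_of_weight {ι : Type*} {S : Set ι} {w : ι → M} {α β θ : ι → ℂ}
    (A : Module.End ℂ M) (hw : ∀ s ∈ S, w s ∈ D.W (α s) (β s)) (hne : ∀ s ∈ S, w s ≠ 0)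
    (hA : ∀ s ∈ S, A (w s) = θ s • w s)
    (hinj : ∀ s ∈ S, ∀ s' ∈ S, α s = α s' → β s = β s' → θ s = θ s' → s = s') :
    LinearIndepOn ℂ w S := by
  refine linearIndepOn_of_eigen (κ := Fin 3) ![D.Y₁ * D.X₁, D.Y₂ * D.X₂, A]
    ![fun s => (α s - 1) / (q₁ - 1), fun s => (β s - α s) / (q₂ - 1), θ] ?_ hne ?_
  · intro k s hs
    fin_cases k
    exacts [D.YX₁ (hw s hs), D.YX₂ (hw s hs), hA s hs]
  · intro s hs s' hs' he
    have h0 := he 0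
    have h1 := he 1
    simp only [Matrix.cons_val] at h0 h1
    rw [div_left_inj' (sub_ne_zero.2 D.q₁_ne'), sub_left_inj] at h0
    rw [div_left_inj' (sub_ne_zero.2 D.q₂_ne'), h0, sub_left_inj] at h1
    exact hinj s hs s' hs' h0 h1 (he 2)

section Grid

variable {a b : ℂ} {N₁ N₂ : ℕ} {I₁ I₂ : Set ℤ}

theorem grid_ne_zero (h : D.Good) (hI₁ : LadderShape N₁ (stepScalar q₁ 1 a) I₁)
    (hI₂ : LadderShape N₂ (stepScalar q₂ a b) I₂) {v : M} (hv : v ∈ D.W a b) (hv0 : v ≠ 0)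
    {i j : ℤ} (hi : i ∈ I₁) (hj : j ∈ I₂) : D.P₁ a i (D.P₂ a b j v) ≠ 0 :=
  hI₁.op_ne_zero (h.ladder₁ a (q₂ ^ (-j) * b)) (by simpa [P₂] using P₂_mem h hv j)
    (hI₂.op_ne_zero (h.ladder₂ a b) (by simpa using hv) hv0 hj) hi

/-- The grid is stable under the generators when the cycles close up, so it spans. -/
theorem grid_span (h : D.Good) (hI₁ : LadderShape N₁ (stepScalar q₁ 1 a) I₁)
    (hI₂ : LadderShape N₂ (stepScalar q₂ a b) I₂) {v : M} (hv : v ∈ D.W a b) (hv0 : v ≠ 0)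
    {μ : ℂ} (hμ0 : μ ≠ 0) (hμ : 0 < N₂ → stepScalar q₂ a b (-1) ≠ 0 → (D.X₂ ^ N₂) v = μ • v)
    {τ : ℤ → ℂ} (hτ0 : ∀ j ∈ I₂, τ j ≠ 0)
    (hτ : ∀ j ∈ I₂, 0 < N₁ → stepScalar q₁ 1 a (-1) ≠ 0 →
      (D.X₁ ^ N₁) (D.P₂ a b j v) = τ j • D.P₂ a b j v) :
    Submodule.span ℂ ((fun s : ℤ × ℤ => D.P₁ a s.1 (D.P₂ a b s.2 v)) '' (I₁ ×ˢ I₂)) = ⊤ := by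
  have hL₂ : v ∈ D.W a (q₂ ^ (-(0 : ℤ)) * b) := by simpa using hv
  have hL₁ : ∀ j, D.P₂ a b j v ∈ D.W (q₁ ^ (-(0 : ℤ)) * a) (q₁ ^ (-(0 : ℤ)) * (q₂ ^ (-j) * b)) :=
    fun j => by simpa using P₂_mem h hv j
  have h1 : ∀ j ∈ I₂,
      Submodule.span ℂ ((fun i => D.P₁ a i (D.P₂ a b j v)) '' I₁) ≤
      Submodule.span ℂ ((fun s : ℤ × ℤ => D.P₁ a s.1 (D.P₂ a b s.2 v)) '' (I₁ ×ˢ I₂)) := by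
    intro j hj
    refine Submodule.span_mono ?_
    rintro _ ⟨i, hi, rfl⟩
    exact ⟨(i, j), ⟨hi, hj⟩, rfl⟩
  have h2 : ∀ i ∈ I₁, ∀ u ∈ Submodule.span ℂ ((fun j => D.P₂ a b j v) '' I₂), D.P₁ a i u ∈
      Submodule.span ℂ ((fun s : ℤ × ℤ => D.P₁ a s.1 (D.P₂ a b s.2 v)) '' (I₁ ×ˢ I₂)) := by
    intro i hi u hu
    have : Submodule.span ℂ ((fun j => D.P₂ a b j v) '' I₂) ≤
        (Submodule.span ℂ ((fun s : ℤ × ℤ => D.P₁ a s.1 (D.P₂ a b s.2 v)) '' (I₁ ×ˢ I₂))).comap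
          (D.P₁ a i) := by
      rw [Submodule.span_le]
      rintro _ ⟨j, hj, rfl⟩
      exact Submodule.subset_span ⟨(i, j), ⟨hi, hj⟩, rfl⟩
    exact this hu
  refine h.span_eq_top (s := (0, 0)) ⟨hI₁.zero_mem, hI₂.zero_mem⟩ (by simpa [P₁, P₂] using hv0)
    ?_ ?_ ?_ ?_
  · rintro ⟨i, j⟩ ⟨hi, hj⟩
    exact h1 j hj (hI₁.X_op_mem_span (h.ladder₁ a _) (hL₁ j) (hτ j hj) hi)
  · rintro ⟨i, j⟩ ⟨hi, hj⟩
    rw [X₂_P₁]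
    exact Submodule.smul_mem _ _
      (h2 i hi _ (hI₂.X_op_mem_span (h.ladder₂ a b) hL₂ hμ hj))
  · rintro ⟨i, j⟩ ⟨hi, hj⟩
    exact h1 j hj (hI₁.Y_op_mem_span (h.ladder₁ a _) (hL₁ j) (hτ0 j hj) (hτ j hj) hi)
  · rintro ⟨i, j⟩ ⟨hi, hj⟩
    rw [Y₂_P₁]
    exact Submodule.smul_mem _ _
      (h2 i hi _ (hI₂.Y_op_mem_span (h.ladder₂ a b) hL₂ hμ0 hμ hj))

end Grid

/-! ### Generic weights -/

/-- A weight vector at a normalized base weight generates one of the generic modules, provided that it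
is an eigenvector of `X_i ^ o_i` in each direction `i` that is a cycle without breaks. -/
theorem famGen_of_shape (h : D.Good) {a b : ℂ} (ha : a ≠ 0) (hb : b ≠ 0) {I₁ I₂ : Set ℤ}
    (hI₁ : Shape q₁ 1 a I₁) (hI₂ : Shape q₂ a b I₂)
    (hexc : ¬ (0 < orderOf q₁ ∧ 0 < orderOf q₂ ∧
      (∀ k : ℤ, a ≠ q₁ ^ k) ∧ (∀ k : ℤ, b ≠ q₂ ^ k * a)))
    {v : M} (hv : v ∈ D.W a b) (hv0 : v ≠ 0) {ρ μ : ℂ} (hρ0 : ρ ≠ 0) (hμ0 : μ ≠ 0)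
    (hρ : 0 < orderOf q₁ → stepScalar q₁ 1 a (-1) ≠ 0 → (D.X₁ ^ orderOf q₁) v = ρ • v)
    (hμ : 0 < orderOf q₂ → stepScalar q₂ a b (-1) ≠ 0 → (D.X₂ ^ orderOf q₂) v = μ • v) :
    FamGen q₁ q₂ l D.action := by
  have hS₁ := hI₁.ladderShape D.q₁_ne D.q₁_ne' one_ne_zero
  have hS₂ := hI₂.ladderShape D.q₂_ne D.q₂_ne' ha
  have hτ0 : ∀ j : ℤ, ρ * l ^ ((orderOf q₁ : ℤ) * j) ≠ 0 := fun j =>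
    mul_ne_zero hρ0 (zpow_ne_zero _ D.l_ne)
  have hτ : ∀ j : ℤ, 0 < orderOf q₁ → stepScalar q₁ 1 a (-1) ≠ 0 →
      (D.X₁ ^ orderOf q₁) (D.P₂ a b j v) =
        (ρ * l ^ ((orderOf q₁ : ℤ) * j)) • D.P₂ a b j v := fun j h0 h1 => by
    rw [pow_X₁_P₂ D a b (pow_orderOf_eq_one q₁), hρ h0 h1, map_smul, smul_smul, mul_comm]
  have hL₂ : v ∈ D.W a (q₂ ^ (-(0 : ℤ)) * b) := by simpa using hv
  have hL₁ : ∀ j, D.P₂ a b j v ∈ D.W (q₁ ^ (-(0 : ℤ)) * a) (q₁ ^ (-(0 : ℤ)) * (q₂ ^ (-j) * b)) :=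
    fun j => by simpa using P₂_mem h hv j
  have hγ₁ : a = 1 + (q₁ - 1) * ((a - 1) / (q₁ - 1)) := by
    rw [mul_div_cancel₀ _ (sub_ne_zero.2 D.q₁_ne')]
    ring
  have hγ₂ : b = a + (q₂ - 1) * ((b - a) / (q₂ - 1)) := by
    rw [mul_div_cancel₀ _ (sub_ne_zero.2 D.q₂_ne')]
    ring
  refine ⟨(a - 1) / (q₁ - 1), (b - a) / (q₂ - 1), a, b, ρ, μ, I₁, I₂,
    fun s => D.P₁ a s.1 (D.P₂ a b s.2 v), hγ₁, hγ₂, ha, hb, hI₁, hI₂, hexc, hρ0, hμ0, ⟨?_, ?_⟩, ?_⟩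
  · refine linearIndepOn_of_weight (D := D) (θ := 1) 1 (fun s _ => P₁_P₂_mem h hv s.1 s.2)
      (fun s hs => grid_ne_zero h hS₁ hS₂ hv hv0 hs.1 hs.2) (fun s _ => by simp) ?_
    rintro ⟨i, j⟩ ⟨hi, hj⟩ ⟨i', j'⟩ ⟨hi', hj'⟩ h1 h2 -
    have e1 : q₁ ^ (-i) = q₁ ^ (-i') := mul_right_cancel₀ ha h1
    simp only [e1] at h2
    have e2 := mul_right_cancel₀ hb (mul_left_cancel₀ (zpow_ne_zero _ D.q₁_ne) h2)
    rw [zpow_neg, zpow_neg, inv_inj] at e1 e2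
    exact Prod.ext (hI₁.zpow_inj D.q₁_ne hi hi' e1) (hI₂.zpow_inj D.q₂_ne hj hj' e2)
  · exact grid_span h hS₁ hS₂ hv hv0 hμ0 hμ (fun j _ => hτ0 j) (fun j _ => hτ j)
  · intro i hi j hj
    have c₁ : ∀ {k : ℤ}, (a - 1) / (q₁ - 1) ≠ qint q₁ k ↔ stepScalar q₁ 1 a k ≠ 0 := by
      intro k
      rw [stepScalar_ne_zero_iff D.q₁_ne D.q₁_ne', mul_one]
    have c₂ : ∀ {k : ℤ}, (b - a) / (q₂ - 1) ≠ qint q₂ k * (1 + (q₁ - 1) * ((a - 1) / (q₁ - 1))) ↔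
        stepScalar q₂ a b k ≠ 0 := by
      intro k
      rw [stepScalar_ne_zero_iff D.q₂_ne D.q₂_ne', ← hγ₁]
    have d₁ : q₁ ^ (-i + 1) * ((a - 1) / (q₁ - 1) - qint q₁ (i - 1)) =
        stepScalar q₁ 1 a (i - 1) := by
      rw [stepScalar_eq D.q₁_ne D.q₁_ne', mul_one, show -(i - 1) = -i + 1 by ring]
    have d₂ : l ^ i * q₂ ^ (-j + 1) *
        ((b - a) / (q₂ - 1) - qint q₂ (j - 1) * (1 + (q₁ - 1) * ((a - 1) / (q₁ - 1)))) =
        l ^ i * stepScalar q₂ a b (j - 1) := by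
      rw [stepScalar_eq D.q₂_ne D.q₂_ne', ← hγ₁, show -(j - 1) = -j + 1 by ring, mul_assoc]
    simp only [c₁, c₂, d₁, d₂]
    refine ⟨?_, ?_, ?_, ?_⟩
    · change D.X₁ (D.P₁ a i (D.P₂ a b j v)) = _
      split_ifs with hi' hc
      · exact hS₁.X_op (h.ladder₁ a _) (hL₁ j) hi hi'
      · exact (hS₁.X_op_end (h.ladder₁ a _) (hL₁ j) (hτ j) hi hi').1 hc
      · exact (hS₁.X_op_end (h.ladder₁ a _) (hL₁ j) (hτ j) hi hi').2 hc
    · change D.X₂ (D.P₁ a i (D.P₂ a b j v)) = _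
      rw [X₂_P₁]
      congr 1
      split_ifs with hj' hc
      · exact congrArg (D.P₁ a i) (hS₂.X_op (h.ladder₂ a b) hL₂ hj hj')
      · rw [P₂, (hS₂.X_op_end (h.ladder₂ a b) hL₂ hμ hj hj').1 hc, map_smul]
        rfl
      · rw [P₂, (hS₂.X_op_end (h.ladder₂ a b) hL₂ hμ hj hj').2 hc, map_zero]
    · change D.Y₁ (D.P₁ a i (D.P₂ a b j v)) = _
      split_ifs with hi' hc
      · exact hS₁.Y_op (h.ladder₁ a _) (hL₁ j) hi hi'
      · exact (hS₁.Y_op_end (h.ladder₁ a _) (hL₁ j) (hτ0 j) (hτ j) hi hi').1 hc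
      · rw [smul_zero]
        exact (hS₁.Y_op_end (h.ladder₁ a _) (hL₁ j) (hτ0 j) (hτ j) hi hi').2 hc
    · change D.Y₂ (D.P₁ a i (D.P₂ a b j v)) = _
      rw [Y₂_P₁, mul_smul]
      congr 1
      split_ifs with hj' hc
      · rw [P₂, hS₂.Y_op (h.ladder₂ a b) hL₂ hj hj', map_smul]
        rfl
      · rw [P₂, (hS₂.Y_op_end (h.ladder₂ a b) hL₂ hμ0 hμ hj hj').1 hc, map_smul, map_smul]
        rfl
      · rw [P₂, (hS₂.Y_op_end (h.ladder₂ a b) hL₂ hμ0 hμ hj hj').2 hc, map_zero, smul_zero]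

end Rep

/-! ### Choice of the base weight -/

section BaseWeight

variable {q γ' : ℂ} {Q : ℂ → Prop}

/-- Dividing by `q` leads from `q ^ k γ'` to `γ'`, either directly or around a cycle. -/
theorem descend_to_break (hq : q ≠ 0) (hdown : ∀ γ, Q γ → γ ≠ γ' → Q (q⁻¹ * γ)) {k : ℤ}
    (hk : 0 ≤ k ∨ 0 < orderOf q) (h : Q (q ^ k * γ')) : Q γ' := by
  have key : ∀ n : ℕ, Q (q ^ n * γ') → Q γ' := by
    intro n
    induction n with
    | zero => intro h; simpa using h
    | succ n ih =>
      intro h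
      by_cases h1 : q ^ (n + 1) * γ' = γ'
      · rwa [h1] at h
      · have := hdown _ h h1
        rw [pow_succ', mul_assoc, inv_mul_cancel_left₀ hq] at this
        exact ih this
  rcases lt_or_ge k 0 with h0 | h0
  · have ho := hk.resolve_left (by omega)
    refine key (k + orderOf q * (-k)).toNat ?_
    have h1 : 0 ≤ k + orderOf q * (-k) := by nlinarith
    have h2 : q ^ k = q ^ (k + orderOf q * (-k)) :=
      (zpow_eq_zpow_iff_orderOf_dvd hq).2 ⟨k, by ring⟩
    rw [← zpow_natCast, Int.toNat_of_nonneg h1, ← h2]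
    exact h
  · obtain ⟨n, rfl⟩ := Int.eq_ofNat_of_zero_le h0
    exact key n (by simpa using h)

/-- Multiplying by `q` leads from `q ^ k γ'` to `q⁻¹ γ'`, either directly or around a cycle. -/
theorem ascend_to_break (hq : q ≠ 0) (hup : ∀ γ, Q γ → q * γ ≠ γ' → Q (q * γ)) {k : ℤ}
    (hk : k < 0 ∨ 0 < orderOf q) (h : Q (q ^ k * γ')) : Q (q⁻¹ * γ') := by
  -- `descend_to_break` for `q⁻¹` in place of `q`
  refine descend_to_break (q := q⁻¹) (k := -k - 1) (inv_ne_zero hq) (fun γ hγ hne => ?_)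
    ?_ ?_
  · rw [inv_inv]
    refine hup γ hγ fun h1 => hne ?_
    rw [← h1, inv_mul_cancel_left₀ hq]
  · have : orderOf q⁻¹ = orderOf q := Nat.dvd_antisymm
      (orderOf_dvd_iff_pow_eq_one.2 (by rw [inv_pow, pow_orderOf_eq_one, inv_one]))
      (orderOf_dvd_iff_pow_eq_one.2 (by
        rw [← inv_inj, ← inv_pow, pow_orderOf_eq_one, inv_one]))
    omega
  · rw [← mul_assoc, ← zpow_add_one₀ (inv_ne_zero hq), sub_add_cancel, inv_zpow, ← zpow_neg,
      neg_neg]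
    exact h

/-- Along a string of weights a base weight of one of the standard shapes can be reached. -/
theorem exists_shape (hq : q ≠ 0) (hdown : ∀ γ, Q γ → γ ≠ γ' → Q (q⁻¹ * γ))
    (hup : ∀ γ, Q γ → q * γ ≠ γ' → Q (q * γ)) {γ : ℂ} (h : Q γ) :
    ∃ γ I, Shape q γ' γ I ∧ Q γ := by
  by_cases hk : ∃ k : ℤ, γ = q ^ k * γ'
  · obtain ⟨k, rfl⟩ := hk
    rcases Nat.eq_zero_or_pos (orderOf q) with ho | ho
    · rcases lt_or_ge k 0 with h0 | h0
      · exact ⟨_, _, Or.inr (Or.inr (Or.inl ⟨ho, rfl, rfl⟩)), ascend_to_break hq hup (Or.inl h0) h⟩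
      · exact ⟨_, _, Or.inr (Or.inr (Or.inr ⟨ho, rfl, rfl⟩)),
          descend_to_break hq hdown (Or.inl h0) h⟩
    · exact ⟨_, _, Or.inl ⟨ho, rfl, Or.inl rfl⟩, ascend_to_break hq hup (Or.inr ho) h⟩
  · push Not at hk
    rcases Nat.eq_zero_or_pos (orderOf q) with ho | ho
    · exact ⟨γ, _, Or.inr (Or.inl ⟨ho, rfl, hk⟩), h⟩
    · exact ⟨γ, _, Or.inl ⟨ho, rfl, Or.inr hk⟩, h⟩

end BaseWeight

namespace Rep

variable {q₁ q₂ l : ℂ} {M : Type*} [AddCommGroup M] [Module ℂ M] {D : Rep q₁ q₂ l M}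

theorem W_X₁_ne_bot {a b : ℂ} (ha : a ≠ 1) (hW : D.W a b ≠ ⊥) :
    D.W (q₁⁻¹ * a) (q₁⁻¹ * b) ≠ ⊥ := by
  obtain ⟨v, hv, hv0⟩ := Submodule.exists_mem_ne_zero_of_ne_bot hW
  exact (Submodule.ne_bot_iff _).2 ⟨_, D.X₁_mem hv (mul_inv_cancel_left₀ D.q₁_ne _)
    (mul_inv_cancel_left₀ D.q₁_ne _), D.X₁_ne_zero ha hv hv0⟩

theorem W_Y₁_ne_bot {a b : ℂ} (ha : q₁ * a ≠ 1) (hW : D.W a b ≠ ⊥) :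
    D.W (q₁ * a) (q₁ * b) ≠ ⊥ := by
  obtain ⟨v, hv, hv0⟩ := Submodule.exists_mem_ne_zero_of_ne_bot hW
  exact (Submodule.ne_bot_iff _).2 ⟨_, D.Y₁_mem hv rfl rfl, D.Y₁_ne_zero ha hv hv0⟩

theorem W_X₂_ne_bot {a b : ℂ} (ha : b ≠ a) (hW : D.W a b ≠ ⊥) : D.W a (q₂⁻¹ * b) ≠ ⊥ := by
  obtain ⟨v, hv, hv0⟩ := Submodule.exists_mem_ne_zero_of_ne_bot hW
  exact (Submodule.ne_bot_iff _).2 ⟨_, D.X₂_mem hv (mul_inv_cancel_left₀ D.q₂_ne _),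
    D.X₂_ne_zero ha hv hv0⟩

theorem W_Y₂_ne_bot {a b : ℂ} (ha : q₂ * b ≠ a) (hW : D.W a b ≠ ⊥) : D.W a (q₂ * b) ≠ ⊥ := by
  obtain ⟨v, hv, hv0⟩ := Submodule.exists_mem_ne_zero_of_ne_bot hW
  exact (Submodule.ne_bot_iff _).2 ⟨_, D.Y₂_mem hv rfl, D.Y₂_ne_zero ha hv hv0⟩

/-! ### Cycles -/

theorem pow_X₁_mem (h : D.Good) {a b : ℂ} {n : ℕ} (hn : q₁ ^ n = 1) :
    ∀ v ∈ D.W a b, (D.X₁ ^ n) v ∈ D.W a b := by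
  intro v hv
  have := (h.ladder₁ a b).pow_X_mem (by simpa using hv) n
  simpa [zpow_neg, hn] using this

theorem pow_X₂_mem (h : D.Good) {a b : ℂ} {n : ℕ} (hn : q₂ ^ n = 1) :
    ∀ v ∈ D.W a b, (D.X₂ ^ n) v ∈ D.W a b := by
  intro v hv
  have := (h.ladder₂ a b).pow_X_mem (by simpa using hv) n
  simpa [zpow_neg, hn] using this

theorem pow_X₁_injOn (h : D.Good) {a b : ℂ} (ha : ∀ k : ℤ, a ≠ q₁ ^ k) (n : ℕ) :
    ∀ v ∈ D.W a b, (D.X₁ ^ n) v = 0 → v = 0 := by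
  intro v hv
  contrapose
  intro hv0
  have hc : ∀ k, stepScalar q₁ 1 a k ≠ 0 := fun k => by
    rw [ne_eq, stepScalar_eq_zero_iff D.q₁_ne D.q₁_ne', mul_one]
    exact ha k
  rw [← ladderOp_natCast D.X₁ D.Y₁ (stepScalar q₁ 1 a)]
  exact (h.ladder₁ a b).op_ne_zero (by simpa using hv) hv0 (fun k _ _ => hc k) (fun k _ _ => hc k)

theorem pow_X₂_injOn (h : D.Good) {a b : ℂ} (hb : ∀ k : ℤ, b ≠ q₂ ^ k * a) (n : ℕ) :
    ∀ v ∈ D.W a b, (D.X₂ ^ n) v = 0 → v = 0 := by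
  intro v hv
  contrapose
  intro hv0
  have hc : ∀ k, stepScalar q₂ a b k ≠ 0 := fun k => by
    rw [ne_eq, stepScalar_eq_zero_iff D.q₂_ne D.q₂_ne']
    exact hb k
  rw [← ladderOp_natCast D.X₂ D.Y₂ (stepScalar q₂ a b)]
  exact (h.ladder₂ a b).op_ne_zero (by simpa using hv) hv0 (fun k _ _ => hc k) (fun k _ _ => hc k)

theorem pow_X₁_pow_X₂ (m n : ℕ) (v : M) : (D.X₁ ^ m) ((D.X₂ ^ n) v) =
    (q₁ * l) ^ (m * n) • (D.X₂ ^ n) ((D.X₁ ^ m) v) := by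
  rw [pow_mul]
  exact apply_pow_comm (pow_apply_comm D.xx m) n v

theorem pow_X₁_P₁ (a : ℂ) (n : ℕ) {i : ℤ} (hi : 0 ≤ i) (v : M) :
    (D.X₁ ^ n) (D.P₁ a i v) = D.P₁ a i ((D.X₁ ^ n) v) := by
  obtain ⟨m, rfl⟩ := Int.eq_ofNat_of_zero_le hi
  rw [P₁, ladderOp_natCast, ← Module.End.mul_apply, ← Module.End.mul_apply,
    ← pow_add, ← pow_add, add_comm]

/-- A cycle without breaks. -/
theorem ladderShape_cycle {q γ' γ : ℂ} (hq : q ≠ 0) (hq' : q ≠ 1) (hγ : ∀ k : ℤ, γ ≠ q ^ k * γ')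
    {n : ℕ} (hn : 0 < n) (hqn : stepScalar q γ' γ (n - 1) = stepScalar q γ' γ (-1)) :
    LadderShape n (stepScalar q γ' γ) (Set.Ico 0 n) :=
  Or.inl ⟨hn, rfl, hqn, fun i _ _ => by
    rw [ne_eq, stepScalar_eq_zero_iff hq hq']
    exact hγ i⟩

theorem mem_Ico_inj {n i j : ℤ} (hi : i ∈ Set.Ico 0 n) (hj : j ∈ Set.Ico 0 n) (h : n ∣ i - j) :
    i = j :=
  Int.eq_of_sub_eq_zero (Int.eq_zero_of_abs_lt_dvd h (by
    simp only [Set.mem_Ico] at hi hj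
    rw [abs_lt]
    omega))

theorem famGenCyc_of_weight (h : D.Good) {a b : ℂ} (ha : a ≠ 0) (hb : b ≠ 0) (hW : D.W a b ≠ ⊥)
    (ho₁ : 0 < orderOf q₁) (ho₂ : 0 < orderOf q₂) (ha' : ∀ k : ℤ, a ≠ q₁ ^ k)
    (hb' : ∀ k : ℤ, b ≠ q₂ ^ k * a) : FamGenCyc q₁ q₂ l D.action := by
  have hq₁ := pow_orderOf_eq_one q₁
  have hq₂ := pow_orderOf_eq_one q₂
  have := h.fin a b
  obtain ⟨hr, ρ, μ, hρ0, hμ0, v, hv, hv0, hρ, hμ⟩ := exists_clock_shift hW (D.X₁ ^ orderOf q₁)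
    (D.X₂ ^ orderOf q₂) (l ^ (orderOf q₁ * orderOf q₂)) (pow_X₁_mem h hq₁) (pow_X₂_mem h hq₂)
    (pow_X₁_injOn h ha' _) (pow_X₂_injOn h hb' _) (fun v _ => by
      rw [pow_X₁_pow_X₂, mul_pow, pow_mul q₁, hq₁, one_pow, one_mul])
  generalize ho₁' : orderOf q₁ = o₁ at *
  generalize ho₂' : orderOf q₂ = o₂ at *
  generalize hr' : orderOf (l ^ (o₁ * o₂)) = r at *
  rw [← pow_mul] at hμ
  have hN : 0 < o₂ * r := Nat.mul_pos ho₂ hr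
  have hS₁ : LadderShape o₁ (stepScalar q₁ 1 a) (Set.Ico 0 o₁) :=
    ladderShape_cycle D.q₁_ne D.q₁_ne' (by simpa using ha') ho₁
      (stepScalar_cycle D.q₁_ne (by exact_mod_cast hq₁))
  have hS₂ : LadderShape (o₂ * r) (stepScalar q₂ a b) (Set.Ico 0 (o₂ * r : ℕ)) :=
    ladderShape_cycle D.q₂_ne D.q₂_ne' hb' hN
      (stepScalar_cycle D.q₂_ne (by rw [zpow_natCast, pow_mul, hq₂, one_pow]))
  have hτ0 : ∀ j : ℤ, l ^ ((o₁ : ℤ) * j) * ρ ≠ 0 := fun j =>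
    mul_ne_zero (zpow_ne_zero _ D.l_ne) hρ0
  have hτ : ∀ j : ℤ, (D.X₁ ^ o₁) (D.P₂ a b j v) = (l ^ ((o₁ : ℤ) * j) * ρ) • D.P₂ a b j v :=
    fun j => by rw [pow_X₁_P₂ D a b hq₁, hρ, map_smul, smul_smul]
  have hL₂ : v ∈ D.W a (q₂ ^ (-(0 : ℤ)) * b) := by simpa using hv
  have hL₁ : ∀ j, D.P₂ a b j v ∈ D.W (q₁ ^ (-(0 : ℤ)) * a) (q₁ ^ (-(0 : ℤ)) * (q₂ ^ (-j) * b)) :=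
    fun j => by simpa using P₂_mem h hv j
  -- `(j, k) ↦ j + o₂ k` identifies the last two indices with a cycle of length `o₂ r`
  have hidx : ∀ j ∈ Set.Ico (0 : ℤ) o₂, ∀ k ∈ Set.Ico (0 : ℤ) r,
      j + o₂ * k ∈ Set.Ico (0 : ℤ) (o₂ * r : ℕ) := by
    intro j hj k hk
    simp only [Set.mem_Ico, Nat.cast_mul] at hj hk ⊢
    constructor <;> nlinarith
  have hq₂k : ∀ j k : ℤ, q₂ ^ (-(j + o₂ * k)) = q₂ ^ (-j) := fun j k => by
    rw [zpow_eq_zpow_iff_orderOf_dvd D.q₂_ne, ho₂']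
    exact ⟨-k, by ring⟩
  have hγ₁ : a = 1 + (q₁ - 1) * ((a - 1) / (q₁ - 1)) := by
    rw [mul_div_cancel₀ _ (sub_ne_zero.2 D.q₁_ne')]
    ring
  have hγ₂ : b = a + (q₂ - 1) * ((b - a) / (q₂ - 1)) := by
    rw [mul_div_cancel₀ _ (sub_ne_zero.2 D.q₂_ne')]
    ring
  refine ⟨by omega, by omega, by rw [ho₁', ho₂', hr']; exact hr, (a - 1) / (q₁ - 1),
    (b - a) / (q₂ - 1), a, b, ρ, μ, fun s => D.P₁ a s.1 (D.P₂ a b (s.2.1 + o₂ * s.2.2) v), hγ₁, hγ₂,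
    ha, hb, ha', hb', hρ0, hμ0, o₁, o₂, r, by rw [ho₁'], by rw [ho₂'], by rw [ho₁', ho₂', hr'],
    ⟨?_, ?_⟩, ?_⟩
  · refine linearIndepOn_of_weight (D := D) (θ := fun s => l ^ ((o₁ : ℤ) * (s.2.1 + o₂ * s.2.2)) * ρ)
      (D.X₁ ^ o₁) (fun s _ => P₁_P₂_mem h hv s.1 _)
      (fun s hs => grid_ne_zero h hS₁ hS₂ hv hv0 hs.1 (hidx _ hs.2.1 _ hs.2.2))
      (fun s hs => by rw [pow_X₁_P₁ a o₁ hs.1.1, hτ, map_smul]) ?_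
    rintro ⟨i, j, k⟩ ⟨hi, hj, hk⟩ ⟨i', j', k'⟩ ⟨hi', hj', hk'⟩ h1 h2 h3
    have e1 : q₁ ^ (-i) = q₁ ^ (-i') := mul_right_cancel₀ ha h1
    simp only [e1] at h2 h3
    have e2 := mul_right_cancel₀ hb (mul_left_cancel₀ (zpow_ne_zero _ D.q₁_ne) h2)
    rw [hq₂k, hq₂k] at e2
    rw [zpow_neg, zpow_neg, inv_inj, zpow_eq_zpow_iff_orderOf_dvd D.q₁_ne, ho₁'] at e1
    rw [zpow_neg, zpow_neg, inv_inj, zpow_eq_zpow_iff_orderOf_dvd D.q₂_ne, ho₂'] at e2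
    obtain rfl := mem_Ico_inj hi hi' e1
    obtain rfl := mem_Ico_inj hj hj' e2
    have e3 := mul_right_cancel₀ hρ0 h3
    rw [mul_add, mul_add, zpow_add₀ D.l_ne, zpow_add₀ D.l_ne,
      mul_right_inj' (zpow_ne_zero _ D.l_ne), ← mul_assoc, ← mul_assoc, ← Nat.cast_mul,
      zpow_mul l _ k, zpow_mul l _ k', zpow_natCast l,
      zpow_eq_zpow_iff_orderOf_dvd (pow_ne_zero _ D.l_ne), hr'] at e3
    obtain rfl := mem_Ico_inj hk hk' e3
    rfl
  · rw [eq_top_iff, ← grid_span h hS₁ hS₂ hv hv0 hμ0 (fun _ _ => hμ) (fun j _ => hτ0 j)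
      (fun j _ _ _ => hτ j)]
    refine Submodule.span_mono ?_
    rintro _ ⟨⟨i, m⟩, ⟨hi, hm⟩, rfl⟩
    have ho₂z : (0 : ℤ) < o₂ := by exact_mod_cast ho₂
    simp only [Set.mem_Ico, Nat.cast_mul] at hm
    refine ⟨(i, m % o₂, m / o₂), ⟨hi, ⟨Int.emod_nonneg _ ho₂z.ne', Int.emod_lt_of_pos _ ho₂z⟩,
      ⟨Int.ediv_nonneg hm.1 ho₂z.le, Int.ediv_lt_of_lt_mul ho₂z (by linarith [hm.2])⟩⟩, ?_⟩
    simp only [Int.emod_add_mul_ediv]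
  · intro i hi j hj k hk
    have hm := hidx j hj k hk
    have hw := P₁_P₂_mem h hv i (j + o₂ * k)
    refine ⟨?_, ?_, ?_, ?_⟩
    · change D.X₁ (D.P₁ a i (D.P₂ a b (j + o₂ * k) v)) = _
      split_ifs with hi'
      · exact hS₁.X_op (h.ladder₁ a _) (hL₁ _) hi ⟨by linarith [hi.1], by omega⟩
      · rw [P₁, (h.ladder₁ a _).X_op (hL₁ _) (Or.inl hi.1),
          show i + 1 = (o₁ : ℤ) by have := hi.2; omega, ladderOp_natCast, hτ, add_comm _ j]
        simp [P₁]
    · change D.X₂ (D.P₁ a i (D.P₂ a b (j + o₂ * k) v)) = _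
      rw [X₂_P₁]
      congr 1
      rw [P₂, (h.ladder₂ a b).X_op hL₂ (Or.inl hm.1)]
      split_ifs with hj' hk'
      · rw [add_right_comm]
        rfl
      · rw [show j + o₂ * k + 1 = 0 + o₂ * (k + 1) by have := hj.2; rw [mul_add]; omega]
        rfl
      · have e1 : j + 1 = o₂ := by have := hj.2; omega
        have e2 : k + 1 = r := by have := hk.2; omega
        have e3 : j + o₂ * k + 1 = ((o₂ * r : ℕ) : ℤ) := by
          rw [Nat.cast_mul, ← e2, mul_add]
          omega
        rw [e3, ladderOp_natCast, hμ, map_smul]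
        simp [P₂]
    · change D.Y₁ (D.X₁ (D.P₁ a i (D.P₂ a b (j + o₂ * k) v))) = _
      rw [D.YX₁ hw, ← mul_one (qint q₁ i), ← stepScalar_eq D.q₁_ne D.q₁_ne']
      rfl
    · change D.Y₂ (D.X₂ (D.P₁ a i (D.P₂ a b (j + o₂ * k) v))) = _
      rw [D.YX₂ hw, ← hγ₁, mul_assoc, ← stepScalar_eq D.q₂_ne D.q₂_ne', hq₂k, stepScalar,
        ← mul_sub, mul_div_assoc]

theorem fam_of_generic_weight (h : D.Good) {a b : ℂ} (ha : a ≠ 0) (hb : b ≠ 0)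
    (hW : D.W a b ≠ ⊥) : FamGenCyc q₁ q₂ l D.action ∨ FamGen q₁ q₂ l D.action := by
  obtain ⟨a, I₁, hI₁, ha, b, hb, hW⟩ := exists_shape (q := q₁) (γ' := 1) (γ := a)
    (Q := fun a => a ≠ 0 ∧ ∃ b, b ≠ 0 ∧ D.W a b ≠ ⊥) D.q₁_ne
    (fun a ⟨ha, b, hb, hW⟩ h1 => ⟨mul_ne_zero (inv_ne_zero D.q₁_ne) ha, _,
      mul_ne_zero (inv_ne_zero D.q₁_ne) hb, W_X₁_ne_bot h1 hW⟩)
    (fun a ⟨ha, b, hb, hW⟩ h1 => ⟨mul_ne_zero D.q₁_ne ha, _,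
      mul_ne_zero D.q₁_ne hb, W_Y₁_ne_bot h1 hW⟩) ⟨ha, b, hb, hW⟩
  obtain ⟨b, I₂, hI₂, hb, hW⟩ := exists_shape (q := q₂) (γ' := a) (γ := b)
    (Q := fun b => b ≠ 0 ∧ D.W a b ≠ ⊥) D.q₂_ne
    (fun b ⟨hb, hW⟩ h1 => ⟨mul_ne_zero (inv_ne_zero D.q₂_ne) hb, W_X₂_ne_bot h1 hW⟩)
    (fun b ⟨hb, hW⟩ h1 => ⟨mul_ne_zero D.q₂_ne hb, W_Y₂_ne_bot h1 hW⟩) ⟨hb, hW⟩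
  have hfin := h.fin a b
  by_cases hexc : 0 < orderOf q₁ ∧ 0 < orderOf q₂ ∧
      (∀ k : ℤ, a ≠ q₁ ^ k) ∧ (∀ k : ℤ, b ≠ q₂ ^ k * a)
  · exact Or.inl (famGenCyc_of_weight h ha hb hW hexc.1 hexc.2.1 hexc.2.2.1 hexc.2.2.2)
  refine Or.inr ?_
  -- a cycle has a break at its end unless it has no break at all
  have hbr₁ : 0 < orderOf q₁ → stepScalar q₁ 1 a (-1) ≠ 0 → ∀ k : ℤ, a ≠ q₁ ^ k := by
    intro ho hc
    rw [ne_eq, stepScalar_eq_zero_iff D.q₁_ne D.q₁_ne'] at hc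
    rcases hI₁ with ⟨-, -, h1 | h1⟩ | ⟨h1, -⟩ | ⟨h1, -⟩ | ⟨h1, -⟩
    · exact absurd (by rw [h1, zpow_neg_one]) hc
    · simpa using h1
    all_goals omega
  have hbr₂ : 0 < orderOf q₂ → stepScalar q₂ a b (-1) ≠ 0 → ∀ k : ℤ, b ≠ q₂ ^ k * a := by
    intro ho hc
    rw [ne_eq, stepScalar_eq_zero_iff D.q₂_ne D.q₂_ne'] at hc
    rcases hI₂ with ⟨-, -, h1 | h1⟩ | ⟨h1, -⟩ | ⟨h1, -⟩ | ⟨h1, -⟩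
    · exact absurd (by rw [h1, zpow_neg_one]) hc
    · exact h1
    all_goals omega
  by_cases h1 : 0 < orderOf q₁ ∧ ∀ k : ℤ, a ≠ q₁ ^ k
  · obtain ⟨ρ, v, hv, hv0, hρ⟩ := exists_eigenvector hW (D.X₁ ^ orderOf q₁)
      (pow_X₁_mem h (pow_orderOf_eq_one q₁))
    refine famGen_of_shape h ha hb hI₁ hI₂ hexc hv hv0 (ρ := ρ) ?_ one_ne_zero
      (fun _ _ => hρ) (fun ho hc => absurd ⟨h1.1, ho, h1.2, hbr₂ ho hc⟩ hexc)
    rintro rfl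
    exact hv0 (pow_X₁_injOn h h1.2 _ v hv (by rw [hρ, zero_smul]))
  by_cases h2 : 0 < orderOf q₂ ∧ ∀ k : ℤ, b ≠ q₂ ^ k * a
  · obtain ⟨μ, v, hv, hv0, hμ⟩ := exists_eigenvector hW (D.X₂ ^ orderOf q₂)
      (pow_X₂_mem h (pow_orderOf_eq_one q₂))
    refine famGen_of_shape h ha hb hI₁ hI₂ hexc hv hv0 (μ := μ) one_ne_zero ?_
      (fun ho hc => absurd ⟨ho, hbr₁ ho hc⟩ h1) (fun _ _ => hμ)
    rintro rfl
    exact hv0 (pow_X₂_injOn h h2.2 _ v hv (by rw [hμ, zero_smul]))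
  obtain ⟨v, hv, hv0⟩ := Submodule.exists_mem_ne_zero_of_ne_bot hW
  exact famGen_of_shape h ha hb hI₁ hI₂ hexc hv hv0 one_ne_zero one_ne_zero
    (fun ho hc => absurd ⟨ho, hbr₁ ho hc⟩ h1) (fun ho hc => absurd ⟨ho, hbr₂ ho hc⟩ h2)


variable {q₁ q₂ l : ℂ} {M : Type*} [AddCommGroup M] [Module ℂ M] {D : Rep q₁ q₂ l M}

/-! ### Weights with `g₁ = g₂ = 0` -/

theorem famN0_of_weight (h : D.Good) (hW : D.W 0 0 ≠ ⊥) : FamN0 q₁ D.action := by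
  have := h.fin 0 0
  have hq := sub_ne_zero.2 D.q₁_ne'.symm
  obtain ⟨ρ, v, hv, hv0, hρ⟩ := exists_eigenvector hW D.X₁
    (fun v hv => D.X₁_mem hv (mul_zero _) (mul_zero _))
  have hρ0 : ρ ≠ 0 := by
    rintro rfl
    exact D.X₁_ne_zero zero_ne_one hv hv0 (by rw [hρ, zero_smul])
  have hX₂ : D.X₂ v = 0 := h.X₂_zero 0 v hv
  have hY₂ : D.Y₂ v = 0 := h.Y₂_zero 0 0 (mul_zero _) v hv
  have hY₁ : D.Y₁ v = (ρ⁻¹ * (1 - q₁)⁻¹) • v := by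
    have h1 := D.YX₁ hv
    rw [hρ, map_smul] at h1
    rw [← inv_smul_smul₀ hρ0 (D.Y₁ v), h1, smul_smul]
    congr 2
    rw [zero_sub, ← neg_sub, neg_div_neg_eq, one_div]
  have hspan : ∀ c : ℂ, c • v ∈ Submodule.span ℂ {v} := fun c =>
    Submodule.smul_mem _ _ (Submodule.mem_span_singleton_self v)
  refine ⟨ρ, v, hρ0, hv0, h.simple _ ?_ ?_, hρ, hX₂, hY₁, hY₂⟩
  · rw [ne_eq, Submodule.span_singleton_eq_bot]
    exact hv0
  · intro u hu
    obtain ⟨c, rfl⟩ := Submodule.mem_span_singleton.1 hu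
    simp only [map_smul, hρ, hX₂, hY₁, hY₂, smul_zero]
    exact ⟨Submodule.smul_mem _ _ (hspan _), Submodule.zero_mem _,
      Submodule.smul_mem _ _ (hspan _), Submodule.zero_mem _⟩

/-! ### Weights with `g₁ ≠ 0` and `g₂ = 0` -/

theorem Y₂_of_X₂_eigenvector {a : ℂ} {v : M} (hv : v ∈ D.W a 0) {ρ : ℂ} (hρ0 : ρ ≠ 0)
    (hρ : D.X₂ v = ρ • v) : D.Y₂ v = (a * (1 - q₂)⁻¹ * ρ⁻¹) • v := by
  have h1 := D.YX₂ hv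
  rw [hρ, map_smul] at h1
  rw [← inv_smul_smul₀ hρ0 (D.Y₂ v), h1, smul_smul]
  congr 1
  rw [zero_sub, ← neg_sub, neg_div_neg_eq, div_eq_mul_inv]
  ring

theorem exists_X₂_eigenvector (h : D.Good) {a : ℂ} (ha : a ≠ 0) (hW : D.W a 0 ≠ ⊥) :
    ∃ ρ : ℂ, ρ ≠ 0 ∧ ∃ v ∈ D.W a 0, v ≠ 0 ∧ D.X₂ v = ρ • v := by
  have := h.fin a 0
  obtain ⟨ρ, v, hv, hv0, hρ⟩ := exists_eigenvector hW D.X₂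
    (fun v hv => D.X₂_mem hv (mul_zero _))
  refine ⟨ρ, ?_, v, hv, hv0, hρ⟩
  rintro rfl
  exact D.X₂_ne_zero ha.symm hv hv0 (by rw [hρ, zero_smul])

theorem ladderShape_point {a : ℂ} (ha : a ≠ 0) (hq₂ : q₂ ≠ 0) (hq₂' : q₂ ≠ 1) {n : ℕ}
    (hn : 0 < n) : LadderShape n (stepScalar q₂ a 0) (Set.Ico 0 n) :=
  ladderShape_cycle hq₂ hq₂' (fun k => (mul_ne_zero (zpow_ne_zero k hq₂) ha).symm) hn
    (by simp [stepScalar])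

/-- A string of one-dimensional weight spaces on which `X₂` acts diagonally. -/
theorem isBasisOn_string (h : D.Good) {a : ℂ} (ha : a ≠ 0) {o : ℕ} {I : Set ℤ}
    (hI : LadderShape o (stepScalar q₁ 1 a) I) (hend : 0 < o → stepScalar q₁ 1 a (-1) = 0)
    (hinj : ∀ i ∈ I, ∀ j ∈ I, q₁ ^ i = q₁ ^ j → i = j) {v : M} (hv : v ∈ D.W a 0) (hv0 : v ≠ 0)
    {ρ : ℂ} (hρ0 : ρ ≠ 0) (hρ : D.X₂ v = ρ • v) : IsBasisOn I (fun i => D.P₁ a i v) := by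
  have hS₂ := ladderShape_point ha D.q₂_ne D.q₂_ne' one_pos
  have h0 : (0 : ℤ) ∈ Set.Ico (0 : ℤ) (1 : ℕ) := by simp
  have hP : ∀ i, D.P₁ a i (D.P₂ a 0 0 v) = D.P₁ a i v := fun i => by simp [P₂]
  refine ⟨?_, ?_⟩
  · refine linearIndepOn_of_weight (D := D) (θ := 1) 1 (fun i _ => P₁_mem h hv i)
      (fun i hi => hP i ▸ grid_ne_zero h hI hS₂ hv hv0 hi h0) (fun s _ => by simp) ?_
    intro i hi j hj h1 _ _
    have := mul_right_cancel₀ ha h1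
    rw [zpow_neg, zpow_neg, inv_inj] at this
    exact hinj i hi j hj this
  · rw [eq_top_iff, ← grid_span h hI hS₂ hv hv0 hρ0 (fun _ _ => by simpa using hρ)
      (τ := 1) (fun _ _ => one_ne_zero) (fun _ _ h0 h1 => absurd (hend h0) h1)]
    refine Submodule.span_mono ?_
    rintro _ ⟨⟨i, j⟩, ⟨hi, hj⟩, rfl⟩
    obtain rfl : j = 0 := by
      simp only [Set.mem_Ico] at hj
      omega
    exact ⟨i, hi, (hP i).symm⟩

theorem famN1Inf_of_weight (h : D.Good) {a : ℂ} (ha : a ≠ 0) (hW : D.W a 0 ≠ ⊥)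
    (ho : orderOf q₁ = 0) (ha' : ∀ k : ℤ, a ≠ q₁ ^ k) : FamN1Inf q₁ q₂ l D.action := by
  obtain ⟨ρ, hρ0, v, hv, hv0, hρ⟩ := exists_X₂_eigenvector h ha hW
  have hSh : Shape q₁ 1 a Set.univ := Or.inr (Or.inl ⟨ho, rfl, by simpa using ha'⟩)
  have hI := hSh.ladderShape D.q₁_ne D.q₁_ne' one_ne_zero
  have hL : v ∈ D.W (q₁ ^ (-(0 : ℤ)) * a) (q₁ ^ (-(0 : ℤ)) * 0) := by simpa using hv
  refine ⟨ho, a, ρ, fun j => D.P₁ a j v, ha, ha', hρ0,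
    isBasisOn_string h ha hI (by omega) (fun i hi j hj => hSh.zpow_inj D.q₁_ne hi hj) hv hv0 hρ0 hρ,
    fun j => ⟨?_, ?_, ?_, ?_⟩⟩
  · exact hI.X_op (h.ladder₁ a 0) hL trivial trivial
  · change D.X₂ (D.P₁ a j v) = _
    rw [X₂_P₁, hρ, map_smul, smul_smul, mul_zpow]
  · change D.Y₁ (D.P₁ a j v) = _
    refine (hI.Y_op (h.ladder₁ a 0) hL trivial trivial).trans
      (congrArg (· • D.P₁ a (j - 1) v) ?_)
    rw [stepScalar, ← neg_div_neg_eq]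
    congr 1
    · rw [show -(j - 1) = -j + 1 by ring]
      ring
    · ring
  · change D.Y₂ (D.P₁ a j v) = _
    rw [Y₂_P₁, Y₂_of_X₂_eigenvector hv hρ0 hρ, map_smul, smul_smul]
    congr 1
    ring

theorem famN1Low_of_weight (h : D.Good) (hW : D.W q₁⁻¹ 0 ≠ ⊥) (ho : orderOf q₁ = 0) :
    FamN1Low q₁ q₂ l D.action := by
  have ha : q₁⁻¹ ≠ 0 := inv_ne_zero D.q₁_ne
  obtain ⟨ρ, hρ0, v, hv, hv0, hρ⟩ := exists_X₂_eigenvector h ha hW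
  have hSh : Shape q₁ 1 q₁⁻¹ (Set.Ici 0) := Or.inr (Or.inr (Or.inl ⟨ho, rfl, by rw [mul_one]⟩))
  have hI := hSh.ladderShape D.q₁_ne D.q₁_ne' one_ne_zero
  have hL : v ∈ D.W (q₁ ^ (-(0 : ℤ)) * q₁⁻¹) (q₁ ^ (-(0 : ℤ)) * 0) := by simpa using hv
  refine ⟨ho, ρ, fun j => D.P₁ q₁⁻¹ j v, hρ0,
    isBasisOn_string h ha hI (by omega) (fun i hi j hj => hSh.zpow_inj D.q₁_ne hi hj) hv hv0 hρ0 hρ,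
    fun j hj => ⟨?_, ?_, ?_, ?_⟩⟩
  · exact hI.X_op (h.ladder₁ _ 0) hL hj (by simp only [Set.mem_Ici] at hj ⊢; omega)
  · change D.Y₁ (D.P₁ q₁⁻¹ j v) = _
    split_ifs with hj0
    · exact (hI.Y_op_end (h.ladder₁ _ 0) hL one_ne_zero (by omega) hj (by simp [hj0])).2
        (by omega)
    · refine (hI.Y_op (h.ladder₁ _ 0) hL hj (by simp only [Set.mem_Ici] at hj ⊢; omega)).trans
        (congrArg (· • D.P₁ q₁⁻¹ (j - 1) v) ?_)
      rw [stepScalar, qint, ← zpow_sub_one₀ D.q₁_ne, show -(j - 1) - 1 = -j by ring]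
  · change D.X₂ (D.P₁ q₁⁻¹ j v) = _
    rw [X₂_P₁, hρ, map_smul, smul_smul]
  · change D.Y₂ (D.P₁ q₁⁻¹ j v) = _
    rw [Y₂_P₁, Y₂_of_X₂_eigenvector hv hρ0 hρ, map_smul, smul_smul]
    congr 1
    ring

theorem stepScalar_reverse (q : ℂ) (i : ℤ) : stepScalar q 1 1 (-i - 1) = qint q (i + 1) := by
  rw [stepScalar, qint, mul_one, show -(-i - 1) = i + 1 by ring]

theorem qint_ne_zero {q : ℂ} (hq : q ≠ 0) (hq' : q ≠ 1) {k : ℤ} (hk : ¬ (orderOf q : ℤ) ∣ k) :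
    qint q k ≠ 0 :=
  div_ne_zero (sub_ne_zero.2 fun h => hk ((zpow_eq_one_iff_orderOf_dvd hq).1 h))
    (sub_ne_zero.2 hq')

/-- The string of weights `g₁ = q₁ ^ j`, `j ≥ 0`, generated by `Y₁` from a vector killed by `X₁`;
the ladder is read downwards. -/
theorem isBasisOn_highest (h : D.Good) {I : Set ℤ} {v : M}
    (hI : LadderShape (orderOf q₁) (fun i => stepScalar q₁ 1 1 (-i - 1)) I)
    (hinj : ∀ i ∈ I, ∀ j ∈ I, q₁ ^ i = q₁ ^ j → i = j) (hv : v ∈ D.W 1 0)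
    (hv0 : v ≠ 0) {ρ : ℂ} (hρ0 : ρ ≠ 0) (hρ : D.X₂ v = ρ • v) {w : ℤ → M}
    (hw : w = fun i => ladderOp D.Y₁ D.X₁ (fun i => stepScalar q₁ 1 1 (-i - 1)) i v) :
    IsBasisOn I w ∧ ∀ j ∈ I,
      D.X₁ (w j) = (if j = 0 then 0 else qint q₁ j • w (j - 1)) ∧
      ((j + 1 ∈ I → D.Y₁ (w j) = w (j + 1)) ∧ (j + 1 ∉ I → D.Y₁ (w j) = 0)) ∧
      D.X₂ (w j) = (ρ * l ^ j * q₁ ^ j) • w j ∧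
      D.Y₂ (w j) = ((1 - q₂)⁻¹ * ρ⁻¹ * (l⁻¹) ^ j) • w j := by
  subst hw
  have hlad := (h.ladder₁ 1 0).reverse
  have hL : v ∈ D.W (q₁ ^ (-(-(0 : ℤ))) * 1) (q₁ ^ (-(-(0 : ℤ))) * 0) := by simpa using hv
  have hend : stepScalar q₁ 1 1 (-(-1) - 1) = 0 := by simp [stepScalar]
  have hτ : 0 < orderOf q₁ → stepScalar q₁ 1 1 (-(-1) - 1) ≠ 0 →
      (D.Y₁ ^ orderOf q₁) v = (1 : ℂ) • v := fun _ h1 => absurd hend h1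
  have hX₂ : ∀ j, D.X₂ (ladderOp D.Y₁ D.X₁ (fun i => stepScalar q₁ 1 1 (-i - 1)) j v) =
      (ρ * l ^ j * q₁ ^ j) • ladderOp D.Y₁ D.X₁ (fun i => stepScalar q₁ 1 1 (-i - 1)) j v := by
    intro j
    rw [apply_ladderOp _ D.yx D.xx', hρ, map_smul, smul_smul, mul_zpow]
    congr 1
    ring
  have hY₂ : ∀ j, D.Y₂ (ladderOp D.Y₁ D.X₁ (fun i => stepScalar q₁ 1 1 (-i - 1)) j v) =
      ((1 - q₂)⁻¹ * ρ⁻¹ * (l⁻¹) ^ j) •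
        ladderOp D.Y₁ D.X₁ (fun i => stepScalar q₁ 1 1 (-i - 1)) j v := by
    intro j
    rw [apply_ladderOp _ D.yy' (fun v => by rw [inv_inv]; exact D.xy' v),
      Y₂_of_X₂_eigenvector hv hρ0 hρ, map_smul, smul_smul]
    congr 1
    ring
  refine ⟨⟨?_, ?_⟩, fun j hj => ⟨?_, ?_, hX₂ j, hY₂ j⟩⟩
  · refine linearIndepOn_of_weight (D := D) (θ := 1) 1 (fun i _ => hlad.op_mem hL i)
      (fun i hi => hI.op_ne_zero hlad hL hv0 hi) (fun s _ => by simp) ?_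
    intro i hi j hj h1 _ _
    simp only [neg_neg] at h1
    exact hinj i hi j hj (mul_right_cancel₀ one_ne_zero h1)
  · exact h.span_eq_top hI.zero_mem (hI.op_ne_zero hlad hL hv0 hI.zero_mem)
      (fun i hi => hI.Y_op_mem_span hlad hL one_ne_zero hτ hi)
      (fun i hi => by
        rw [hX₂]
        exact Submodule.smul_mem _ _ (Submodule.subset_span ⟨i, hi, rfl⟩))
      (fun i hi => hI.X_op_mem_span hlad hL hτ hi)
      (fun i hi => by
        rw [hY₂]
        exact Submodule.smul_mem _ _ (Submodule.subset_span ⟨i, hi, rfl⟩))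
  · have hzero : stepScalar q₁ 1 1 (-(j - 1) - 1) = 0 →
        D.X₁ (ladderOp D.Y₁ D.X₁ (fun i => stepScalar q₁ 1 1 (-i - 1)) j v) = 0 := by
      intro hc
      have h1 := hlad.Y_zero (j - 1) hc _ (by rw [sub_add_cancel]; exact hlad.op_mem hL j)
      exact h1
    split_ifs with hj0
    · exact hzero (by subst hj0; simp [stepScalar])
    · by_cases hj' : j - 1 ∈ I
      · have h1 := hI.Y_op hlad hL hj hj'
        rwa [stepScalar_reverse, sub_add_cancel] at h1
      · exfalso
        rcases hI with ⟨-, rfl, -⟩ | ⟨-, rfl, -⟩ | ⟨-, rfl, -⟩ | ⟨-, rfl, -⟩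
        · simp only [Set.mem_Ico] at hj hj'
          omega
        · exact hj' trivial
        · simp only [Set.mem_Ici] at hj hj'
          omega
        · simp only [Set.mem_Iic] at hj hj'
          omega
  · have hm := hI.X_op_end hlad hL hτ hj
    refine ⟨fun hj' => hI.X_op hlad hL hj hj', fun hj' => ?_⟩
    · by_cases hc : stepScalar q₁ 1 1 (-j - 1) = 0
      · exact hlad.X_zero j hc _ (hlad.op_mem hL j)
      · refine (hm hj').2 fun h1 => ?_
        rcases hI with ⟨ho, rfl, h2, -⟩ | ⟨ho, -⟩ | ⟨ho, -⟩ | ⟨ho, -⟩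
        · simp only [Set.mem_Ico] at hj hj'
          obtain rfl : j = orderOf q₁ - 1 := by omega
          exact hc (h2.trans hend)
        all_goals omega

theorem famN1Fin_of_weight (h : D.Good) (hW : D.W 1 0 ≠ ⊥) (ho : 0 < orderOf q₁) :
    FamN1Fin q₁ q₂ l D.action := by
  obtain ⟨ρ, hρ0, v, hv, hv0, hρ⟩ := exists_X₂_eigenvector h one_ne_zero hW
  have hI : LadderShape (orderOf q₁) (fun i => stepScalar q₁ 1 1 (-i - 1))
      (Set.Ico 0 (orderOf q₁ : ℤ)) := by
    refine Or.inl ⟨ho, rfl, ?_, fun i hi hi' => ?_⟩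
    · change stepScalar q₁ 1 1 (-((orderOf q₁ : ℤ) - 1) - 1) = stepScalar q₁ 1 1 (-(-1) - 1)
      rw [stepScalar_reverse, stepScalar_reverse]
      simp [qint, pow_orderOf_eq_one]
    · change stepScalar q₁ 1 1 (-i - 1) ≠ 0
      rw [stepScalar_reverse]
      refine qint_ne_zero D.q₁_ne D.q₁_ne' fun hd => ?_
      have := Int.le_of_dvd (by omega) hd
      omega
  obtain ⟨hb, hf⟩ := isBasisOn_highest h hI (fun i hi j hj hij => mem_Ico_inj hi hj
    ((zpow_eq_zpow_iff_orderOf_dvd D.q₁_ne).1 hij)) hv hv0 hρ0 hρ rfl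
  refine ⟨ho, ρ, _, hρ0, hb, fun j hj => ?_⟩
  obtain ⟨h1, h2, h3⟩ := hf j hj
  refine ⟨h1, ?_, h3⟩
  simp only [Set.mem_Ico] at hj h2
  split_ifs with hj'
  · exact h2.1 (by omega)
  · exact h2.2 (by omega)

theorem famN1High_of_weight (h : D.Good) (hW : D.W 1 0 ≠ ⊥) (ho : orderOf q₁ = 0) :
    FamN1High q₁ q₂ l D.action := by
  obtain ⟨ρ, hρ0, v, hv, hv0, hρ⟩ := exists_X₂_eigenvector h one_ne_zero hW
  have hI : LadderShape (orderOf q₁) (fun i => stepScalar q₁ 1 1 (-i - 1)) (Set.Ici 0) := by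
    refine Or.inr (Or.inr (Or.inl ⟨ho, rfl, ?_, fun i hi => ?_⟩))
    · simp [stepScalar]
    · change stepScalar q₁ 1 1 (-i - 1) ≠ 0
      rw [stepScalar_reverse]
      refine qint_ne_zero D.q₁_ne D.q₁_ne' ?_
      rw [ho, Nat.cast_zero, zero_dvd_iff]
      omega
  obtain ⟨hb, hf⟩ := isBasisOn_highest h hI (fun i hi j hj hij => by
    rw [zpow_eq_zpow_iff_orderOf_dvd D.q₁_ne, ho, Nat.cast_zero, zero_dvd_iff] at hij
    omega) hv hv0 hρ0 hρ rfl
  refine ⟨ho, ρ, _, hρ0, hb, fun j hj => ?_⟩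
  obtain ⟨h1, h2, h3⟩ := hf j hj
  exact ⟨h1, h2.1 (by simp only [Set.mem_Ici] at hj ⊢; omega), h3⟩

theorem famN1Cyc_of_weight (h : D.Good) {a : ℂ} (ha : a ≠ 0) (hW : D.W a 0 ≠ ⊥)
    (ho : 0 < orderOf q₁) (ha' : ∀ k : ℤ, a ≠ q₁ ^ k) : FamN1Cyc q₁ q₂ l D.action := by
  have hq₁ := pow_orderOf_eq_one q₁
  have := h.fin a 0
  obtain ⟨hr, ρ, μ, hρ0, hμ0, v, hv, hv0, hρ, hμ⟩ := exists_clock_shift hW (D.X₁ ^ orderOf q₁)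
    D.X₂ (l ^ orderOf q₁) (pow_X₁_mem h hq₁) (fun v hv => D.X₂_mem hv (mul_zero _))
    (pow_X₁_injOn h ha' _) (fun v hv h0 => by_contra fun hv0 => D.X₂_ne_zero ha.symm hv hv0 h0)
    (fun v _ => by
      have := pow_X₁_pow_X₂ (D := D) (orderOf q₁) 1 v
      rwa [pow_one, mul_one, mul_pow, hq₁, one_mul] at this)
  generalize ho' : orderOf q₁ = o at *
  generalize hr' : orderOf (l ^ o) = r at *
  have hS₁ : LadderShape o (stepScalar q₁ 1 a) (Set.Ico 0 o) :=
    ladderShape_cycle D.q₁_ne D.q₁_ne' (by simpa using ha') ho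
      (stepScalar_cycle D.q₁_ne (by exact_mod_cast hq₁))
  have hS₂ := ladderShape_point ha D.q₂_ne D.q₂_ne' hr
  have hτ0 : ∀ j : ℤ, l ^ ((o : ℤ) * j) * ρ ≠ 0 := fun j =>
    mul_ne_zero (zpow_ne_zero _ D.l_ne) hρ0
  have hτ : ∀ j : ℤ, (D.X₁ ^ o) (D.P₂ a 0 j v) = (l ^ ((o : ℤ) * j) * ρ) • D.P₂ a 0 j v :=
    fun j => by rw [pow_X₁_P₂ D a 0 hq₁, hρ, map_smul, smul_smul]
  have hL₂ : v ∈ D.W a (q₂ ^ (-(0 : ℤ)) * 0) := by simpa using hv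
  have hL₁ : ∀ j, D.P₂ a 0 j v ∈ D.W (q₁ ^ (-(0 : ℤ)) * a) (q₁ ^ (-(0 : ℤ)) * (q₂ ^ (-j) * 0)) :=
    fun j => by simpa using P₂_mem h hv j
  have hc₁ : ∀ i : ℤ, stepScalar q₁ 1 a (i - 1) = (1 - a * q₁ ^ (1 - i)) * (1 - q₁)⁻¹ := fun i => by
    rw [stepScalar, ← neg_div_neg_eq, neg_sub, neg_sub, neg_sub, mul_comm a, div_eq_mul_inv]
  have hc₂ : ∀ j : ℤ, stepScalar q₂ a 0 j = a * (1 - q₂)⁻¹ := fun j => by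
    rw [stepScalar, ← neg_div_neg_eq, neg_sub, neg_sub, mul_zero, sub_zero, div_eq_mul_inv]
  have hc₁0 : ∀ i : ℤ, stepScalar q₁ 1 a i ≠ 0 := fun i => by
    rw [ne_eq, stepScalar_eq_zero_iff D.q₁_ne D.q₁_ne', mul_one]
    exact ha' i
  have hc₂0 : ∀ j : ℤ, stepScalar q₂ a 0 j ≠ 0 := fun j => by
    rw [hc₂]
    exact mul_ne_zero ha (inv_ne_zero (sub_ne_zero.2 D.q₂_ne'.symm))
  refine ⟨by omega, by rw [ho', hr']; exact hr, a, ρ, μ, fun s => D.P₁ a s.1 (D.P₂ a 0 s.2 v),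
    ha, ha', hρ0, hμ0, o, r, by rw [ho'], by rw [ho', hr'], ⟨?_, ?_⟩, ?_⟩
  · refine linearIndepOn_of_weight (D := D) (θ := fun s => l ^ ((o : ℤ) * s.2) * ρ)
      (D.X₁ ^ o) (fun s _ => P₁_P₂_mem h hv s.1 _)
      (fun s hs => grid_ne_zero h hS₁ hS₂ hv hv0 hs.1 hs.2)
      (fun s hs => by rw [pow_X₁_P₁ a o hs.1.1, hτ, map_smul]) ?_
    rintro ⟨i, j⟩ ⟨hi, hj⟩ ⟨i', j'⟩ ⟨hi', hj'⟩ h1 - h3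
    have e1 : q₁ ^ (-i) = q₁ ^ (-i') := mul_right_cancel₀ ha h1
    rw [zpow_neg, zpow_neg, inv_inj, zpow_eq_zpow_iff_orderOf_dvd D.q₁_ne, ho'] at e1
    have e3 := mul_right_cancel₀ hρ0 h3
    simp only at e3
    rw [zpow_mul, zpow_mul, zpow_natCast,
      zpow_eq_zpow_iff_orderOf_dvd (pow_ne_zero _ D.l_ne), hr'] at e3
    exact Prod.ext (mem_Ico_inj hi hi' e1) (mem_Ico_inj hj hj' e3)
  · exact grid_span h hS₁ hS₂ hv hv0 hμ0 (fun _ _ => hμ) (fun j _ => hτ0 j)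
      (fun j _ _ _ => hτ j)
  · intro i hi j hj
    have hi1 : i < (o : ℤ) - 1 ↔ i + 1 ∈ Set.Ico 0 (o : ℤ) := by
      simp only [Set.mem_Ico] at hi ⊢
      omega
    have hj1 : j < (r : ℤ) - 1 ↔ j + 1 ∈ Set.Ico 0 (r : ℤ) := by
      simp only [Set.mem_Ico] at hj ⊢
      omega
    have hi2 : i = 0 ↔ ¬ i - 1 ∈ Set.Ico 0 (o : ℤ) := by
      simp only [Set.mem_Ico] at hi ⊢
      omega
    have hj2 : j = 0 ↔ ¬ j - 1 ∈ Set.Ico 0 (r : ℤ) := by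
      simp only [Set.mem_Ico] at hj ⊢
      omega
    refine ⟨?_, ?_, ?_, ?_⟩
    · change D.X₁ (D.P₁ a i (D.P₂ a 0 j v)) = _
      split_ifs with hi'
      · exact hS₁.X_op (h.ladder₁ a _) (hL₁ j) hi (hi1.1 hi')
      · exact (hS₁.X_op_end (h.ladder₁ a _) (hL₁ j) (fun _ _ => hτ j) hi (hi1.not.1 hi')).1
          ⟨ho, hc₁0 _⟩
    · change D.Y₁ (D.P₁ a i (D.P₂ a 0 j v)) = _
      split_ifs with hi'
      · have h1 := (hS₁.Y_op_end (h.ladder₁ a _) (hL₁ j) (hτ0 j) (fun _ _ => hτ j) hi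
          (hi2.1 hi')).1 ⟨ho, hc₁0 _⟩
        rw [P₁, h1, smul_smul, hc₁, hi', sub_zero, zpow_one, mul_inv, ← zpow_neg, ← mul_assoc]
        rfl
      · rw [← hc₁]
        exact hS₁.Y_op (h.ladder₁ a _) (hL₁ j) hi (not_not.1 (hi2.not.1 hi'))
    · change D.X₂ (D.P₁ a i (D.P₂ a 0 j v)) = _
      rw [X₂_P₁, mul_zpow, inv_zpow', P₂]
      split_ifs with hj'
      · rw [hS₂.X_op (h.ladder₂ a 0) hL₂ hj (hj1.1 hj')]
        rfl
      · rw [(hS₂.X_op_end (h.ladder₂ a 0) hL₂ (fun _ _ => hμ) hj (hj1.not.1 hj')).1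
          ⟨hr, hc₂0 _⟩, map_smul, smul_smul]
        rfl
    · change D.Y₂ (D.P₁ a i (D.P₂ a 0 j v)) = _
      rw [Y₂_P₁, P₂]
      split_ifs with hj'
      · rw [(hS₂.Y_op_end (h.ladder₂ a 0) hL₂ hμ0 (fun _ _ => hμ) hj (hj2.1 hj')).1
          ⟨hr, hc₂0 _⟩, map_smul, map_smul, smul_smul, smul_smul, hc₂]
        congr 1
        ring
      · rw [hS₂.Y_op (h.ladder₂ a 0) hL₂ hj (not_not.1 (hj2.not.1 hj')), map_smul, smul_smul, hc₂,
          ← mul_assoc]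
        rfl

theorem fam_of_weight_zero_right (h : D.Good) {a : ℂ} (ha : a ≠ 0) (hW : D.W a 0 ≠ ⊥) :
    FamN1Fin q₁ q₂ l D.action ∨ FamN1High q₁ q₂ l D.action ∨ FamN1Low q₁ q₂ l D.action ∨
    FamN1Cyc q₁ q₂ l D.action ∨ FamN1Inf q₁ q₂ l D.action := by
  have hdown : ∀ a, D.W a 0 ≠ ⊥ → a ≠ 1 → D.W (q₁⁻¹ * a) 0 ≠ ⊥ := fun a hW h1 => by
    simpa using W_X₁_ne_bot h1 hW
  have hup : ∀ a, D.W a 0 ≠ ⊥ → q₁ * a ≠ 1 → D.W (q₁ * a) 0 ≠ ⊥ := fun a hW h1 => by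
    simpa using W_Y₁_ne_bot h1 hW
  by_cases hk : ∃ k : ℤ, a = q₁ ^ k * 1
  · obtain ⟨k, rfl⟩ := hk
    rcases Nat.eq_zero_or_pos (orderOf q₁) with ho | ho
    · rcases lt_or_ge k 0 with h0 | h0
      · have := ascend_to_break (Q := fun a => D.W a 0 ≠ ⊥) D.q₁_ne hup (Or.inl h0) hW
        rw [mul_one] at this
        exact Or.inr (Or.inr (Or.inl (famN1Low_of_weight h this ho)))
      · exact Or.inr (Or.inl (famN1High_of_weight h
          (descend_to_break (Q := fun a => D.W a 0 ≠ ⊥) D.q₁_ne hdown (Or.inl h0) hW) ho))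
    · exact Or.inl (famN1Fin_of_weight h
        (descend_to_break (Q := fun a => D.W a 0 ≠ ⊥) D.q₁_ne hdown (Or.inr ho) hW) ho)
  · push Not at hk
    simp only [mul_one] at hk
    rcases Nat.eq_zero_or_pos (orderOf q₁) with ho | ho
    · exact Or.inr (Or.inr (Or.inr (Or.inr (famN1Inf_of_weight h ha hW ho hk))))
    · exact Or.inr (Or.inr (Or.inr (Or.inl (famN1Cyc_of_weight h ha hW ho hk))))

end Rep

/-! ### Two group elements that commute up to a central one -/

section Group

variable {G : Type*} [Group G] {u v z : G}

theorem zpow_mul_zpow_of_mul_eq (huv : u * v = z * v * u) (hu : Commute z u) (hv : Commute z v)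
    (i j : ℤ) : u ^ i * v ^ j = z ^ (i * j) * v ^ j * u ^ i := by
  have h1 : SemiconjBy u v (z * v) := huv
  have h2 := h1.zpow_right j
  rw [hv.mul_zpow] at h2
  have h3 : SemiconjBy (v ^ j) u (z ^ (-j) * u) := by
    change v ^ j * u = z ^ (-j) * u * v ^ j
    rw [mul_assoc, h2.eq, mul_assoc, ← mul_assoc, ← zpow_add, neg_add_cancel, zpow_zero, one_mul]
  have h4 := h3.zpow_right i
  rw [(hu.zpow_left _).mul_zpow, ← zpow_mul] at h4
  rw [mul_assoc, h4.eq, mul_assoc, ← mul_assoc, ← zpow_add, show i * j + -j * i = 0 by ring,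
    zpow_zero, one_mul]

theorem monomial_mul_monomial (huv : u * v = z * v * u) (hu : Commute z u) (hv : Commute z v)
    (i j k m : ℤ) :
    u ^ i * v ^ j * (u ^ k * v ^ m) = z ^ (-(j * k)) * (u ^ (i + k) * v ^ (j + m)) := by
  have h1 : v ^ j * u ^ k = z ^ (-(j * k)) * (u ^ k * v ^ j) := by
    rw [zpow_mul_zpow_of_mul_eq huv hu hv k j, ← mul_assoc, ← mul_assoc, ← zpow_add,
      show -(j * k) + k * j = 0 by ring, zpow_zero, one_mul]
  calc u ^ i * v ^ j * (u ^ k * v ^ m) = u ^ i * (v ^ j * u ^ k) * v ^ m := by group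
    _ = (u ^ i * z ^ (-(j * k))) * u ^ k * v ^ j * v ^ m := by
      rw [h1]
      group
    _ = z ^ (-(j * k)) * (u ^ (i + k) * v ^ (j + m)) := by
      rw [((hu.zpow_left _).zpow_right i).symm.eq, zpow_add, zpow_add]
      group

theorem eq_zpow_of_succ {f : ℤ → G} {x : G} (h0 : f 0 = 1) (hf : ∀ p, f (p + 1) = f p * x)
    (p : ℤ) : x ^ p = f p := by
  induction p using Int.induction_on with
  | zero => rw [zpow_zero, h0]
  | succ n ih => rw [zpow_add_one, ih, hf]
  | pred n ih =>
    have := hf (-n - 1)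
    rw [sub_add_cancel] at this
    rw [zpow_sub_one, ih, this, mul_inv_cancel_right]

theorem half_mul_sub_one_succ (p : ℤ) : (p + 1) * (p + 1 - 1) / 2 = p * (p - 1) / 2 + p := by
  rw [show (p + 1) * (p + 1 - 1) = p * (p - 1) + p * 2 by ring, Int.add_mul_ediv_right _ _ two_ne_zero]

theorem monomial_zpow (huv : u * v = z * v * u) (hu : Commute z u) (hv : Commute z v)
    (i j p : ℤ) :
    (u ^ i * v ^ j) ^ p = z ^ (-(i * j * (p * (p - 1) / 2))) * (u ^ (p * i) * v ^ (p * j)) := by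
  refine eq_zpow_of_succ
    (f := fun p => z ^ (-(i * j * (p * (p - 1) / 2))) * (u ^ (p * i) * v ^ (p * j)))
    (by simp) (fun p => ?_) p
  rw [mul_assoc (z ^ _) _ (u ^ i * v ^ j), monomial_mul_monomial huv hu hv,
    ← mul_assoc (z ^ _) (z ^ _), ← zpow_add, half_mul_sub_one_succ, add_one_mul, add_one_mul]
  congr 2
  ring

end Group

/-! ### Weights with `g₁ = 0` and `g₂ ≠ 0` -/

/-- The scalar operators as a central subgroup. -/
noncomputable def scalarUnit (M : Type*) [AddCommGroup M] [Module ℂ M] :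
    ℂˣ →* (Module.End ℂ M)ˣ :=
  Units.map (algebraMap ℂ (Module.End ℂ M) : ℂ →* Module.End ℂ M)

section Scalar

variable {M : Type*} [AddCommGroup M] [Module ℂ M]

theorem scalarUnit_smul (c : ℂˣ) (v : M) : scalarUnit M c • v = (c : ℂ) • v := rfl

theorem scalarUnit_commute (c : ℂˣ) (u : (Module.End ℂ M)ˣ) : Commute (scalarUnit M c) u :=
  Units.ext (Algebra.commutes (c : ℂ) (u : Module.End ℂ M))

theorem zpow_smul_of_eigen {u : (Module.End ℂ M)ˣ} {v : M} {ρ : ℂ} (hρ : ρ ≠ 0)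
    (h : u • v = ρ • v) (p : ℤ) : u ^ p • v = ρ ^ p • v := by
  induction p using Int.induction_on with
  | zero => simp
  | succ n ih => rw [zpow_add_one, mul_smul, h, smul_comm, ih, smul_smul, zpow_add_one₀ hρ, mul_comm]
  | pred n ih =>
    have h1 : u⁻¹ • v = ρ⁻¹ • v := by
      rw [inv_smul_eq_iff, smul_comm, h, smul_smul, inv_mul_cancel₀ hρ, one_smul]
    rw [zpow_sub_one, mul_smul, h1, smul_comm, ih, smul_smul, zpow_sub_one₀ hρ, mul_comm]

end Scalar

/-- For `g₁ = 0` the operators `X₁` and `X₂` are invertible and `Y₁`, `Y₂` are multiples of their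
inverses on weight vectors, so that the representation is one of a quantum torus. -/
structure Torus {q₁ q₂ l : ℂ} {M : Type*} [AddCommGroup M] [Module ℂ M] (D : Rep q₁ q₂ l M) where
  U₁ : (Module.End ℂ M)ˣ
  U₂ : (Module.End ℂ M)ˣ
  X₁_eq : ∀ v, D.X₁ v = U₁ • v
  X₂_eq : ∀ v, D.X₂ v = U₂ • v
  YX₁ : ∀ v, D.Y₁ (D.X₁ v) = (1 - q₁)⁻¹ • v

namespace Torus

variable {q₁ q₂ l : ℂ} {M : Type*} [AddCommGroup M] [Module ℂ M] {D : Rep q₁ q₂ l M}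

/-- By simplicity `Y₁ X₁` is scalar on all of `M`, and the kernel and the range of `X₂` are trivial,
since `X₂` commutes up to scalars with all generators. -/
theorem nonempty (h : D.Good) {b : ℂ} (hb : b ≠ 0) (hW : D.W 0 b ≠ ⊥) : Nonempty (Torus D) := by
  have hq := sub_ne_zero.2 D.q₁_ne'.symm
  obtain ⟨v₀, hv₀, hv₀0⟩ := Submodule.exists_mem_ne_zero_of_ne_bot hW
  have hYX : ∀ v, D.Y₁ (D.X₁ v) = (1 - q₁)⁻¹ • v := by
    have htop : Module.End.eigenspace (D.Y₁ * D.X₁) (1 - q₁)⁻¹ = ⊤ := by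
      refine h.simple _ ((Submodule.ne_bot_iff _).2 ⟨v₀, ?_, hv₀0⟩) fun v hv => ?_
      · rw [Module.End.mem_eigenspace_iff, Module.End.mul_apply, D.YX₁ hv₀]
        congr 1
        rw [zero_sub, ← neg_sub 1 q₁, neg_div_neg_eq, one_div]
      · simp only [Module.End.mem_eigenspace_iff, Module.End.mul_apply] at hv ⊢
        refine ⟨?_, ?_, ?_, ?_⟩
        · have h1 := D.one (D.X₁ v)
          rw [hv, map_smul] at h1
          have h2 : q₁ • D.Y₁ (D.X₁ (D.X₁ v)) = q₁ • (1 - q₁)⁻¹ • D.X₁ v := by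
            rw [eq_sub_of_add_eq h1.symm]
            match_scalars
            field_simp
            ring
          exact smul_right_injective M D.q₁_ne h2
        · rw [D.xx, map_smul, D.yx', hv, map_smul, smul_inv_smul₀ (mul_ne_zero D.q₁_ne D.l_ne)]
        · rw [D.one, hv, map_add, map_smul, map_smul]
          match_scalars
          field_simp
          ring
        · rw [D.xy, map_smul, D.yy, hv, map_smul, inv_smul_smul₀ D.l_ne]
    intro v
    have : v ∈ Module.End.eigenspace (D.Y₁ * D.X₁) (1 - q₁)⁻¹ := htop ▸ Submodule.mem_top
    exact Module.End.mem_eigenspace_iff.1 this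
  have hXY : ∀ v, D.X₁ (D.Y₁ v) = (1 - q₁)⁻¹ • v := fun v => by
    rw [D.one, hYX]
    match_scalars
    field_simp
    ring
  have hXY₂ : ∀ v, D.X₂ (D.Y₂ v) = q₂ • D.Y₂ (D.X₂ v) := fun v => by
    rw [D.two, hYX, add_assoc]
    convert add_zero _
    match_scalars
    field_simp
    ring
  have hX₂v : D.X₂ v₀ ≠ 0 := D.X₂_ne_zero hb hv₀ hv₀0
  have hker : LinearMap.ker D.X₂ = ⊥ := by
    by_contra hne
    have htop := h.simple _ hne fun v hv => by
      simp only [LinearMap.mem_ker] at hv ⊢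
      exact ⟨by rw [D.xx', hv, map_zero, smul_zero], by rw [hv, map_zero],
        by rw [D.yx, hv, map_zero, smul_zero], by rw [hXY₂, hv, map_zero, smul_zero]⟩
    exact hX₂v (LinearMap.mem_ker.1 (htop ▸ Submodule.mem_top))
  have hran : LinearMap.range D.X₂ = ⊤ := by
    refine h.simple _ ((Submodule.ne_bot_iff _).2 ⟨_, ⟨v₀, rfl⟩, hX₂v⟩) ?_
    rintro _ ⟨v, rfl⟩
    refine ⟨⟨(q₁ * l) • D.X₁ v, ?_⟩, ⟨_, rfl⟩, ⟨(q₁ * l)⁻¹ • D.Y₁ v, ?_⟩, ⟨q₂⁻¹ • D.Y₂ v, ?_⟩⟩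
    · rw [map_smul, D.xx]
    · rw [map_smul, D.yx']
    · rw [map_smul, hXY₂, inv_smul_smul₀ D.q₂_ne]
  obtain ⟨U₂, hU₂⟩ := (Module.End.isUnit_iff D.X₂).2
    ⟨LinearMap.ker_eq_bot.1 hker, LinearMap.range_eq_top.1 hran⟩
  refine ⟨⟨⟨D.X₁, (1 - q₁) • D.Y₁, ?_, ?_⟩, U₂, fun v => rfl, fun v => by rw [← hU₂]; rfl, hYX⟩⟩
  · ext v
    simp [hXY, smul_smul, mul_inv_cancel₀ hq]
  · ext v
    simp [hYX, smul_smul, mul_inv_cancel₀ hq]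

variable (T : Torus D)

/-- The monomial `X₁ ^ i X₂ ^ j`. -/
noncomputable def mono (i j : ℤ) : (Module.End ℂ M)ˣ := T.U₁ ^ i * T.U₂ ^ j

variable (D) in
/-- The commutation scalar `q₁ λ₁₂` of `X₁` and `X₂` as a unit. -/
noncomputable def qUnit : ℂˣ := Units.mk0 (q₁ * l) (mul_ne_zero D.q₁_ne D.l_ne)

theorem qUnit_zpow_val (k : ℤ) : ((qUnit D ^ k : ℂˣ) : ℂ) = (q₁ * l) ^ k := by
  simp [qUnit]

theorem U₁_mul_U₂ : T.U₁ * T.U₂ = scalarUnit M (qUnit D) * T.U₂ * T.U₁ := by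
  refine Units.ext (LinearMap.ext fun v => ?_)
  change T.U₁ • T.U₂ • v = (q₁ * l) • T.U₂ • T.U₁ • v
  rw [← T.X₂_eq, ← T.X₁_eq, ← T.X₂_eq, ← T.X₁_eq, D.xx]

theorem mono_mul (i j k m : ℤ) : T.mono i j * T.mono k m =
    scalarUnit M (qUnit D ^ (-(j * k))) * T.mono (i + k) (j + m) := by
  rw [map_zpow]
  exact monomial_mul_monomial T.U₁_mul_U₂ (scalarUnit_commute _ _) (scalarUnit_commute _ _) i j k m

theorem mono_zpow (i j p : ℤ) : T.mono i j ^ p =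
    scalarUnit M (qUnit D ^ (-(i * j * (p * (p - 1) / 2)))) * T.mono (p * i) (p * j) := by
  rw [map_zpow]
  exact monomial_zpow T.U₁_mul_U₂ (scalarUnit_commute _ _) (scalarUnit_commute _ _) i j p

theorem mono_smul_mono_smul (i j k m : ℤ) (v : M) : T.mono i j • T.mono k m • v =
    (q₁ * l) ^ (-(j * k)) • T.mono (i + k) (j + m) • v := by
  rw [← mul_smul, mono_mul, mul_smul, scalarUnit_smul, qUnit_zpow_val]

theorem U₁_smul (i j : ℤ) (v : M) : T.U₁ • T.mono i j • v = T.mono (i + 1) j • v := by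
  have := T.mono_smul_mono_smul 1 0 i j v
  rwa [zero_mul, neg_zero, zpow_zero, one_smul, zero_add, add_comm 1 i,
    show T.mono 1 0 = T.U₁ by simp [mono]] at this

theorem U₂_smul (i j : ℤ) (v : M) :
    T.U₂ • T.mono i j • v = (q₁ * l) ^ (-i) • T.mono i (j + 1) • v := by
  have := T.mono_smul_mono_smul 0 1 i j v
  rwa [one_mul, zero_add, add_comm 1 j, show T.mono 0 1 = T.U₂ by simp [mono]] at this

theorem smul_ne_zero {v : M} (hv : v ≠ 0) (u : (Module.End ℂ M)ˣ) : u • v ≠ 0 := fun h =>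
  hv (by rw [← inv_smul_smul u v, h, smul_zero])

theorem Y₁_eq (v : M) : D.Y₁ v = (1 - q₁)⁻¹ • T.U₁⁻¹ • v := by
  have := T.YX₁ (T.U₁⁻¹ • v)
  rwa [T.X₁_eq, smul_inv_smul] at this

theorem Y₂_eq {b : ℂ} {v : M} (hv : v ∈ D.W 0 b) :
    D.Y₂ v = (q₂ * b / (q₂ - 1)) • T.U₂⁻¹ • v := by
  have := D.XY₂ hv
  rw [T.X₂_eq, sub_zero] at this
  rw [smul_comm, ← this, inv_smul_smul]

theorem U₁_zpow_mem {b : ℂ} (i : ℤ) : ∀ v ∈ D.W 0 b, T.U₁ ^ i • v ∈ D.W 0 (q₁ ^ (-i) * b) := by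
  have hq := sub_ne_zero.2 D.q₁_ne'.symm
  induction i using Int.induction_on with
  | zero => simp
  | succ n ih =>
    intro v hv
    rw [add_comm, zpow_add, mul_smul, zpow_one, ← T.X₁_eq]
    refine D.X₁_mem (ih v hv) (mul_zero _) ?_
    rw [← mul_assoc, ← zpow_one_add₀ D.q₁_ne]
    congr 2
    ring
  | pred n ih =>
    intro v hv
    have h1 := T.Y₁_eq (T.U₁ ^ (-n : ℤ) • v)
    rw [eq_inv_smul_iff₀ hq, ← mul_smul, ← zpow_neg_one, ← zpow_add, neg_add_eq_sub] at h1
    rw [← h1]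
    refine Submodule.smul_mem _ _ (D.Y₁_mem (ih v hv) (mul_zero _).symm ?_)
    rw [← mul_assoc, ← zpow_one_add₀ D.q₁_ne]
    congr 2
    ring

theorem U₂_zpow_mem {b : ℂ} (hb : b ≠ 0) (j : ℤ) :
    ∀ v ∈ D.W 0 b, T.U₂ ^ j • v ∈ D.W 0 (q₂ ^ (-j) * b) := by
  induction j using Int.induction_on with
  | zero => simp
  | succ n ih =>
    intro v hv
    rw [add_comm, zpow_add, mul_smul, zpow_one, ← T.X₂_eq]
    refine D.X₂_mem (ih v hv) ?_
    rw [← mul_assoc, ← zpow_one_add₀ D.q₂_ne]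
    congr 2
    ring
  | pred n ih =>
    intro v hv
    have h1 := T.Y₂_eq (ih v hv)
    have hc : q₂ * (q₂ ^ (-(-(n : ℤ))) * b) / (q₂ - 1) ≠ 0 :=
      div_ne_zero (mul_ne_zero D.q₂_ne (mul_ne_zero (zpow_ne_zero _ D.q₂_ne) hb))
        (sub_ne_zero.2 D.q₂_ne')
    rw [← inv_smul_eq_iff₀ hc, ← mul_smul, ← zpow_neg_one T.U₂, ← zpow_add, neg_add_eq_sub] at h1
    rw [← h1]
    refine Submodule.smul_mem _ _ (D.Y₂_mem (ih v hv) ?_)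
    rw [← mul_assoc, ← zpow_one_add₀ D.q₂_ne]
    congr 2
    ring

theorem mono_mem {b : ℂ} (hb : b ≠ 0) {v : M} (hv : v ∈ D.W 0 b) (i j : ℤ) :
    T.mono i j • v ∈ D.W 0 (q₁ ^ (-i) * q₂ ^ (-j) * b) := by
  rw [mono, mul_smul, mul_assoc]
  exact T.U₁_zpow_mem i _ (T.U₂_zpow_mem hb j _ hv)

theorem mono_span (h : D.Good) {b : ℂ} (hb : b ≠ 0) {v : M} (hv : v ∈ D.W 0 b) (hv0 : v ≠ 0) :
    Submodule.span ℂ ((fun g : ℤ × ℤ => T.mono g.1 g.2 • v) '' Set.univ) = ⊤ := by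
  have hmem : ∀ (c : ℂ) (i j : ℤ), c • T.mono i j • v ∈
      Submodule.span ℂ ((fun g : ℤ × ℤ => T.mono g.1 g.2 • v) '' Set.univ) := fun c i j =>
    Submodule.smul_mem _ _ (Submodule.subset_span ⟨(i, j), trivial, rfl⟩)
  refine h.span_eq_top (s := (0, 0)) trivial (smul_ne_zero hv0 _) ?_ ?_ ?_ ?_
  · rintro ⟨i, j⟩ -
    rw [T.X₁_eq, U₁_smul, ← one_smul ℂ (T.mono _ _ • v)]
    exact hmem _ _ _
  · rintro ⟨i, j⟩ -
    rw [T.X₂_eq, U₂_smul]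
    exact hmem _ _ _
  · rintro ⟨i, j⟩ -
    have : T.U₁⁻¹ • T.mono i j • v = T.mono (i - 1) j • v := by
      rw [inv_smul_eq_iff, U₁_smul, sub_add_cancel]
    rw [T.Y₁_eq, this]
    exact hmem _ _ _
  · rintro ⟨i, j⟩ -
    have : T.U₂⁻¹ • T.mono i j • v = (q₁ * l) ^ i • T.mono i (j - 1) • v := by
      rw [inv_smul_eq_iff, smul_comm, U₂_smul, sub_add_cancel, smul_smul, zpow_neg,
        mul_inv_cancel₀ (zpow_ne_zero _ (mul_ne_zero D.q₁_ne D.l_ne)), one_smul]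
    rw [T.Y₂_eq (T.mono_mem hb hv i j), this, smul_smul]
    exact hmem _ _ _

theorem span_eq_top_of_mono (h : D.Good) {b : ℂ} (hb : b ≠ 0) {v : M} (hv : v ∈ D.W 0 b)
    (hv0 : v ≠ 0) {ι : Type*} {S : Set ι} {w : ι → M}
    (hw : ∀ i j, ∃ s ∈ S, ∃ c : ℂ, T.mono i j • v = c • w s) :
    Submodule.span ℂ (w '' S) = ⊤ := by
  rw [eq_top_iff, ← T.mono_span h hb hv hv0, Submodule.span_le]
  rintro _ ⟨⟨i, j⟩, -, rfl⟩
  obtain ⟨s, hs, c, hc⟩ := hw i j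
  change T.mono i j • v ∈ Submodule.span ℂ (w '' S)
  rw [hc]
  exact Submodule.smul_mem _ _ (Submodule.subset_span ⟨s, hs, rfl⟩)

/-- A monomial in the stabilizer of the weights acts on each weight space. -/
theorem mono_mem_of_mem_K₂ {b : ℂ} (hb : b ≠ 0) {g : ℤ × ℤ} (hg : g ∈ K₂ q₁ q₂) :
    ∀ v ∈ D.W 0 b, T.mono g.1 g.2 • v ∈ D.W 0 b := by
  intro v hv
  have h1 := T.mono_mem hb hv g.1 g.2
  have h2 : q₁ ^ (-g.1) * q₂ ^ (-g.2) = 1 := by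
    rw [zpow_neg, zpow_neg, ← mul_inv, show q₁ ^ g.1 * q₂ ^ g.2 = 1 from hg, inv_one]
  rwa [h2, one_mul] at h1

theorem mem_K₂_of_weight_eq {i j i' j' : ℤ} {b : ℂ} (hb : b ≠ 0) (hq₁ : q₁ ≠ 0) (hq₂ : q₂ ≠ 0)
    (h : q₁ ^ (-i) * q₂ ^ (-j) * b = q₁ ^ (-i') * q₂ ^ (-j') * b) :
    (i - i', j - j') ∈ K₂ q₁ q₂ := by
  have h1 := mul_right_cancel₀ hb h
  rw [zpow_neg, zpow_neg, zpow_neg, zpow_neg, ← mul_inv, ← mul_inv, inv_inj] at h1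
  change q₁ ^ (i - i') * q₂ ^ (j - j') = 1
  rw [zpow_sub₀ hq₁, zpow_sub₀ hq₂, div_mul_div_comm, h1]
  exact div_self (mul_ne_zero (zpow_ne_zero _ hq₁) (zpow_ne_zero _ hq₂))

theorem exists_mono_eigenvector (h : D.Good) {b : ℂ} (hb : b ≠ 0) (hW : D.W 0 b ≠ ⊥)
    {g : ℤ × ℤ} (hg : g ∈ K₂ q₁ q₂) : ∃ ρ : ℂ, ρ ≠ 0 ∧ ∃ v ∈ D.W 0 b, v ≠ 0 ∧
      T.mono g.1 g.2 • v = ρ • v := by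
  have := h.fin 0 b
  obtain ⟨ρ, v, hv, hv0, hρ⟩ := exists_eigenvector hW (T.mono g.1 g.2 : Module.End ℂ M)
    (T.mono_mem_of_mem_K₂ hb hg)
  refine ⟨ρ, ?_, v, hv, hv0, hρ⟩
  rintro rfl
  exact smul_ne_zero hv0 (T.mono g.1 g.2) (hρ.trans (zero_smul _ _))

end Torus

/-! ### The scalars between the standard monomials and those of the quantum torus -/

/-- The scalar `c` with `Z₁ ^ k = c X₁ ^ k`, where `Z₁ ^ k = Y₁ ^ (-k)` for `k < 0`. -/
noncomputable def norm₁ (q₁ : ℂ) (k : ℤ) : ℂ := (1 - q₁) ^ (-max 0 (-k))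

/-- The scalar `c` with `Z₂ ^ k = c X₂ ^ k` on vectors with `t₂ = z`, where
`Z₂ ^ k = Y₂ ^ (-k)` for `k < 0`. -/
noncomputable def norm₂ (q₂ z : ℂ) (k : ℤ) : ℂ :=
  z ^ max 0 (-k) * q₂ ^ (max 0 (-k) * (max 0 (-k) + 1) / 2)

theorem norm₁_of_nonneg (q₁ : ℂ) {k : ℤ} (hk : 0 ≤ k) : norm₁ q₁ k = 1 := by
  rw [norm₁, max_eq_left (by omega), neg_zero, zpow_zero]

theorem norm₁_of_nonpos (q₁ : ℂ) {k : ℤ} (hk : k ≤ 0) : norm₁ q₁ k = (1 - q₁) ^ k := by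
  rw [norm₁, max_eq_right (by omega), neg_neg]

theorem norm₂_of_nonneg (q₂ z : ℂ) {k : ℤ} (hk : 0 ≤ k) : norm₂ q₂ z k = 1 := by
  rw [norm₂, max_eq_left (by omega)]
  simp

theorem norm₂_of_nonpos (q₂ z : ℂ) {k : ℤ} (hk : k ≤ 0) :
    norm₂ q₂ z k = z ^ (-k) * q₂ ^ (-k * (-k + 1) / 2) := by
  rw [norm₂, max_eq_right (by omega)]

theorem norm₁_ne_zero {q₁ : ℂ} (hq : q₁ ≠ 1) (k : ℤ) : norm₁ q₁ k ≠ 0 :=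
  zpow_ne_zero _ (sub_ne_zero.2 hq.symm)

theorem norm₂_ne_zero {q₂ z : ℂ} (hq : q₂ ≠ 0) (hz : z ≠ 0) (k : ℤ) : norm₂ q₂ z k ≠ 0 :=
  mul_ne_zero (zpow_ne_zero _ hz) (zpow_ne_zero _ hq)

theorem ediv_two_eq {x y : ℤ} (h : x = 2 * y) : x / 2 = y := by omega

theorem exists_half (k : ℤ) : ∃ y, k * (k + 1) = 2 * y := by
  obtain ⟨y, hy⟩ := Int.even_mul_succ_self k
  exact ⟨y, by omega⟩

theorem norm₁_succ {q₁ : ℂ} (hq : q₁ ≠ 1) {i : ℤ} (hi : i < 0) :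
    norm₁ q₁ i = (1 - q₁)⁻¹ * norm₁ q₁ (i + 1) := by
  have h := sub_ne_zero.2 hq.symm
  rw [norm₁_of_nonpos _ hi.le, norm₁_of_nonpos _ (by omega), zpow_add_one₀ h]
  field_simp

theorem norm₂_succ {q₂ z : ℂ} (hq : q₂ ≠ 0) (hz : z ≠ 0) {j : ℤ} (hj : j < 0) :
    norm₂ q₂ z j = z * q₂ ^ (-j) * norm₂ q₂ z (j + 1) := by
  obtain ⟨y, hy⟩ := exists_half (-j)
  rw [norm₂_of_nonpos _ _ hj.le, norm₂_of_nonpos _ _ (by omega : j + 1 ≤ 0), ediv_two_eq hy,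
    ediv_two_eq (y := y + j) (by linarith), show -(j + 1) = -j - 1 by ring, zpow_sub_one₀ hz,
    zpow_add₀ hq, zpow_neg q₂]
  have := zpow_ne_zero j hq
  field_simp

theorem norm₁_mul {q₁ : ℂ} (hq : q₁ ≠ 1) (k n : ℤ) :
    norm₁ q₁ k * norm₁ q₁ n = mul₁ q₁ k n * norm₁ q₁ (k + n) := by
  have h := sub_ne_zero.2 hq.symm
  have key : ∀ x y u w : ℤ, x + y = u + w →
      (1 - q₁) ^ x * (1 - q₁) ^ y = (1 - q₁) ^ u * (1 - q₁) ^ w := fun x y u w hxy => by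
    rw [← zpow_add₀ h, ← zpow_add₀ h, hxy]
  have hm : mul₁ q₁ k n = (1 - q₁) ^ (if k * n < 0 then -min |k| |n| else 0) := by
    rw [mul₁]
    split_ifs <;> simp
  rw [hm, norm₁, norm₁, norm₁]
  apply key
  split_ifs with hkn
  · rcases mul_neg_iff.1 hkn with ⟨h1, h2⟩ | ⟨h1, h2⟩
    · rw [abs_of_pos h1, abs_of_neg h2]
      omega
    · rw [abs_of_neg h1, abs_of_pos h2]
      omega
  · rcases mul_nonneg_iff.1 (not_lt.1 hkn) with ⟨h1, h2⟩ | ⟨h1, h2⟩ <;> omega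

/-- The cocycle identity for `norm₂`: comparing `Z₂ ^ k Z₂ ^ n` with `Z₂ ^ (k + n)`. The power of
`q₂` on the left accounts for the change of `t₂` under `X₂ ^ n`. -/
theorem norm₂_mul {q₂ z : ℂ} (hq : q₂ ≠ 0) (hz : z ≠ 0) (k n : ℤ) :
    norm₂ q₂ z k * norm₂ q₂ z n * q₂ ^ (-(n * max 0 (-k))) =
      mul₂ q₂ z k n * norm₂ q₂ z (k + n) := by
  have key : ∀ a b c d e f g x y : ℤ, a + c = f + x → b + d + e = g + y →
      z ^ a * q₂ ^ b * (z ^ c * q₂ ^ d) * q₂ ^ e = z ^ f * q₂ ^ g * (z ^ x * q₂ ^ y) := by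
    intro a b c d e f g x y h1 h2
    calc _ = z ^ (a + c) * q₂ ^ (b + d + e) := by
          rw [zpow_add₀ hz, zpow_add₀ hq, zpow_add₀ hq]
          ring
      _ = _ := by
          rw [h1, h2, zpow_add₀ hz, zpow_add₀ hq]
          ring
  have h0 : mul₂ q₂ z k n = z ^ (if k * n < 0 then min |k| |n| else 0) *
      q₂ ^ (if k * n < 0 then (1 - 2 * n + n.sign * min |k| |n|) * min |k| |n| / 2 else 0) := by
    rw [mul₂]
    split_ifs <;> simp
  rw [h0, norm₂, norm₂, norm₂]
  apply key
  · split_ifs with hkn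
    · rcases mul_neg_iff.1 hkn with ⟨h1, h2⟩ | ⟨h1, h2⟩
      · rw [abs_of_pos h1, abs_of_neg h2]
        omega
      · rw [abs_of_neg h1, abs_of_pos h2]
        omega
    · rcases mul_nonneg_iff.1 (not_lt.1 hkn) with ⟨h1, h2⟩ | ⟨h1, h2⟩ <;> omega
  · obtain ⟨x, hx⟩ := exists_half k
    obtain ⟨y, hy⟩ := exists_half n
    have ek : -k * (-k + 1) / 2 = x - k := ediv_two_eq (by linarith)
    have en : -n * (-n + 1) / 2 = y - n := ediv_two_eq (by linarith)
    have ekn : -(k + n) * (-(k + n) + 1) / 2 = x + y - k - n + k * n := ediv_two_eq (by linarith)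
    have e0 : (0 : ℤ) * (0 + 1) / 2 = 0 := rfl
    split_ifs with hkn
    · rcases mul_neg_iff.1 hkn with ⟨h1, h2⟩ | ⟨h1, h2⟩
      · rw [abs_of_pos h1, abs_of_neg h2, Int.sign_eq_neg_one_of_neg h2,
          max_eq_left (by omega : -k ≤ 0), max_eq_right (by omega : 0 ≤ -n), e0, en]
        rcases le_total k (-n) with h3 | h3
        · have e : (1 - 2 * n + -1 * k) * k / 2 = x - k * k - n * k := ediv_two_eq (by linarith)
          rw [min_eq_left h3, max_eq_right (by omega : 0 ≤ -(k + n)), e, ekn]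
          linarith
        · have e : (1 - 2 * n + -1 * -n) * -n / 2 = y - n := ediv_two_eq (by linarith)
          rw [min_eq_right h3, max_eq_left (by omega : -(k + n) ≤ 0), e, e0]
          ring
      · rw [abs_of_neg h1, abs_of_pos h2, Int.sign_eq_one_of_pos h2,
          max_eq_right (by omega : 0 ≤ -k), max_eq_left (by omega : -n ≤ 0), e0, ek]
        rcases le_total (-k) n with h3 | h3
        · have e : (1 - 2 * n + 1 * -k) * -k / 2 = x - k + n * k := ediv_two_eq (by linarith)
          rw [min_eq_left h3, max_eq_left (by omega : -(k + n) ≤ 0), e, e0]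
          ring
        · have e : (1 - 2 * n + 1 * n) * n / 2 = n - y + 0 := ediv_two_eq (by linarith)
          rw [min_eq_right h3, max_eq_right (by omega : 0 ≤ -(k + n)), e, ekn]
          linarith
    · rcases mul_nonneg_iff.1 (not_lt.1 hkn) with ⟨h1, h2⟩ | ⟨h1, h2⟩
      · rw [max_eq_left (by omega : -k ≤ 0), max_eq_left (by omega : -n ≤ 0),
          max_eq_left (by omega : -(k + n) ≤ 0), e0]
        ring
      · rw [max_eq_right (by omega : 0 ≤ -k), max_eq_right (by omega : 0 ≤ -n),
          max_eq_right (by omega : 0 ≤ -(k + n)), ek, en, ekn]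
        ring

/-! ### Stabilizers of rank at most one -/

namespace Torus

variable {q₁ q₂ l : ℂ} {M : Type*} [AddCommGroup M] [Module ℂ M] {D : Rep q₁ q₂ l M}

theorem YX_of_mem {b : ℂ} {v : M} {i j : ℤ} (hv : v ∈ D.W 0 (q₁ ^ (-i) * q₂ ^ (-j) * b)) :
    D.Y₂ (D.X₂ v) = (b / (q₂ - 1) * q₁ ^ (-i) * q₂ ^ (-j)) • v := by
  rw [D.YX₂ hv]
  congr 1
  ring

theorem famN2Zero_of_weight (T : Torus D) (h : D.Good) {b : ℂ} (hb : b ≠ 0) (hW : D.W 0 b ≠ ⊥)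
    (hK : K₂ q₁ q₂ = {0}) : FamN2Zero q₁ q₂ l D.action := by
  obtain ⟨v, hv, hv0⟩ := Submodule.exists_mem_ne_zero_of_ne_bot hW
  have hz : b / (q₂ - 1) ≠ 0 := div_ne_zero hb (sub_ne_zero.2 D.q₂_ne')
  set z := b / (q₂ - 1) with hzdef
  have hn : ∀ i j, norm₁ q₁ i * norm₂ q₂ z j ≠ 0 := fun i j =>
    mul_ne_zero (norm₁_ne_zero D.q₁_ne' i) (norm₂_ne_zero D.q₂_ne hz j)
  have hmem : ∀ i j, (norm₁ q₁ i * norm₂ q₂ z j) • T.mono i j • v ∈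
      D.W 0 (q₁ ^ (-i) * q₂ ^ (-j) * b) := fun i j =>
    Submodule.smul_mem _ _ (T.mono_mem hb hv i j)
  refine ⟨hK, z, fun s => (norm₁ q₁ s.1 * norm₂ q₂ z s.2) • T.mono s.1 s.2 • v, hz,
    ⟨?_, ?_⟩, fun i j => ⟨?_, ?_, T.YX₁ _, YX_of_mem (hmem i j)⟩⟩
  · refine Rep.linearIndepOn_of_weight (D := D) (θ := 1) 1 (fun s _ => hmem s.1 s.2)
      (fun s _ => _root_.smul_ne_zero (hn s.1 s.2) (smul_ne_zero hv0 _)) (fun s _ => by simp) ?_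
    rintro ⟨i, j⟩ - ⟨i', j'⟩ - - h2 -
    have := mem_K₂_of_weight_eq hb D.q₁_ne D.q₂_ne h2
    rw [hK, Set.mem_singleton_iff, Prod.mk_eq_zero] at this
    exact Prod.ext (by simp only; omega) (by simp only; omega)
  · refine T.span_eq_top_of_mono h hb hv hv0 fun i j => ⟨(i, j), trivial, (_ : ℂ)⁻¹,
      (inv_smul_smul₀ (hn i j) _).symm⟩
  · change D.X₁ ((norm₁ q₁ i * norm₂ q₂ z j) • T.mono i j • v) = _
    rw [map_smul, T.X₁_eq, U₁_smul]
    split_ifs with hi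
    · simp only [norm₁_of_nonneg q₁ hi, norm₁_of_nonneg q₁ (show 0 ≤ i + 1 by omega)]
    · simp only [smul_smul, norm₁_succ D.q₁_ne' (not_le.1 hi), mul_assoc]
  · change D.X₂ ((norm₁ q₁ i * norm₂ q₂ z j) • T.mono i j • v) = _
    rw [map_smul, T.X₂_eq, U₂_smul]
    split_ifs with hj
    · simp only [smul_smul, norm₂_of_nonneg q₂ z hj, norm₂_of_nonneg q₂ z (show 0 ≤ j + 1 by omega)]
      rw [mul_comm]
    · simp only [smul_smul, norm₂_succ D.q₂_ne hz (not_le.1 hj)]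
      congr 1
      ring

theorem famN2One'_of_weight (T : Torus D) (h : D.Good) {b : ℂ} (hb : b ≠ 0) (hW : D.W 0 b ≠ ⊥) {n : ℤ}
    (hn : 0 < n) (hK : ∀ g : ℤ × ℤ, g ∈ K₂ q₁ q₂ ↔ ∃ m : ℤ, g = (0, m * n)) :
    FamN2One' q₁ q₂ l D.action := by
  have hg : ((0, n) : ℤ × ℤ) ∈ K₂ q₁ q₂ := (hK _).2 ⟨1, by simp⟩
  obtain ⟨ρ, hρ0, v, hv, hv0, hρ⟩ := T.exists_mono_eigenvector h hb hW hg
  have hz : b / (q₂ - 1) ≠ 0 := div_ne_zero hb (sub_ne_zero.2 D.q₂_ne')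
  set z := b / (q₂ - 1) with hzdef
  have hne := norm₁_ne_zero D.q₁_ne'
  have hmem : ∀ i j, norm₁ q₁ i • T.mono i j • v ∈ D.W 0 (q₁ ^ (-i) * q₂ ^ (-j) * b) :=
    fun i j => Submodule.smul_mem _ _ (T.mono_mem hb hv i j)
  have hQ : q₁ * l ≠ 0 := mul_ne_zero D.q₁_ne D.l_ne
  refine ⟨n, hn, hK, z, ρ, fun s => norm₁ q₁ s.1 • T.mono s.1 s.2 • v, hz, hρ0,
    ⟨?_, ?_⟩, fun i j hj => ⟨?_, ?_, T.YX₁ _, YX_of_mem (hmem i j)⟩⟩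
  · refine Rep.linearIndepOn_of_weight (D := D) (θ := 1) 1 (fun s _ => hmem s.1 s.2)
      (fun s _ => _root_.smul_ne_zero (hne s.1) (smul_ne_zero hv0 _)) (fun s _ => by simp) ?_
    rintro ⟨i, j⟩ ⟨-, hj⟩ ⟨i', j'⟩ ⟨-, hj'⟩ - h2 -
    obtain ⟨m, hm⟩ := (hK _).1 (mem_K₂_of_weight_eq hb D.q₁_ne D.q₂_ne h2)
    rw [Prod.mk.injEq] at hm
    exact Prod.ext (by simp only; omega) (Rep.mem_Ico_inj hj hj' ⟨m, by rw [hm.2, mul_comm]⟩)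
  · refine T.span_eq_top_of_mono h hb hv hv0 fun i j => ⟨(i, j % n), ⟨trivial,
      Int.emod_nonneg _ hn.ne', Int.emod_lt_of_pos _ hn⟩, ?_⟩
    have h1 : T.mono 0 n ^ (j / n) • v = ρ ^ (j / n) • v := zpow_smul_of_eigen hρ0 hρ _
    have h2 : T.mono i j • v = ρ ^ (j / n) • T.mono i (j % n) • v := by
      rw [smul_comm, ← h1, mono_zpow, mul_zero, zero_mul, zero_mul, neg_zero, zpow_zero, map_one,
        one_mul, mono_smul_mono_smul, mul_zero, neg_zero, zpow_zero, one_smul, add_zero,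
        mul_comm (j / n), Int.emod_add_mul_ediv]
    exact ⟨ρ ^ (j / n) * (norm₁ q₁ i)⁻¹, by
      rw [h2, mul_smul, inv_smul_smul₀ (hne i)]⟩
  · change D.X₁ (norm₁ q₁ i • T.mono i j • v) = _
    rw [map_smul, T.X₁_eq, U₁_smul]
    split_ifs with hi
    · simp only [norm₁_of_nonneg q₁ hi, norm₁_of_nonneg q₁ (show 0 ≤ i + 1 by omega)]
    · simp only [smul_smul, norm₁_succ D.q₁_ne' (not_le.1 hi)]
  · change D.X₂ (norm₁ q₁ i • T.mono i j • v) = _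
    rw [map_smul, T.X₂_eq, U₂_smul]
    split_ifs with hj'
    · simp only [smul_smul]
      rw [mul_comm]
    · have h1 : T.mono i (j + 1) • v = ρ • T.mono i 0 • v := by
        have := T.mono_smul_mono_smul i 0 0 n v
        rw [hρ] at this
        rw [show j + 1 = n by have := hj.2; omega, smul_comm, this]
        simp
      simp only [h1, smul_smul]
      congr 1
      ring

/-- The vectors are `Z₂`-normalized monomials applied to an eigenvector of `X₁ ^ a X₂ ^ b`, where
`(a, b)` generates the stabilizer. -/
theorem famN2One_of_weight (T : Torus D) (h : D.Good) {β : ℂ} (hβ : β ≠ 0) (hW : D.W 0 β ≠ ⊥) {a b : ℤ}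
    (ha : 0 < a) (hK : ∀ g : ℤ × ℤ, g ∈ K₂ q₁ q₂ ↔ ∃ n : ℤ, g = (n * a, n * b)) :
    FamN2One q₁ q₂ l D.action := by
  have hg : ((a, b) : ℤ × ℤ) ∈ K₂ q₁ q₂ := (hK _).2 ⟨1, by simp⟩
  obtain ⟨σ, hσ0, v, hv, hv0, hσ⟩ := T.exists_mono_eigenvector h hβ hW hg
  have hz : β / (q₂ - 1) ≠ 0 := div_ne_zero hβ (sub_ne_zero.2 D.q₂_ne')
  set z := β / (q₂ - 1) with hzdef
  have hne := norm₂_ne_zero D.q₂_ne hz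
  have hmem : ∀ i j, norm₂ q₂ z j • T.mono i j • v ∈ D.W 0 (q₁ ^ (-i) * q₂ ^ (-j) * β) :=
    fun i j => Submodule.smul_mem _ _ (T.mono_mem hβ hv i j)
  have hQ : q₁ * l ≠ 0 := mul_ne_zero D.q₁_ne D.l_ne
  have hr : rInv q₁ q₂ z 0 b ≠ 0 := by
    simp only [rInv, abs_zero, zpow_zero, one_mul]
    exact mul_ne_zero (zpow_ne_zero _ hz) (zpow_ne_zero _ D.q₂_ne)
  -- the parameter `ρ` absorbs all scalars that do not depend on `j`
  have hκ : rInv q₁ q₂ z 0 b * q₁ ^ (a * max 0 (-b)) * norm₂ q₂ z (-b) * q₁ ^ (a * b) ≠ 0 :=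
    mul_ne_zero (mul_ne_zero (mul_ne_zero hr (zpow_ne_zero _ D.q₁_ne)) (hne _))
      (zpow_ne_zero _ D.q₁_ne)
  set κ := rInv q₁ q₂ z 0 b * q₁ ^ (a * max 0 (-b)) * norm₂ q₂ z (-b) * q₁ ^ (a * b) with hκdef
  refine ⟨a, b, ha, hK, z, κ⁻¹ * σ, fun s => norm₂ q₂ z s.2 • T.mono s.1 s.2 • v, hz,
    mul_ne_zero (inv_ne_zero hκ) hσ0, ⟨?_, ?_⟩,
    fun i hi j => ⟨?_, ?_, T.YX₁ _, YX_of_mem (hmem i j)⟩⟩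
  · refine Rep.linearIndepOn_of_weight (D := D) (θ := 1) 1 (fun s _ => hmem s.1 s.2)
      (fun s _ => _root_.smul_ne_zero (hne s.2) (smul_ne_zero hv0 _)) (fun s _ => by simp) ?_
    rintro ⟨i, j⟩ ⟨hi, -⟩ ⟨i', j'⟩ ⟨hi', -⟩ - h2 -
    obtain ⟨m, hm⟩ := (hK _).1 (mem_K₂_of_weight_eq hβ D.q₁_ne D.q₂_ne h2)
    rw [Prod.mk.injEq] at hm
    obtain rfl := Rep.mem_Ico_inj hi hi' ⟨m, by rw [hm.1, mul_comm]⟩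
    have hm0 : m = 0 := by
      rcases mul_eq_zero.1 (hm.1.symm.trans (sub_self _)) with h3 | h3
      · exact h3
      · omega
    rw [hm0, zero_mul] at hm
    exact Prod.ext rfl (by simp only; omega)
  · refine T.span_eq_top_of_mono h hβ hv hv0 fun i j => ⟨(i % a, j - i / a * b),
      ⟨⟨Int.emod_nonneg _ ha.ne', Int.emod_lt_of_pos _ ha⟩, trivial⟩, ?_⟩
    have h1 : T.mono a b ^ (i / a) • v = σ ^ (i / a) • v := zpow_smul_of_eigen hσ0 hσ _
    rw [mono_zpow, mul_smul, scalarUnit_smul, qUnit_zpow_val] at h1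
    have h2 := T.mono_smul_mono_smul (i % a) (j - i / a * b) (i / a * a) (i / a * b) v
    rw [mul_comm (i / a) a, Int.emod_add_mul_ediv, sub_add_cancel] at h2
    rw [mul_comm (i / a) a, ← eq_inv_smul_iff₀ (zpow_ne_zero _ hQ)] at h1
    rw [h1, smul_comm, ← inv_smul_eq_iff₀ (zpow_ne_zero _ hQ)] at h2
    have h3 := inv_smul_smul₀ (hne (j - i / a * b)) (T.mono (i % a) (j - i / a * b) • v)
    have h4 := h2.symm
    rw [smul_comm (T.mono (i % a) _) (σ ^ (i / a)) v, ← h3, smul_smul, smul_smul, smul_smul] at h4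
    exact ⟨_, h4⟩
  · change D.X₁ (norm₂ q₂ z j • T.mono i j • v) = _
    rw [map_smul, T.X₁_eq, U₁_smul]
    split_ifs with hi'
    · rfl
    · rw [show i + 1 = a by have := hi.2; omega]
      have h1 := T.mono_smul_mono_smul 0 (j - b) a b v
      rw [hσ, zero_add, sub_add_cancel, smul_comm, ← inv_smul_eq_iff₀ (zpow_ne_zero _ hQ)] at h1
      simp only [← h1, smul_smul]
      congr 1
      have h2 := norm₂_mul D.q₂_ne hz j (-b)
      have h3 : q₂ ^ b = q₁ ^ (-a) := by
        rw [zpow_neg]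
        exact eq_inv_of_mul_eq_one_right hg
      rw [neg_mul, neg_neg, zpow_mul q₂, h3, ← zpow_mul, ← sub_eq_add_neg] at h2
      have h4 : q₁ ^ (a * (max 0 j + max 0 (-b))) * q₁ ^ (-a * max 0 (-j)) =
          q₁ ^ (a * max 0 (-b)) * q₁ ^ (a * b) * q₁ ^ (a * (j - b)) := by
        rw [← zpow_add₀ D.q₁_ne, ← zpow_add₀ D.q₁_ne, ← zpow_add₀ D.q₁_ne]
        congr 1
        have : j = max 0 j - max 0 (-j) := by omega
        nth_rewrite 3 [this]
        ring
      have h5 : ((q₁ * l) ^ (-((j - b) * a)))⁻¹ = q₁ ^ (a * (j - b)) * l ^ (a * (j - b)) := by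
        rw [zpow_neg, inv_inv, mul_zpow, mul_comm (j - b)]
      calc norm₂ q₂ z j * (((q₁ * l) ^ (-((j - b) * a)))⁻¹ * σ)
          = κ⁻¹ * κ * σ * norm₂ q₂ z j * (q₁ ^ (a * (j - b)) * l ^ (a * (j - b))) := by
            rw [h5, inv_mul_cancel₀ hκ]
            ring
        _ = rInv q₁ q₂ z 0 b * (q₁ ^ (a * (max 0 j + max 0 (-b))) * q₁ ^ (-a * max 0 (-j))) *
              l ^ (a * (j - b)) * (κ⁻¹ * σ) * (norm₂ q₂ z j * norm₂ q₂ z (-b)) := by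
            rw [h4]
            nth_rewrite 2 [hκdef]
            ring
        _ = rInv q₁ q₂ z 0 b * q₁ ^ (a * (max 0 j + max 0 (-b))) *
              l ^ (a * (j - b)) * (κ⁻¹ * σ) *
              (norm₂ q₂ z j * norm₂ q₂ z (-b) * q₁ ^ (-a * max 0 (-j))) := by
            ring
        _ = _ := by
            rw [h2]
            ring
  · change D.X₂ (norm₂ q₂ z j • T.mono i j • v) = _
    rw [map_smul, T.X₂_eq, U₂_smul, mul_zpow, zpow_neg l, ← inv_zpow l]
    split_ifs with hj
    · simp only [smul_smul, norm₂_of_nonneg q₂ z hj, norm₂_of_nonneg q₂ z (show 0 ≤ j + 1 by omega)]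
      rw [mul_comm]
    · simp only [smul_smul, norm₂_succ D.q₂_ne hz (not_le.1 hj)]
      congr 1
      ring

end Torus

/-! ### Stabilizers of rank two: the scalars -/

section Scalars

variable {q₁ q₂ l z : ℂ}

theorem zpow_mul_eq_of_mem_K₂ {g₁ g₂ : ℤ} (hg : q₁ ^ g₁ * q₂ ^ g₂ = 1) (x : ℤ) :
    q₁ ^ (g₁ * x) = q₂ ^ (-g₂ * x) := by
  rw [zpow_mul, zpow_mul, eq_inv_of_mul_eq_one_left hg, zpow_neg]

/-- The `p`-th power of `Z₁ ^ g₁ Z₂ ^ g₂` in terms of scalars. The power of `q₁ λ₁₂` is the one that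
reorders `(X₁ ^ g₁ X₂ ^ g₂) ^ p`. -/
theorem norm_zpow (hq₁ : q₁ ≠ 1) (hq₂ : q₂ ≠ 0) (hz : z ≠ 0) {g₁ g₂ : ℤ}
    (hg : q₁ ^ g₁ * q₂ ^ g₂ = 1) (h0 : 0 ≤ g₁) (p : ℤ) :
    (norm₁ q₁ g₁ * norm₂ q₂ z g₂) ^ p * (q₁ * l) ^ (-(g₁ * g₂ * (p * (p - 1) / 2))) =
      pow₂ q₁ q₂ l z g₁ g₂ p * (norm₁ q₁ (p * g₁) * norm₂ q₂ z (p * g₂)) := by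
  have h1 := sub_ne_zero.2 hq₁.symm
  obtain ⟨t, ht⟩ : ∃ t, p * (p - 1) = 2 * t := by
    obtain ⟨t, ht⟩ := exists_half (p - 1)
    exact ⟨t, by linarith⟩
  obtain ⟨y, hy⟩ := exists_half (-g₂)
  have e1 : -(p * g₂) * (-(p * g₂) + 1) / 2 = p * y + g₂ * g₂ * t :=
    ediv_two_eq (by linear_combination p * hy + g₂ ^ 2 * ht)
  have e2 : q₁ ^ (-(g₁ * g₂ * t)) = q₂ ^ (g₂ * g₂ * t) := by
    rw [mul_assoc, ← mul_neg, zpow_mul_eq_of_mem_K₂ hg]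
    congr 1
    ring
  suffices h : (norm₁ q₁ g₁ * norm₂ q₂ z g₂) ^ p * q₁ ^ (-(g₁ * g₂ * t)) =
      (if 0 ≤ p then q₁ ^ (-(g₁ * max 0 g₂ * t))
        else rInv q₁ q₂ z g₁ g₂ ^ (-p) * q₁ ^ (g₁ * max 0 (-g₂) * t)) *
      (norm₁ q₁ (p * g₁) * norm₂ q₂ z (p * g₂)) by
    rw [pow₂, ediv_two_eq ht, mul_zpow q₁, ← mul_assoc, h]
    ring
  rw [norm₁_of_nonneg q₁ h0, one_mul]
  split_ifs with hp
  · rw [norm₁_of_nonneg q₁ (mul_nonneg hp h0), one_mul]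
    rcases le_total 0 g₂ with hg₂ | hg₂
    · rw [norm₂_of_nonneg q₂ z hg₂, norm₂_of_nonneg q₂ z (mul_nonneg hp hg₂), max_eq_right hg₂]
      simp
    · rw [norm₂_of_nonpos q₂ z hg₂, norm₂_of_nonpos q₂ z (mul_nonpos_of_nonneg_of_nonpos hp hg₂),
        e1, e2, ediv_two_eq hy, max_eq_left hg₂, mul_zero, zero_mul, neg_zero, zpow_zero, one_mul,
        mul_zpow, ← zpow_mul, ← zpow_mul, mul_assoc, ← zpow_add₀ hq₂, neg_mul, mul_comm g₂,
        mul_comm y]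
  · replace hp := (not_le.1 hp).le
    rw [norm₁_of_nonpos q₁ (mul_nonpos_of_nonpos_of_nonneg hp h0), rInv, abs_of_nonneg h0]
    rcases le_total 0 g₂ with hg₂ | hg₂
    · rw [norm₂_of_nonneg q₂ z hg₂, norm₂_of_nonpos q₂ z (mul_nonpos_of_nonpos_of_nonneg hp hg₂),
        e1, e2, abs_of_nonneg hg₂, max_eq_left (by omega : -g₂ ≤ 0), mul_zero, zero_mul, zpow_zero,
        one_zpow, one_mul, mul_one, ediv_two_eq (x := (g₂ - 1) * g₂) (y := y) (by linarith),
        mul_zpow, mul_zpow, ← zpow_mul, ← zpow_mul, ← zpow_mul, zpow_add₀ hq₂]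
      have f1 : (1 - q₁) ^ (g₁ * -p) * (1 - q₁) ^ (p * g₁) = 1 := by
        rw [← zpow_add₀ h1, show g₁ * -p + p * g₁ = 0 by ring, zpow_zero]
      have f2 : z ^ (-g₂ * -p) * z ^ (-(p * g₂)) = 1 := by
        rw [← zpow_add₀ hz, show -g₂ * -p + -(p * g₂) = 0 by ring, zpow_zero]
      have f3 : q₂ ^ (y * -p) * q₂ ^ (p * y) = 1 := by
        rw [← zpow_add₀ hq₂, show y * -p + p * y = 0 by ring, zpow_zero]
      linear_combination (-q₂ ^ (g₂ * g₂ * t)) * (z ^ (-g₂ * -p) * z ^ (-(p * g₂)) *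
        (q₂ ^ (y * -p) * q₂ ^ (p * y)) * f1 + q₂ ^ (y * -p) * q₂ ^ (p * y) * f2 + f3)
    · rw [norm₂_of_nonpos q₂ z hg₂, norm₂_of_nonneg q₂ z (mul_nonneg_of_nonpos_of_nonpos hp hg₂),
        abs_of_nonpos hg₂, max_eq_right (by omega : 0 ≤ -g₂), neg_neg, ediv_two_eq hy,
        ediv_two_eq (x := (g₂ - 1) * -g₂) (y := -y) (by linarith), mul_neg g₁, neg_mul (g₁ * g₂),
        mul_zpow, mul_zpow, mul_zpow, ← zpow_mul, ← zpow_mul, ← zpow_mul, ← zpow_mul, ← zpow_mul]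
      have f1 : (1 - q₁) ^ (g₁ * -p) * (1 - q₁) ^ (p * g₁) = 1 := by
        rw [← zpow_add₀ h1, show g₁ * -p + p * g₁ = 0 by ring, zpow_zero]
      rw [neg_mul_neg, neg_mul, mul_neg g₂]
      linear_combination (-z ^ (-(g₂ * p)) * q₂ ^ (y * p) * q₁ ^ (-(g₁ * g₂ * t))) * f1

theorem mul₁_ne_zero (hq : q₁ ≠ 1) (k n : ℤ) : mul₁ q₁ k n ≠ 0 := by
  rw [mul₁]
  split_ifs
  exacts [zpow_ne_zero _ (sub_ne_zero.2 hq.symm), one_ne_zero]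

theorem mul₂_ne_zero (hq : q₂ ≠ 0) (hz : z ≠ 0) (k n : ℤ) : mul₂ q₂ z k n ≠ 0 := by
  rw [mul₂]
  split_ifs
  exacts [mul_ne_zero (zpow_ne_zero _ hz) (zpow_ne_zero _ hq), one_ne_zero]

theorem pow₂_ne_zero (hq₁ : q₁ ≠ 0) (hq₁' : q₁ ≠ 1) (hq₂ : q₂ ≠ 0) (hl : l ≠ 0) (hz : z ≠ 0)
    (g₁ g₂ p : ℤ) : pow₂ q₁ q₂ l z g₁ g₂ p ≠ 0 := by
  have h1 := sub_ne_zero.2 hq₁'.symm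
  rw [pow₂, rInv]
  split_ifs <;> simp [zpow_ne_zero, *]

/-- The product of `Z₁ ^ g₁ Z₂ ^ g₂` and `Z₁ ^ h₁ Z₂ ^ h₂` in terms of scalars. The power of `q₁ λ₁₂`
is the one that moves `X₁ ^ h₁` past `X₂ ^ g₂`. -/
theorem norm_mul (hq₁ : q₁ ≠ 0) (hq₁' : q₁ ≠ 1) (hq₂ : q₂ ≠ 0) (hz : z ≠ 0) {g₁ g₂ h₁ h₂ : ℤ}
    (hh : q₁ ^ h₁ * q₂ ^ h₂ = 1) :
    norm₁ q₁ g₁ * norm₂ q₂ z g₂ * (norm₁ q₁ h₁ * norm₂ q₂ z h₂) * (q₁ * l) ^ (-(g₂ * h₁)) =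
      q₁ ^ (-(h₁ * max 0 g₂)) * l ^ (-(h₁ * g₂)) * mul₁ q₁ g₁ h₁ * mul₂ q₂ z g₂ h₂ *
        (norm₁ q₁ (g₁ + h₁) * norm₂ q₂ z (g₂ + h₂)) := by
  have h1 := norm₂_mul hq₂ hz g₂ h₂
  rw [← neg_mul, ← zpow_mul_eq_of_mem_K₂ hh] at h1
  have h2 : q₁ ^ (-(g₂ * h₁)) = q₁ ^ (h₁ * max 0 (-g₂)) * q₁ ^ (-(h₁ * max 0 g₂)) := by
    rw [← zpow_add₀ hq₁]
    congr 1
    have : g₂ = max 0 g₂ - max 0 (-g₂) := by omega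
    nth_rewrite 1 [this]
    ring
  rw [mul_zpow, h2, mul_comm g₂ h₁]
  calc _ = q₁ ^ (-(h₁ * max 0 g₂)) * l ^ (-(h₁ * g₂)) * (norm₁ q₁ g₁ * norm₁ q₁ h₁) *
        (norm₂ q₂ z g₂ * norm₂ q₂ z h₂ * q₁ ^ (h₁ * max 0 (-g₂))) := by ring
    _ = _ := by
      rw [h1, norm₁_mul hq₁']
      ring

/-- With this form of `swap₂` it is clear that `ν` is a power of `q₁ λ₁₂`. -/
theorem swap₂_eq (k n : ℤ) : swap₂ q₂ k n = q₂ ^ (k * max 0 (-n) - n * max 0 (-k)) := by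
  have h0 : swap₂ q₂ k n = q₂ ^ (if k * n < 0 then
      (k - n) * min |k| |n| - (k.sign - n.sign) * min |k| |n| ^ 2 / 2 else 0) := by
    rw [swap₂]
    split_ifs <;> simp
  rw [h0]
  congr 1
  split_ifs with hkn
  · rcases mul_neg_iff.1 hkn with ⟨h1, h2⟩ | ⟨h1, h2⟩
    · rw [abs_of_pos h1, abs_of_neg h2, Int.sign_eq_neg_one_of_neg h2, Int.sign_eq_one_of_pos h1,
        max_eq_left (by omega : -k ≤ 0), max_eq_right (by omega : 0 ≤ -n)]
      rcases le_total k (-n) with h3 | h3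
      · rw [min_eq_left h3, ediv_two_eq (y := k ^ 2) (by ring)]
        ring
      · rw [min_eq_right h3, ediv_two_eq (y := n ^ 2) (by ring)]
        ring
    · rw [abs_of_neg h1, abs_of_pos h2, Int.sign_eq_neg_one_of_neg h1, Int.sign_eq_one_of_pos h2,
        max_eq_right (by omega : 0 ≤ -k), max_eq_left (by omega : -n ≤ 0)]
      rcases le_total (-k) n with h3 | h3
      · rw [min_eq_left h3, ediv_two_eq (y := -k ^ 2) (by ring)]
        ring
      · rw [min_eq_right h3, ediv_two_eq (y := -n ^ 2) (by ring)]
        ring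
  · rcases mul_nonneg_iff.1 (not_lt.1 hkn) with ⟨h1, h2⟩ | ⟨h1, h2⟩
    · rw [max_eq_left (by omega : -k ≤ 0), max_eq_left (by omega : -n ≤ 0)]
      ring
    · rw [max_eq_right (by omega : 0 ≤ -k), max_eq_right (by omega : 0 ≤ -n)]
      ring

end Scalars

namespace RankTwoChoice

variable {q₁ q₂ : ℂ} (c : RankTwoChoice q₁ q₂)

theorem mem_a : q₁ ^ c.a₁ * q₂ ^ c.a₂ = 1 := (c.mem_iff (c.a₁, c.a₂)).2 ⟨1, 0, by simp, by simp⟩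

theorem mem_b : q₁ ^ c.b₁ * q₂ ^ c.b₂ = 1 := (c.mem_iff (c.b₁, c.b₂)).2 ⟨0, 1, by simp, by simp⟩

theorem nu_eq (l : ℂ) (hq₁ : q₁ ≠ 0) (hq₂ : q₂ ≠ 0) : c.nu l = (q₁ * l) ^ c.d := by
  have h1 : swap₂ q₂ c.a₂ c.b₂ = q₁ ^ (-(c.a₁ * max 0 (-c.b₂)) + c.b₁ * max 0 (-c.a₂)) := by
    rw [swap₂_eq, zpow_add₀ hq₁, ← mul_neg, zpow_mul_eq_of_mem_K₂ c.mem_a,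
      zpow_mul_eq_of_mem_K₂ c.mem_b, ← zpow_add₀ hq₂]
    congr 1
    ring
  rw [nu, h1, mul_assoc, ← zpow_add₀ hq₁, mul_zpow, mul_comm]
  congr 2
  have h2 : c.b₂ = max 0 c.b₂ - max 0 (-c.b₂) := by omega
  have h3 : c.a₂ = max 0 c.a₂ - max 0 (-c.a₂) := by omega
  rw [d]
  linear_combination (-c.a₁) * h2 + c.b₁ * h3

theorem d₂_pos : 0 < c.d₂ := by
  have h : Int.gcd c.a₂ c.b₂ ≠ 0 := fun h => by
    rw [Int.gcd_eq_zero_iff] at h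
    have := c.det_pos
    rw [h.1, h.2] at this
    simp at this
  rw [d₂]
  omega

theorem d₂_mul_a : c.d₂ * (c.a₂ / c.d₂) = c.a₂ := Int.mul_ediv_cancel' (Int.gcd_dvd_left _ _)

theorem d₂_mul_b : c.d₂ * (c.b₂ / c.d₂) = c.b₂ := Int.mul_ediv_cancel' (Int.gcd_dvd_right _ _)

theorem d₁_eq : c.d₁ = c.a₁ * (c.b₂ / c.d₂) - c.b₁ * (c.a₂ / c.d₂) := by
  refine Int.ediv_eq_of_eq_mul_right c.d₂_pos.ne' ?_
  rw [d]
  linear_combination (-c.a₁) * c.d₂_mul_b + c.b₁ * c.d₂_mul_a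

theorem d₁_pos : 0 < c.d₁ := by
  have h1 : 0 < c.d := c.det_pos
  have h2 : c.d₂ * c.d₁ = c.d := by
    rw [d₁_eq, d]
    linear_combination c.a₁ * c.d₂_mul_b - c.b₁ * c.d₂_mul_a
  exact pos_of_mul_pos_right (h2 ▸ h1) c.d₂_pos.le

theorem bezout_div : c.a' * (c.a₂ / c.d₂) + c.b' * (c.b₂ / c.d₂) = 1 := by
  refine mul_left_cancel₀ c.d₂_pos.ne' ?_
  rw [mul_one, mul_add, mul_left_comm, d₂_mul_a, mul_left_comm, d₂_mul_b]
  exact c.bezout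

/-- The rectangle with sides `d₁`, `d₂` is a set of representatives of `ℤ² / K₂`. -/
theorem eq_of_sub_mem {i j i' j' : ℤ} (hi : i ∈ Set.Ico 0 c.d₁) (hj : j ∈ Set.Ico 0 c.d₂)
    (hi' : i' ∈ Set.Ico 0 c.d₁) (hj' : j' ∈ Set.Ico 0 c.d₂) (h : (i - i', j - j') ∈ K₂ q₁ q₂) :
    i = i' ∧ j = j' := by
  obtain ⟨m, n, h1, h2⟩ := (c.mem_iff _).1 h
  simp only at h1 h2
  have h3 : j - j' = c.d₂ * (m * (c.a₂ / c.d₂) + n * (c.b₂ / c.d₂)) := by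
    rw [h2]
    linear_combination (-m) * c.d₂_mul_a - n * c.d₂_mul_b
  obtain rfl := Rep.mem_Ico_inj hj hj' ⟨_, h3⟩
  have h4 : m * (c.a₂ / c.d₂) + n * (c.b₂ / c.d₂) = 0 := by
    rw [sub_self] at h3
    exact (mul_eq_zero.1 h3.symm).resolve_left c.d₂_pos.ne'
  refine ⟨Rep.mem_Ico_inj hi hi' ⟨m * c.b' - n * c.a', ?_⟩, rfl⟩
  rw [h1, d₁_eq]
  linear_combination (-(m * c.a₁ + n * c.b₁)) * c.bezout_div + (c.a₁ * c.a' + c.b₁ * c.b') * h4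

end RankTwoChoice

/-! ### Stabilizers of rank two: the modules -/

/-- If `u v = ν v u`, then `u ^ p` acts on `v ^ n • w` through the orders of `ν` and `v`, for an
eigenvector `w` of `u` and of `v ^ r`. -/
theorem zpow_smul_zpow_smul_of_eigen {M : Type*} [AddCommGroup M] [Module ℂ M]
    {u v : (Module.End ℂ M)ˣ} {w : M} {ν : ℂˣ} {ρ μ : ℂ} {r : ℤ} (hρ : ρ ≠ 0) (hμ : μ ≠ 0)
    (huv : u * v = scalarUnit M ν * v * u) (hu : u • w = ρ • w) (hv : v ^ r • w = μ • w)
    (hr : ν ^ r = 1) (p n' n'' : ℤ) :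
    u ^ p • v ^ (r * n' + n'') • w = ((ν : ℂ) ^ (p * n'') * ρ ^ p * μ ^ n') • v ^ n'' • w := by
  have h1 : u ^ p * v ^ (r * n' + n'') =
      scalarUnit M (ν ^ (p * n'')) * v ^ (r * n' + n'') * u ^ p := by
    rw [zpow_mul_zpow_of_mul_eq huv (scalarUnit_commute _ _) (scalarUnit_commute _ _), ← map_zpow,
      mul_add, zpow_add, mul_left_comm, zpow_mul ν r, hr, one_zpow, one_mul]
  rw [← mul_smul, h1, mul_smul, zpow_smul_of_eigen hρ hu, mul_smul, scalarUnit_smul,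
    add_comm (r * n'), zpow_add, mul_smul, zpow_mul v, smul_comm ((v ^ r) ^ n'),
    zpow_smul_of_eigen hμ hv, smul_comm (v ^ n''), smul_comm (v ^ n''), smul_smul, smul_smul,
    Units.val_zpow_eq_zpow_val]

namespace Torus

variable {q₁ q₂ l : ℂ} {M : Type*} [AddCommGroup M] [Module ℂ M] {D : Rep q₁ q₂ l M}
  {z : ℂ}

variable (D) in
/-- The scalar between `Z₁ ^ i Z₂ ^ j` and `X₁ ^ i X₂ ^ j` as a unit. -/
noncomputable def normUnit (hz : z ≠ 0) (i j : ℤ) : ℂˣ :=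
  Units.mk0 (norm₁ q₁ i * norm₂ q₂ z j)
    (mul_ne_zero (norm₁_ne_zero D.q₁_ne' i) (norm₂_ne_zero D.q₂_ne hz j))

/-- The monomial `Z₁ ^ i Z₂ ^ j`, as it acts on vectors with `t₂ = z`. -/
noncomputable def std (T : Torus D) (hz : z ≠ 0) (i j : ℤ) : (Module.End ℂ M)ˣ :=
  scalarUnit M (normUnit D hz i j) * T.mono i j

variable (T : Torus D) (hz : z ≠ 0)

theorem std_smul (i j : ℤ) (v : M) :
    T.std hz i j • v = (norm₁ q₁ i * norm₂ q₂ z j) • T.mono i j • v := by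
  rw [std, mul_smul, scalarUnit_smul]
  rfl

theorem std_zpow_smul {g₁ g₂ : ℤ} (hg : q₁ ^ g₁ * q₂ ^ g₂ = 1) (h0 : 0 ≤ g₁) (p : ℤ) (v : M) :
    T.std hz g₁ g₂ ^ p • v = pow₂ q₁ q₂ l z g₁ g₂ p • T.std hz (p * g₁) (p * g₂) • v := by
  rw [std, (scalarUnit_commute _ _).mul_zpow, ← map_zpow, mul_smul, mono_zpow, mul_smul,
    scalarUnit_smul, scalarUnit_smul, qUnit_zpow_val, smul_smul, std_smul, smul_smul,
    ← norm_zpow D.q₁_ne' D.q₂_ne hz hg h0, Units.val_zpow_eq_zpow_val]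
  rfl

theorem std_smul_std_smul {g₁ g₂ h₁ h₂ : ℤ} (hh : q₁ ^ h₁ * q₂ ^ h₂ = 1) (v : M) :
    T.std hz g₁ g₂ • T.std hz h₁ h₂ • v =
      (q₁ ^ (-(h₁ * max 0 g₂)) * l ^ (-(h₁ * g₂)) * mul₁ q₁ g₁ h₁ * mul₂ q₂ z g₂ h₂) •
        T.std hz (g₁ + h₁) (g₂ + h₂) • v := by
  rw [std_smul, std_smul, std_smul, smul_comm (T.mono g₁ g₂), mono_smul_mono_smul, smul_smul,
    smul_smul, smul_smul, ← norm_mul D.q₁_ne D.q₁_ne' D.q₂_ne hz hh]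

variable (c : RankTwoChoice q₁ q₂)

theorem std_eq_const_smul (p n : ℤ) (v : M) :
    T.std hz (p * c.a₁ + n * c.b₁) (p * c.a₂ + n * c.b₂) • v =
      c.const l z p n • T.std hz c.a₁ c.a₂ ^ p • T.std hz c.b₁ c.b₂ ^ n • v := by
  have hb : q₁ ^ (n * c.b₁) * q₂ ^ (n * c.b₂) = 1 := by
    rw [mul_comm n, mul_comm n, zpow_mul, zpow_mul, ← mul_zpow, c.mem_b, one_zpow]
  rw [std_zpow_smul T hz c.mem_a c.a₁_nonneg, std_zpow_smul T hz c.mem_b c.b₁_nonneg,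
    smul_comm (T.std hz _ _) (pow₂ _ _ _ _ _ _ _), std_smul_std_smul T hz hb, RankTwoChoice.const,
    eq_inv_smul_iff₀]
  · simp only [mul_smul]
  · have h1 := D.q₁_ne
    have h2 := D.l_ne
    have h3 := pow₂_ne_zero h1 D.q₁_ne' D.q₂_ne h2 hz
    have h4 := mul₁_ne_zero D.q₁_ne'
    have h5 := mul₂_ne_zero D.q₂_ne hz
    simp [h1, h2, h3, h4, h5, zpow_ne_zero]

/-- The two generators of the stabilizer commute up to `ν`, by `RankTwoChoice.nu_eq`. -/
theorem std_mul_std : T.std hz c.a₁ c.a₂ * T.std hz c.b₁ c.b₂ =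
    scalarUnit M (qUnit D ^ c.d) * T.std hz c.b₁ c.b₂ * T.std hz c.a₁ c.a₂ := by
  refine Units.ext (LinearMap.ext fun v => ?_)
  change T.std hz c.a₁ c.a₂ • T.std hz c.b₁ c.b₂ • v =
    scalarUnit M (qUnit D ^ c.d) • T.std hz c.b₁ c.b₂ • T.std hz c.a₁ c.a₂ • v
  have hQ : q₁ * l ≠ 0 := mul_ne_zero D.q₁_ne D.l_ne
  have h1 : ∀ i j k m : ℤ, T.std hz i j • T.std hz k m • v =
      (norm₁ q₁ i * norm₂ q₂ z j * (norm₁ q₁ k * norm₂ q₂ z m) * (q₁ * l) ^ (-(j * k))) •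
        T.mono (i + k) (j + m) • v := fun i j k m => by
    rw [std_smul, std_smul, smul_comm (T.mono i j), mono_smul_mono_smul, smul_smul, smul_smul]
  rw [scalarUnit_smul, qUnit_zpow_val, h1, h1, smul_smul, add_comm c.a₁, add_comm c.a₂]
  congr 1
  have : (q₁ * l) ^ c.d * (q₁ * l) ^ (-(c.b₂ * c.a₁)) = (q₁ * l) ^ (-(c.a₂ * c.b₁)) := by
    rw [← zpow_add₀ hQ, RankTwoChoice.d]
    congr 1
    ring
  linear_combination (-(norm₁ q₁ c.a₁ * norm₂ q₂ z c.a₂ * (norm₁ q₁ c.b₁ * norm₂ q₂ z c.b₂))) * this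

theorem std_mem {b : ℂ} (hb : b ≠ 0) {g₁ g₂ : ℤ} (hg : q₁ ^ g₁ * q₂ ^ g₂ = 1) {v : M}
    (hv : v ∈ D.W 0 b) : T.std hz g₁ g₂ • v ∈ D.W 0 b := by
  rw [std_smul]
  exact Submodule.smul_mem _ _ (T.mono_mem_of_mem_K₂ hb (g := (g₁, g₂)) hg v hv)

/-- The vectors are `X₁ ^ i X₂ ^ j B ^ k v`, where `A` and `B` are the monomials of the two
generators of the stabilizer, `v` is a joint eigenvector of `A` and `B ^ r`, and `r` is the order of
the scalar `ν` by which `A` and `B` commute. The two cases of `X₂` at the edge of the rectangle of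
indices come from `X₁ ^ i X₂ ^ d₂ = (1 - q₁) ^ s X₁ ^ (i + s) Z₁ ^ (-s) Z₂ ^ d₂`. -/
theorem famN2TwoFor_of_weight (T : Torus D) (c : RankTwoChoice q₁ q₂) (h : D.Good) {b : ℂ}
    (hb : b ≠ 0) (hW : D.W 0 b ≠ ⊥) :
    FamN2TwoFor q₁ q₂ l D.action c (b / (q₂ - 1)) := by
  have hz : b / (q₂ - 1) ≠ 0 := div_ne_zero hb (sub_ne_zero.2 D.q₂_ne')
  set z := b / (q₂ - 1) with hzdef
  have hQ : q₁ * l ≠ 0 := mul_ne_zero D.q₁_ne D.l_ne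
  have hν : ((qUnit D ^ c.d : ℂˣ) : ℂ) = c.nu l := by
    rw [qUnit_zpow_val, c.nu_eq l D.q₁_ne D.q₂_ne]
  have hAB := T.std_mul_std hz c
  have hconst := T.std_eq_const_smul hz c
  have hmemA := fun v => T.std_mem hz hb c.mem_a (v := v)
  have hmemB := fun v => T.std_mem hz hb c.mem_b (v := v)
  have hAdef := T.std_smul hz c.a₁ c.a₂
  have hBdef := fun n => T.std_zpow_smul hz c.mem_b c.b₁_nonneg n
  generalize hA : T.std hz c.a₁ c.a₂ = A at *
  generalize hB : T.std hz c.b₁ c.b₂ = B at *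
  have := h.fin 0 b
  obtain ⟨hr, ρ, μ, hρ0, hμ0, v, hv, hv0, hρ, hμ⟩ := exists_clock_shift hW (A : Module.End ℂ M) B
    (c.nu l) hmemA hmemB (fun v _ h0 => (smul_eq_zero_iff_eq A).1 h0)
    (fun v _ h0 => (smul_eq_zero_iff_eq B).1 h0) (fun v _ => by
      have := congrArg (fun u => u • v) hAB
      simp only [mul_smul, scalarUnit_smul, hν] at this
      exact this)
  have hrpow : (qUnit D ^ c.d) ^ (orderOf (c.nu l) : ℤ) = 1 := by
    refine Units.ext ?_
    rw [zpow_natCast, Units.val_pow_eq_pow_val, hν, pow_orderOf_eq_one, Units.val_one]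
  have hrz : (0 : ℤ) < orderOf (c.nu l) := by exact_mod_cast hr
  have hμz : B ^ (orderOf (c.nu l) : ℤ) • v = μ • v := by
    rw [zpow_natCast]
    exact hμ
  have hinj : ∀ k k' : ℤ, c.nu l ^ k = c.nu l ^ k' → (orderOf (c.nu l) : ℤ) ∣ k - k' := fun k k' =>
    (zpow_eq_zpow_iff_orderOf_dvd (hν ▸ Units.ne_zero _)).1
  refine ⟨hr, ?_⟩
  generalize (orderOf (c.nu l) : ℤ) = r at *
  have hact : ∀ p n n' n'' : ℤ, n = r * n' + n'' →
      A ^ p • B ^ n • v = (c.nu l ^ (p * n'') * ρ ^ p * μ ^ n') • B ^ n'' • v := by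
    rintro p _ n' n'' rfl
    rw [← hν]
    exact zpow_smul_zpow_smul_of_eigen hρ0 hμ0 hAB hρ hμz hrpow p n' n''
  have hBmem : ∀ k : ℤ, B ^ k • v ∈ D.W 0 b := fun k => by
    rw [hBdef]
    refine Submodule.smul_mem _ _ (T.std_mem hz hb ?_ hv)
    rw [mul_comm k, mul_comm k, zpow_mul, zpow_mul, ← mul_zpow, c.mem_b, one_zpow]
  have hmem := fun i j k => T.mono_mem hb (hBmem k) i j
  -- `X₁ ^ d₁` and `Z₁ ^ (-s) Z₂ ^ d₂` are in the stabilizer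
  have hd₁ : ∀ k k' k'' : ℤ, k - c.a₂ / c.d₂ = r * k' + k'' → T.mono c.d₁ 0 • B ^ k • v =
      (c.C₁ l z * c.nu l ^ (c.b₂ / c.d₂ * k'') * ρ ^ (c.b₂ / c.d₂) * μ ^ k') • B ^ k'' • v := by
    intro k k' k'' hk
    have h1 := hconst (c.b₂ / c.d₂) (-(c.a₂ / c.d₂)) (B ^ k • v)
    rw [show c.b₂ / c.d₂ * c.a₁ + -(c.a₂ / c.d₂) * c.b₁ = c.d₁ by rw [c.d₁_eq]; ring,
      show c.b₂ / c.d₂ * c.a₂ + -(c.a₂ / c.d₂) * c.b₂ = 0 by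
        linear_combination (c.a₂ / c.d₂) * c.d₂_mul_b - (c.b₂ / c.d₂) * c.d₂_mul_a,
      std_smul, norm₁_of_nonneg _ c.d₁_pos.le, norm₂_of_nonneg _ _ le_rfl, one_mul, one_smul,
      ← mul_smul (B ^ (-(c.a₂ / c.d₂))), ← zpow_add, hact _ _ k' k'' (by linarith),
      smul_smul (c.const l z _ _)] at h1
    rw [h1, RankTwoChoice.C₁]
    congr 1
    ring
  have hsd : ∀ i k k' k'' : ℤ, c.b' + k = r * k' + k'' → T.mono i c.d₂ • B ^ k • v =
      ((1 - q₁) ^ c.s * c.C₂ l z * c.nu l ^ (c.a' * k'') * ρ ^ c.a' * μ ^ k') •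
        T.mono (i + c.s) 0 • B ^ k'' • v := by
    intro i k k' k'' hk
    have h1 := hconst c.a' c.b' (B ^ k • v)
    rw [show c.a' * c.a₁ + c.b' * c.b₁ = -c.s by rw [RankTwoChoice.s]; ring,
      show c.a' * c.a₂ + c.b' * c.b₂ = c.d₂ from c.bezout, std_smul,
      norm₁_of_nonpos _ (neg_nonpos.2 c.shift_nonneg : -c.s ≤ 0), norm₂_of_nonneg _ _ c.d₂_pos.le, mul_one,
      ← mul_smul (B ^ c.b'), ← zpow_add, hact _ _ k' k'' hk, zpow_neg,
      inv_smul_eq_iff₀ (zpow_ne_zero _ (sub_ne_zero.2 D.q₁_ne'.symm))] at h1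
    have h2 := T.mono_smul_mono_smul (i + c.s) 0 (-c.s) c.d₂ (B ^ k • v)
    rw [zero_mul, neg_zero, zpow_zero, one_smul, zero_add, add_neg_cancel_right, h1] at h2
    rw [← h2, smul_comm (T.mono _ _), smul_comm (T.mono _ _), smul_comm (T.mono _ _),
      smul_smul ((1 - q₁) ^ c.s), smul_smul ((1 - q₁) ^ c.s * _), RankTwoChoice.C₂]
    congr 1
    ring
  refine ⟨ρ, μ, fun s => T.mono s.1 s.2.1 • B ^ s.2.2 • v, hρ0, hμ0, r, rfl, ⟨?_, ?_⟩, ?_⟩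
  · refine Rep.linearIndepOn_of_weight (D := D)
      (θ := fun s => (q₁ * l) ^ (s.2.1 * c.a₁ - c.a₂ * s.1) * (c.nu l ^ s.2.2 * ρ)) A
      (fun s _ => hmem s.1 s.2.1 s.2.2)
      (fun s _ => smul_ne_zero (smul_ne_zero hv0 _) _) ?_ ?_
    · rintro ⟨i, j, k⟩ -
      have h1 := hact 1 k 0 k (by ring)
      rw [zpow_one, one_mul, zpow_one, zpow_zero, mul_one] at h1
      change A • T.mono i j • B ^ k • v = _
      have h2 : A • T.mono i j • B ^ k • v =
          (q₁ * l) ^ (j * c.a₁ - c.a₂ * i) • T.mono i j • A • B ^ k • v := by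
        rw [hAdef, hAdef, smul_comm (T.mono i j) (norm₁ q₁ c.a₁ * _), mono_smul_mono_smul,
          mono_smul_mono_smul, smul_smul (norm₁ q₁ c.a₁ * _), smul_smul (_ ^ (j * c.a₁ - _)),
          smul_smul (_ ^ (j * c.a₁ - _) * _), add_comm i, add_comm j, sub_eq_neg_add, zpow_add₀ hQ,
          zpow_neg _ (j * c.a₁)]
        congr 1
        have := zpow_ne_zero (j * c.a₁) hQ
        field_simp
      rw [h2, h1, smul_comm (T.mono i j), smul_smul]
    · rintro ⟨i, j, k⟩ ⟨hi, hj, hk⟩ ⟨i', j', k'⟩ ⟨hi', hj', hk'⟩ - h2 h3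
      obtain ⟨rfl, rfl⟩ := c.eq_of_sub_mem hi hj hi' hj' (mem_K₂_of_weight_eq hb D.q₁_ne D.q₂_ne h2)
      have h4 := mul_right_cancel₀ hρ0 (mul_left_cancel₀ (zpow_ne_zero _ hQ) h3)
      obtain rfl := Rep.mem_Ico_inj hk hk' (hinj _ _ h4)
      rfl
  · refine T.span_eq_top_of_mono h hb hv hv0 fun i j => ?_
    -- subtract `J (-s, d₂)` and then a multiple of `(d₁, 0)`
    obtain ⟨J, hJ⟩ : ∃ J, J = j / c.d₂ := ⟨_, rfl⟩
    obtain ⟨I, hI⟩ : ∃ I, I = (i + J * c.s) / c.d₁ := ⟨_, rfl⟩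
    obtain ⟨p, hp⟩ : ∃ p, p = I * (c.b₂ / c.d₂) + J * c.a' := ⟨_, rfl⟩
    obtain ⟨n, hn⟩ : ∃ n, n = -(I * (c.a₂ / c.d₂)) + J * c.b' := ⟨_, rfl⟩
    refine ⟨((i + J * c.s) % c.d₁, j % c.d₂, n % r),
      ⟨⟨Int.emod_nonneg _ c.d₁_pos.ne', Int.emod_lt_of_pos _ c.d₁_pos⟩,
      ⟨Int.emod_nonneg _ c.d₂_pos.ne', Int.emod_lt_of_pos _ c.d₂_pos⟩,
      ⟨Int.emod_nonneg _ hrz.ne', Int.emod_lt_of_pos _ hrz⟩⟩, ?_⟩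
    have e1 : (i + J * c.s) % c.d₁ + (p * c.a₁ + n * c.b₁) = i := by
      have := Int.emod_add_mul_ediv (i + J * c.s) c.d₁
      rw [← hI] at this
      have h1 := c.d₁_eq
      rw [RankTwoChoice.s] at *
      rw [hp, hn]
      linear_combination this - I * h1
    have e2 : j % c.d₂ + (p * c.a₂ + n * c.b₂) = j := by
      have := Int.emod_add_mul_ediv j c.d₂
      rw [← hJ] at this
      have h1 : c.a' * c.a₂ + c.b' * c.b₂ = c.d₂ := c.bezout
      rw [hp, hn]
      linear_combination this + J * h1 + I * ((c.a₂ / c.d₂) * c.d₂_mul_b -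
        (c.b₂ / c.d₂) * c.d₂_mul_a)
    have h1 := hconst p n v
    rw [hact p n (n / r) (n % r) (by rw [add_comm, Int.emod_add_mul_ediv]), std_smul, smul_smul,
      ← eq_inv_smul_iff₀ (mul_ne_zero (norm₁_ne_zero D.q₁_ne' _) (norm₂_ne_zero D.q₂_ne hz _)),
      smul_smul] at h1
    have h2 := T.mono_smul_mono_smul ((i + J * c.s) % c.d₁) (j % c.d₂) (p * c.a₁ + n * c.b₁)
      (p * c.a₂ + n * c.b₂) v
    rw [e1, e2, h1, smul_comm (T.mono _ _), ← inv_smul_eq_iff₀ (zpow_ne_zero _ hQ), smul_smul] at h2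
    exact ⟨_, h2.symm⟩
  · intro i hi j hj k hk k₁' k₁'' k₂' k₂'' k₃' k₃'' _ e₁ _ e₂ _ e₃
    refine ⟨?_, ?_, T.YX₁ _, YX_of_mem (hmem i j k)⟩
    · change D.X₁ (T.mono i j • B ^ k • v) = _
      rw [T.X₁_eq, U₁_smul]
      split_ifs with hi'
      · rfl
      · have h1 := T.mono_smul_mono_smul 0 j c.d₁ 0 (B ^ k • v)
        rw [zero_add, add_zero, hd₁ k k₁' k₁'' e₁, smul_comm (T.mono _ _),
          ← inv_smul_eq_iff₀ (zpow_ne_zero _ hQ), smul_smul, zpow_neg, inv_inv, mul_zpow] at h1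
        rw [show i + 1 = c.d₁ by have := hi.2; omega, ← h1]
        simp only [mul_assoc]
    · change D.X₂ (T.mono i j • B ^ k • v) = _
      rw [T.X₂_eq, U₂_smul]
      congr 1
      split_ifs with hj' hi'
      · rfl
      · rw [show j + 1 = c.d₂ by have := hj.2; omega, hsd i k k₂' k₂'' e₂]
      · have h1 := T.mono_smul_mono_smul (i + c.s - c.d₁) 0 c.d₁ 0 (B ^ k₂'' • v)
        rw [zero_mul, neg_zero, zpow_zero, one_smul, sub_add_cancel, add_zero,
          hd₁ k₂'' k₃' k₃'' e₃, smul_comm (T.mono _ _)] at h1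
        rw [show j + 1 = c.d₂ by have := hj.2; omega, hsd i k k₂' k₂'' e₂, ← h1, smul_smul]
        congr 1
        have hν0 : c.nu l ≠ 0 := hν ▸ Units.ne_zero _
        rw [zpow_add₀ hν0, zpow_add₀ hρ0, zpow_add₀ hμ0, mul_comm k₃'']
        ring

end Torus

/-! ### The possible stabilizers -/

section Stabilizer

variable {q₁ q₂ : ℂ}

theorem mem_K₂_iff {g : ℤ × ℤ} : g ∈ K₂ q₁ q₂ ↔ q₁ ^ g.1 * q₂ ^ g.2 = 1 := Iff.rfl

/-- The projection of the stabilizer to the first coordinate is a subgroup of `ℤ`, hence cyclic. -/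
theorem exists_generator_of_image (hp : q₁ ≠ 0) (hq : q₂ ≠ 0) :
    ∃ n : ℤ, 0 ≤ n ∧ ∀ k : ℤ, (∃ m : ℤ, q₁ ^ k * q₂ ^ m = 1) ↔ n ∣ k := by
  let H : AddSubgroup ℤ :=
    { carrier := {k | ∃ m : ℤ, q₁ ^ k * q₂ ^ m = 1}
      zero_mem' := ⟨0, by simp⟩
      add_mem' := by
        rintro k k' ⟨m, hm⟩ ⟨m', hm'⟩
        refine ⟨m + m', ?_⟩
        rw [zpow_add₀ hp, zpow_add₀ hq, mul_mul_mul_comm, hm, hm', one_mul]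
      neg_mem' := by
        rintro k ⟨m, hm⟩
        exact ⟨-m, by rw [zpow_neg, zpow_neg, ← mul_inv, hm, inv_one]⟩ }
  obtain ⟨n, hn⟩ := Int.subgroup_cyclic H
  refine ⟨|n|, abs_nonneg n, fun k => ?_⟩
  rw [abs_dvd, ← Int.mem_zmultiples_iff, AddSubgroup.zmultiples_eq_closure, ← hn]
  rfl

/-- The Hermite normal form of the stabilizer. -/
theorem nonempty_rankTwoChoice (hq₁ : q₁ ≠ 0) (hq₂ : q₂ ≠ 0) (ho₁ : 0 < orderOf q₁)
    (ho₂ : 0 < orderOf q₂) : Nonempty (RankTwoChoice q₁ q₂) := by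
  obtain ⟨n, hn0, hn⟩ := exists_generator_of_image hq₂ hq₁
  have hnpos : 0 < n := by
    refine hn0.lt_of_ne' ?_
    rintro rfl
    have := (hn (orderOf q₂)).1 ⟨0, by simp [pow_orderOf_eq_one]⟩
    rw [zero_dvd_iff] at this
    omega
  have hN : (0 : ℤ) < orderOf q₁ := by exact_mod_cast ho₁
  have hb : ∃ b : ℤ, 0 ≤ b ∧ b < orderOf q₁ ∧ q₁ ^ b * q₂ ^ n = 1 := by
    obtain ⟨m, hm⟩ := (hn n).2 dvd_rfl
    refine ⟨m % orderOf q₁, Int.emod_nonneg _ hN.ne', Int.emod_lt_of_pos _ hN, ?_⟩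
    have h1 : q₁ ^ (m % orderOf q₁) = q₁ ^ m := (zpow_eq_zpow_iff_orderOf_dvd hq₁).2
      ⟨-(m / orderOf q₁), by linarith [Int.emod_add_mul_ediv m (orderOf q₁)]⟩
    rw [h1, mul_comm, hm]
  obtain ⟨b, hb0, hbN, hb⟩ := hb
  have hgcd : (Int.gcd 0 n : ℤ) = n := by rw [Int.gcd_zero_left, Int.natCast_natAbs, abs_of_pos hnpos]
  have hs : 0 ≤ (if b = 0 then 0 else 1) * (orderOf q₁ : ℤ) - b ∧
      (if b = 0 then 0 else 1) * (orderOf q₁ : ℤ) - b < orderOf q₁ := by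
    split_ifs <;> constructor <;> omega
  refine ⟨⟨orderOf q₁, 0, b, n, -(if b = 0 then 0 else 1), 1, hN.le, hb0, by simpa using mul_pos hN hnpos,
    fun g => ⟨fun hg => ?_, ?_⟩, ?_, ?_, ?_⟩⟩
  · rw [mem_K₂_iff] at hg
    obtain ⟨k, hk⟩ := (hn g.2).1 ⟨g.1, by rw [mul_comm, hg]⟩
    have h1 : q₁ ^ g.1 = q₁ ^ (b * k) := by
      rw [zpow_mul_eq_of_mem_K₂ hb, neg_mul, zpow_neg, ← hk]
      exact eq_inv_of_mul_eq_one_left hg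
    obtain ⟨m, hm⟩ := (zpow_eq_zpow_iff_orderOf_dvd hq₁).1 h1
    exact ⟨m, k, by linarith, by linarith⟩
  · rintro ⟨m, k, h1, h2⟩
    rw [mem_K₂_iff, h1, h2, zpow_add₀ hq₁, mul_comm m, zpow_mul q₁ _ m, zpow_natCast,
      pow_orderOf_eq_one, one_zpow, one_mul, mul_zero, zero_add, mul_comm k, mul_comm k, zpow_mul,
      zpow_mul, ← mul_zpow, hb, one_zpow]
  · rw [hgcd]
    ring
  · rw [neg_neg, one_mul]
    exact hs.1
  · rw [hgcd, neg_neg, one_mul, mul_zero, sub_zero, Int.mul_ediv_cancel _ hnpos.ne']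
    exact hs.2

theorem K₂_eq_zmultiples_of_orderOf_eq_zero (hq₁ : q₁ ≠ 0) (ho₁ : orderOf q₁ = 0)
    (ho₂ : 0 < orderOf q₂) (hq₂ : q₂ ≠ 0) (g : ℤ × ℤ) :
    g ∈ K₂ q₁ q₂ ↔ ∃ m : ℤ, g = (0, m * orderOf q₂) := by
  have hq₂z : q₂ ^ (orderOf q₂ : ℤ) = 1 := by rw [zpow_natCast, pow_orderOf_eq_one]
  constructor
  · intro hg
    rw [mem_K₂_iff] at hg
    have h1 := congrArg (· ^ (orderOf q₂ : ℤ)) hg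
    simp only [mul_zpow, one_zpow] at h1
    rw [← zpow_mul, ← zpow_mul, mul_comm g.2, zpow_mul q₂, hq₂z, one_zpow, mul_one,
      zpow_eq_one_iff_orderOf_dvd hq₁, ho₁, Nat.cast_zero, zero_dvd_iff, mul_eq_zero] at h1
    have h2 : g.1 = 0 := h1.resolve_right (by omega)
    rw [h2, zpow_zero, one_mul, zpow_eq_one_iff_orderOf_dvd hq₂] at hg
    obtain ⟨m, hm⟩ := hg
    exact ⟨m, Prod.ext h2 (by rw [hm, mul_comm])⟩
  · rintro ⟨m, rfl⟩
    rw [mem_K₂_iff, zpow_zero, one_mul, mul_comm, zpow_mul, hq₂z, one_zpow]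

/-- If `q₂` is not a root of unity, then the first coordinate is injective on the stabilizer. -/
theorem K₂_of_orderOf_eq_zero (hq₁ : q₁ ≠ 0) (hq₂ : q₂ ≠ 0) (ho₂ : orderOf q₂ = 0) :
    K₂ q₁ q₂ = {0} ∨ ∃ a b : ℤ, 0 < a ∧
      ∀ g : ℤ × ℤ, g ∈ K₂ q₁ q₂ ↔ ∃ m : ℤ, g = (m * a, m * b) := by
  have hinj : ∀ {i j : ℤ}, q₂ ^ i = q₂ ^ j → i = j := fun {i j} h => by
    rw [zpow_eq_zpow_iff_orderOf_dvd hq₂, ho₂, Nat.cast_zero, zero_dvd_iff] at h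
    omega
  obtain ⟨n, hn0, hn⟩ := exists_generator_of_image hq₁ hq₂
  rcases hn0.eq_or_lt with rfl | hnpos
  · left
    refine Set.eq_singleton_iff_unique_mem.2 ⟨by simp [K₂], fun g hg => ?_⟩
    rw [mem_K₂_iff] at hg
    have h1 : g.1 = 0 := zero_dvd_iff.1 ((hn _).1 ⟨_, hg⟩)
    rw [h1, zpow_zero, one_mul, ← zpow_zero q₂] at hg
    exact Prod.ext h1 (hinj hg)
  · right
    obtain ⟨b, hb⟩ := (hn n).2 dvd_rfl
    refine ⟨n, b, hnpos, fun g => ⟨fun hg => ?_, ?_⟩⟩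
    · rw [mem_K₂_iff] at hg
      obtain ⟨m, hm⟩ := (hn _).1 ⟨_, hg⟩
      refine ⟨m, Prod.ext (by rw [hm, mul_comm]) (hinj ?_)⟩
      rw [hm, zpow_mul_eq_of_mem_K₂ hb, neg_mul, zpow_neg] at hg
      simp only
      rw [mul_comm m]
      exact (inv_mul_eq_one₀ (zpow_ne_zero _ hq₂)).1 hg |>.symm
    · rintro ⟨m, rfl⟩
      rw [mem_K₂_iff, mul_comm m, mul_comm m, zpow_mul, zpow_mul, ← mul_zpow, hb, one_zpow]

end Stabilizer

theorem Rep.fam_of_weight_zero_left {q₁ q₂ l : ℂ} {M : Type*} [AddCommGroup M] [Module ℂ M]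
    {D : Rep q₁ q₂ l M} (h : D.Good) {b : ℂ} (hb : b ≠ 0) (hW : D.W 0 b ≠ ⊥) :
    FamN2Zero q₁ q₂ l D.action ∨ FamN2One q₁ q₂ l D.action ∨ FamN2One' q₁ q₂ l D.action ∨
      FamN2Two q₁ q₂ l D.action := by
  obtain ⟨T⟩ := Torus.nonempty h hb hW
  rcases (orderOf q₂).eq_zero_or_pos with ho₂ | ho₂
  · rcases K₂_of_orderOf_eq_zero D.q₁_ne D.q₂_ne ho₂ with hK | ⟨a, c, ha, hK⟩
    · exact Or.inl (T.famN2Zero_of_weight h hb hW hK)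
    · exact Or.inr (Or.inl (T.famN2One_of_weight h hb hW ha hK))
  rcases (orderOf q₁).eq_zero_or_pos with ho₁ | ho₁
  · exact Or.inr (Or.inr (Or.inl (T.famN2One'_of_weight h hb hW (by exact_mod_cast ho₂)
      (K₂_eq_zmultiples_of_orderOf_eq_zero D.q₁_ne ho₁ ho₂ D.q₂_ne))))
  · exact Or.inr (Or.inr (Or.inr ⟨nonempty_rankTwoChoice D.q₁_ne D.q₂_ne ho₁ ho₂, b / (q₂ - 1),
      div_ne_zero hb (sub_ne_zero.2 D.q₂_ne'), fun c => T.famN2TwoFor_of_weight c h hb hW⟩))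

end QWeyl

theorem theorem6p13 (q₁ q₂ l : ℂ) (hq₁ : q₁ ≠ 0) (hq₁' : q₁ ≠ 1) (hq₂ : q₂ ≠ 0) (hq₂' : q₂ ≠ 1)
    (hl : l ≠ 0) (M : Type*) [AddCommGroup M] [Module ℂ M] [Module (QWeyl.Alg q₁ q₂ l) M]
    [IsScalarTower ℂ (QWeyl.Alg q₁ q₂ l) M] (hsimple : IsSimpleModule (QWeyl.Alg q₁ q₂ l) M)
    (hweight : QWeyl.IsWeightModule q₁ q₂ l M) (hfin : QWeyl.IsLocallyFinite q₁ q₂ l M)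
    (hbreaks : QWeyl.NoProperInnerBreaks q₁ q₂ l M) :
    QWeyl.FamN0 q₁ (QWeyl.genAction q₁ q₂ l M) ∨
    QWeyl.FamN1Fin q₁ q₂ l (QWeyl.genAction q₁ q₂ l M) ∨
    QWeyl.FamN1High q₁ q₂ l (QWeyl.genAction q₁ q₂ l M) ∨
    QWeyl.FamN1Low q₁ q₂ l (QWeyl.genAction q₁ q₂ l M) ∨
    QWeyl.FamN1Cyc q₁ q₂ l (QWeyl.genAction q₁ q₂ l M) ∨
    QWeyl.FamN1Inf q₁ q₂ l (QWeyl.genAction q₁ q₂ l M) ∨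
    QWeyl.FamN2Zero q₁ q₂ l (QWeyl.genAction q₁ q₂ l M) ∨
    QWeyl.FamN2One q₁ q₂ l (QWeyl.genAction q₁ q₂ l M) ∨
    QWeyl.FamN2One' q₁ q₂ l (QWeyl.genAction q₁ q₂ l M) ∨
    QWeyl.FamN2Two q₁ q₂ l (QWeyl.genAction q₁ q₂ l M) ∨
    QWeyl.FamGenCyc q₁ q₂ l (QWeyl.genAction q₁ q₂ l M) ∨
    QWeyl.FamGen q₁ q₂ l (QWeyl.genAction q₁ q₂ l M) := by
  have h := QWeyl.repOfModule_good (hq₁ := hq₁) (hq₁' := hq₁') (hq₂ := hq₂) (hq₂' := hq₂')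
    (hl := hl) hsimple hweight hfin hbreaks
  change QWeyl.FamN0 q₁ (QWeyl.repOfModule M hq₁ hq₁' hq₂ hq₂' hl).action ∨ _
  obtain ⟨a, b, hW⟩ := h.exists_weight
  by_cases ha : a = 0
  · subst ha
    by_cases hb : b = 0
    · subst hb
      exact Or.inl (QWeyl.Rep.famN0_of_weight h hW)
    · rcases QWeyl.Rep.fam_of_weight_zero_left h hb hW with h1 | h1 | h1 | h1
      exacts [.inr (.inr (.inr (.inr (.inr (.inr (.inl h1)))))),
        .inr (.inr (.inr (.inr (.inr (.inr (.inr (.inl h1))))))),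
        .inr (.inr (.inr (.inr (.inr (.inr (.inr (.inr (.inl h1)))))))),
        .inr (.inr (.inr (.inr (.inr (.inr (.inr (.inr (.inr (.inl h1)))))))))]
  by_cases hb : b = 0
  · subst hb
    rcases QWeyl.Rep.fam_of_weight_zero_right h ha hW with h1 | h1 | h1 | h1 | h1
    exacts [.inr (.inl h1), .inr (.inr (.inl h1)), .inr (.inr (.inr (.inl h1))),
      .inr (.inr (.inr (.inr (.inl h1)))), .inr (.inr (.inr (.inr (.inr (.inl h1)))))]
  · rcases QWeyl.Rep.fam_of_generic_weight h ha hb hW with h1 | h1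
    exacts [.inr (.inr (.inr (.inr (.inr (.inr (.inr (.inr (.inr (.inr (.inl h1)))))))))),
      .inr (.inr (.inr (.inr (.inr (.inr (.inr (.inr (.inr (.inr (.inr h1))))))))))]
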